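/- Let $R$ be a discrete valuation ring with fraction field $K$, uniformizer $\pi$ and residue field $k$. Fix an algebraic closure $\Omega$ of $K$ and a valuation ring $V$ of $\Omega$ with $V\cap K=R$. For an intermediate field $F$, let $F^{\mathrm{sh}}$ be the field of elements of the separable closure of $F$ in $\Omega$ that are fixed by the inertia group of $V$ over $F$, and let $(F\cap V)^{\mathrm{sh}}=F^{\mathrm{sh}}\cap V$ be the strict Henselization of $F\cap V$. A subring $A\subseteq V$ reduces to a subring $k_A$ of the residue field of $V$. A polynomial $f\in R[y]$ is *tame* if its splitting field $L_f$ is separable over $K$ and, for the primes $\mathfrak M$ over $(\pi)$ in the integral closure of $R$ in $L_f$, the ramification index is nonzero in $k$ and the residue field extension is separable. Let $f\in R[y]$ be tame with invertible leading coefficient, $d=\deg f$, and let $h\ge 1$ be an integer. **The discrete Newton–Puiseux algorithm.** The data are a ring $A$, a uniformizer $\varpi$ with $\varpi^r=\pi$, a polynomial $f_{\mathrm{cur}}\in A[y]$, an exponent $N$ and a polynomial $P$ (the expansion found so far), such that a root $y$ of $f_{\mathrm{cur}}$ stands for the root $P(\varpi)+\varpi^N y$ of $f$. Start with $A=R$,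 $\varpi=\pi$, $r=1$, $f_{\mathrm{cur}}=f$, $P=0$, $N=0$. Slopes of Newton polygons are signed so that they are the valuations of roots, normalized by $v(\varpi)=1$. 1. Compute the Newton polygon of $f_{\mathrm{cur}}$. If it has a segment of infinite slope (that is, $f_{\mathrm{cur}}(0)=0$), stop for this segment, with output $(r,\varpi,P)$. 2. If there is no segment of strictly positive slope, go to 5 with $f_e:=f_{\mathrm{cur}}$; in the first pass, a segment of slope $0$ may also be chosen, and one then goes to 5 with $f_e:=f_{\mathrm{cur}}$. Otherwise choose a segment of slope $a/b>0$, $\gcd(a,b)=1$; choose a $b$-th root $\varpi'$ of $\varpi$, and replace $A,\varpi,r$ by $A[\varpi'],\varpi',br$, and rewrite $P$ as a polynomial in $\varpi'$. 3. Replace $N$ by $bN+a$ (this adds zeros to the expansion). 4. If $N\ge rh$, stop with output $(r,\varpi,P)$. Otherwise let $f_e=\varpi^{-m}f_{\mathrm{cur}}(\varpi^{a}y)$ with $m$ such that $f_e$ is primitive. 5. Choose an irreducible factor $\bar g$ over $k_A$ of the reduction $\bar f_e$. 6. Choose a lift $g\in A[y]$ of $\bar g$ of the same degree, and a root $c$ of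 $g$. 7. Replace $P$ by $P+cX^N$. 8. Replace $A$ by $A[c]$ and $f_{\mathrm{cur}}$ by $f_e(y+c)$, and return to 1. The segments, the factors $\bar g$ and the roots $c$ are branched over; the roots $\varpi'$ and the lifts $g$ are given by an arbitrary fixed rule. **Theorem.** Fix any such rule and any $\varpi_d\in\Omega$ with $\varpi_d^{d!}=\pi$. Let $B$ be the valuation ring $K^{\mathrm{sh}}(\varpi_d)\cap V$ of $K^{\mathrm{sh}}(\pi^{1/d!})$. Then the algorithm correctly computes the power series expansions of the roots of $f$ up to height $rh$: - At every stage, $r\ge1$ divides $d!$, $\varpi^r=\pi$, $K^{\mathrm{sh}}(\varpi)\subseteq K^{\mathrm{sh}}(\varpi_d)$, $A\subseteq (K(\varpi)\cap V)^{\mathrm{sh}}$, and the current polynomial has coefficients in $A$. In particular all Kummer extensions used stay inside $K^{\mathrm{sh}}(\pi^{1/d!})$. - All steps can be carried out: whenever Step 5 is reached, $k_A$ is a field and all irreducible factors of $\bar f_e$ are separable; if $d\ge1$, every unfinished branch can be continued. - The algorithm terminates: the number of steps in a branch is bounded. - For every output $(r,\varpi,P)$ there is a root $\gamma$ of $f$,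 and for every root $\gamma$ of $f$ there is an output $(r,\varpi,P)$, such that $P=\sum_{i<rh}c_iX^i$ gives the expansion of $\gamma$ up to height $rh$. This means: $\gamma\in B$, all $c_i$ lie in the strict Henselization $(K(\varpi)\cap V)^{\mathrm{sh}}$ of $R[\pi^{1/r}]=R[\varpi]$, and $\gamma-\sum_{i<rh}c_i\varpi^i\in\varpi^{rh}B$; moreover, for every set of representatives $S$ in $(K(\varpi)\cap V)^{\mathrm{sh}}$ of its residue field that contains $0$ and all the $c_i$, the $c_i$ are the only elements of $S$ with this property. -/

import Mathlib

open Polynomial IntermediateField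

noncomputable section

namespace DiscreteNP

/-! ### Tame polynomials -/

section Tame

variable (R K : Type*) [CommRing R] [IsLocalRing R] [Field K] [Algebra R K]

/-- The splitting field over `K` of a polynomial with coefficients in `R`. -/
abbrev SplitField (f : R[X]) : Type _ := (f.map (algebraMap R K)).SplittingField

/-- A polynomial `f` over a discrete valuation ring `R` with fraction field `K` is tame if its
splitting field is separable over `K` and if, for the primes `𝔐` of the integral closure of `R` in
the splitting field lying over the maximal ideal of `R` (they are all conjugate), the
ramification index is nonzero in the residue field of `R` (it is coprime to the residue
characteristic when this is positive) and the extension of residue fields is separable. -/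
def IsTame (f : R[X]) : Prop :=
  Algebra.IsSeparable K (SplitField R K f) ∧
  ∀ 𝔐 : Ideal (integralClosure R (SplitField R K f)), 𝔐.IsPrime →
    ∀ _ : 𝔐.LiesOver (IsLocalRing.maximalIdeal R),
      ((𝔐.ramificationIdx R : ℕ) : IsLocalRing.ResidueField R) ≠ 0 ∧
      Algebra.IsSeparable (R ⧸ IsLocalRing.maximalIdeal R)
        (integralClosure R (SplitField R K f) ⧸ 𝔐)

end Tame

variable {E : Type*} [Field E]

/-! ### Strict Henselizations

`E` is an algebraic closure of `K` and `V` is a valuation ring of `E` with `V ∩ K = R`; choosing `V`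
amounts to choosing a prime over the maximal ideal of `R` in the integral closure of `R`. -/

section Henselization

variable (F : Type*) [Field F] [Algebra F E] (V : ValuationSubring E)

/-- The fraction field of the strict Henselization of the valuation ring `F ∩ V`:
the elements of the separable closure of `F` in `E` that are fixed by the inertia group of `V`
over `F`. -/
def strictHenselField : IntermediateField F E :=
  separableClosure F E ⊓
    fixedField ((V.inertiaSubgroup F).map (V.decompositionSubgroup F).subtype)

/-- The strict Henselization of the valuation ring `F ∩ V`. -/
def strictHenselRing : Subring E :=
  (strictHenselField F V).toSubfield.toSubring ⊓ V.toSubring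

/-- The field `F^sh(ϖ)`, for an element `ϖ` of `E`. -/
def kummerField (ϖ : E) : IntermediateField F E :=
  strictHenselField F V ⊔ F⟮ϖ⟯

end Henselization

/-! ### Reduction of subrings of the valuation ring -/

section Reduction

variable (V : ValuationSubring E) (A : Subring E)

/-- A subring `A ⊆ V` of `E`, seen as a subring of `V`. -/
def inside : Subring V := A.comap V.subtype

/-- The inclusion of `A` into `E`. -/
def incl : inside V A →+* E := V.subtype.comp (inside V A).subtype

/-- The residue field of `A`, as a subring of the residue field of `V`. -/
def resField : Subring (IsLocalRing.ResidueField V) :=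
  ((IsLocalRing.residue V).comp (inside V A).subtype).range

/-- The reduction map from `A` onto its residue field. -/
def red : inside V A →+* resField V A :=
  ((IsLocalRing.residue V).comp (inside V A).subtype).rangeRestrict

/-- The polynomial `p` has coefficients in `A` and is primitive: at least one coefficient is a unit
in the valuation ring. -/
def IsPrimitiveOver (p : E[X]) : Prop :=
  (∀ i, p.coeff i ∈ A) ∧ ∃ i, V.valuation (p.coeff i) = 1

/-- The ring `A[x]` generated by `A` and `x`. -/
def adjoinElem (x : E) : Subring E := Subring.closure (insert x (A : Set E))

/-- The Newton polygon of `p`, with respect to the valuation `v` normalized by `v ϖ = 1`, has a line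
segment of slope `a / b`. Slopes are counted so that they are the valuations of the
roots: the lower boundary of the convex hull of the points `(l, v (p.coeff l))` contains a
segment, joining the points with indices `i < j`, along which `y + (a / b) x` is constant, and no
point has a smaller value of `y + (a / b) x`. The valuation is written multiplicatively here,
and everything is multiplied by `b`. -/
def HasSlope (ϖ : E) (p : E[X]) (a b : ℕ) : Prop :=
  ∃ i j : ℕ, i < j ∧ p.coeff i ≠ 0 ∧ p.coeff j ≠ 0 ∧
    V.valuation (p.coeff i) ^ b * V.valuation ϖ ^ (a * i) =
      V.valuation (p.coeff j) ^ b * V.valuation ϖ ^ (a * j) ∧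
    ∀ l, V.valuation (p.coeff l) ^ b * V.valuation ϖ ^ (a * l) ≤
      V.valuation (p.coeff i) ^ b * V.valuation ϖ ^ (a * i)

end Reduction

/-! ### The algorithm -/

/-- The data carried along a branch of the algorithm. -/
structure State (E : Type*) [Field E] where
  /-- the current base ring -/
  A : Subring E
  /-- the current uniformizer, an `r`-th root of the original one -/
  ϖ : E
  /-- the degree of the Kummer extension made so far -/
  r : ℕ
  /-- the current polynomial -/
  f : E[X]
  /-- the expansion found so far: the coefficient of `X ^ i` is the coefficient of `ϖ ^ i` -/
  P : E[X]
  /-- the current exponent: a root `y` of `f` stands for the root `P(ϖ) + ϖ ^ N * y` of the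
  original polynomial -/
  N : ℕ
  /-- the number of completed passes through the loop -/
  pass : ℕ

/-- The choices that the algorithm leaves to its user: the roots of the uniformizer
that are adjoined, and the lifts, of the same degree, of irreducible polynomials over the residue
field of the current ring. -/
structure Choices (V : ValuationSubring E) where
  root : State E → ℕ → E
  root_pow : ∀ s b, 0 < b → root s b ^ b = s.ϖ
  lift : ∀ s : State E, (resField V s.A)[X] → (inside V s.A)[X]
  lift_map : ∀ s g, (lift s g).map (red V s.A) = g
  lift_natDegree : ∀ s g, (lift s g).natDegree = g.natDegree

/-- The positions of the algorithm: about to compute a Newton polygon, about to factor a reduction,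
or terminated. -/
inductive Config (E : Type*) [Field E] where
  | polygon (s : State E)
  | residual (s : State E)
  | done (s : State E)

/-- The data of a configuration. -/
def Config.state : Config E → State E
  | .polygon s => s
  | .residual s => s
  | .done s => s

section Algorithm

variable {V : ValuationSubring E}

/-- The update for a line segment of slope `a / b`: adjoin a `b`-th root of the uniformizer,
rewrite the expansion in terms of this root, and add zeros to the expansion, so that all coefficients of
exponent `< b * N + a` are now known. -/
def extend (ch : Choices V) (s : State E) (a b : ℕ) : State E where
  A := adjoinElem s.A (ch.root s b)
  ϖ := ch.root s b
  r := b * s.r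
  f := s.f
  P := Polynomial.expand E b s.P
  N := b * s.N + a
  pass := s.pass

/-- The update for a root `c` of a lift of an irreducible factor: record `c` as the coefficient
of `ϖ ^ N`, translate the polynomial, and replace the ring by the étale extension `A[c]`. -/
def translate (s : State E) (c : E) : State E where
  A := adjoinElem s.A c
  ϖ := s.ϖ
  r := s.r
  f := s.f.comp (X + C c)
  P := s.P + C c * X ^ s.N
  N := s.N
  pass := s.pass + 1

/-- `g` is an irreducible factor of the reduction of the polynomial of `s` to the residue field of
the ring of `s`. -/
def IsIrredFactor (V : ValuationSubring E) (s : State E) (g : (resField V s.A)[X]) : Prop :=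
  Irreducible g ∧
    ∃ p : (inside V s.A)[X], p.map (incl V s.A) = s.f ∧ g ∣ p.map (red V s.A)

/-- One step of the discrete Newton-Puiseux algorithm with target height `h`
(relative to the original uniformizer; after a Kummer extension of degree `r` it is `r * h`). All
line segments, irreducible factors and roots of lifts can be chosen; the runs of the algorithm
are the branches that result from these choices. -/
inductive Step (ch : Choices V) (h : ℕ) : Config E → Config E → Prop
  /-- A segment of infinite slope: an exact root has been found. -/
  | infinite (s : State E) (h0 : s.f.coeff 0 = 0) : Step ch h (.polygon s) (.done s)
  /-- There is no segment of strictly positive slope: reduce the polynomial itself. -/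
  | flat (s : State E) (h0 : s.f.coeff 0 ≠ 0)
      (hs : ∀ a b : ℕ, 0 < a → 0 < b → ¬ HasSlope V s.ϖ s.f a b) :
      Step ch h (.polygon s) (.residual s)
  /-- In the first pass, a segment of slope zero can be chosen: reduce the polynomial itself. -/
  | zero (s : State E) (h0 : s.pass = 0) (hs : HasSlope V s.ϖ s.f 0 1) :
      Step ch h (.polygon s) (.residual s)
  /-- A segment of slope `a / b > 0`, and the precision reaches the target height. -/
  | halt (s : State E) (a b : ℕ) (ha : 0 < a) (hb : 0 < b) (hab : a.Coprime b)
      (hs : HasSlope V s.ϖ s.f a b) (hN : (extend ch s a b).r * h ≤ (extend ch s a b).N) :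
      Step ch h (.polygon s) (.done (extend ch s a b))
  /-- A segment of slope `a / b > 0`, and the precision does not reach the target height:
  scale by `y ↦ ϖ ^ a * y` and divide by a power of `ϖ` to make the polynomial primitive. -/
  | scale (s : State E) (a b : ℕ) (ha : 0 < a) (hb : 0 < b) (hab : a.Coprime b)
      (hs : HasSlope V s.ϖ s.f a b) (hN : (extend ch s a b).N < (extend ch s a b).r * h)
      (m : ℕ) (fe : E[X])
      (hfe : C ((extend ch s a b).ϖ ^ m) * fe = s.f.comp (C ((extend ch s a b).ϖ ^ a) * X))
      (hprim : IsPrimitiveOver V (extend ch s a b).A fe) :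
      Step ch h (.polygon s) (.residual { extend ch s a b with f := fe })
  /-- An irreducible factor `g` of the reduction, and a root `c` of its lift. -/
  | factor (s : State E) (g : (resField V s.A)[X]) (hg : IsIrredFactor V s g)
      (c : E) (hc : (ch.lift s g).eval₂ (incl V s.A) c = 0) :
      Step ch h (.residual s) (.polygon (translate s c))

/-- The starting point: the base ring `R`, its uniformizer `π`, and the empty expansion. -/
def init (E : Type*) [Field E] {R : Type*} [CommRing R] [Algebra R E] (π : R) (f : R[X]) :
    Config E :=
  .polygon {
    A := (algebraMap R E).range
    ϖ := algebraMap R E π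
    r := 1
    f := f.map (algebraMap R E)
    P := 0
    N := 0
    pass := 0 }

/-- The configuration `x` occurs in some run of the algorithm on the input `f`, `h`. -/
def Reachable {R : Type*} [CommRing R] [Algebra R E] (ch : Choices V) (h : ℕ) (π : R) (f : R[X])
    (x : Config E) : Prop :=
  Relation.ReflTransGen (Step ch h) (init E π f) x

end Algorithm

/-! ### Power series expansions -/

/-- `S` is a set of representatives in `B` of the residue field of `B`, where `B` is a subring of
`V` whose maximal ideal consists of the elements in the maximal ideal of `V`. -/
def IsRepresentatives (V : ValuationSubring E) (B : Subring E) (S : Set E) : Prop :=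
  (0 : E) ∈ S ∧ S ⊆ B ∧ ∀ x ∈ B, ∃! s, s ∈ S ∧ V.valuation (x - s) < 1

/-- `γ = P(ϖ) + O(ϖ ^ H)` in the ring `B`, where `P` is of degree `< H`. -/
def Approximates (B : Subring E) (ϖ : E) (H : ℕ) (γ : E) (P : E[X]) : Prop :=
  P.degree < (H : WithBot ℕ) ∧ ∃ t ∈ B, γ = P.eval ϖ + ϖ ^ H * t

/-- The coefficients of `P` are those of the `ϖ`-adic power series expansion of `γ ∈ B` up to
height `H`: they lie in `B'`, they give `γ` up to `O(ϖ ^ H)`, and for every set of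
representatives `S ⊆ B'` of the residue field that contains them, they are the only ones in `S`
with this property. -/
def IsExpansion (V : ValuationSubring E) (B' B : Subring E) (ϖ : E) (H : ℕ) (γ : E) (P : E[X]) :
    Prop :=
  γ ∈ B ∧ (∀ i, P.coeff i ∈ B') ∧ Approximates B ϖ H γ P ∧
    ∀ S : Set E, IsRepresentatives V B' S → (∀ i, P.coeff i ∈ S) →
      ∀ Q : E[X], (∀ i, Q.coeff i ∈ S) → Approximates B ϖ H γ Q → Q = P

end DiscreteNP

end

noncomputable section

namespace DiscreteNP

/-! ### The valuation on the algebraic closure -/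

section Valuation

variable {R K E : Type*} [CommRing R] [Field K] [Algebra R K]
    [Field E] [Algebra K E] [Algebra R E] [IsScalarTower R K E]
    {V : ValuationSubring E}

/-! Every run stays inside fields over which tameness can be read off directly. Write v for the
valuation, k for the residue field of `R`, d for the degree of f, and embed the splitting field L of
f in `E`. Then V ∩ L is discrete, its ramification index e is a unit of `V`, and its residue field
is separable over k. As e divides the order of the Galois group, which permutes at most d roots, e
divides d!. The element ρ = ϖd^(d!/e) has the value of a uniformizer of L and differs from one by an
e-th root of a unit. Since e is a unit, adjoining it is étale. This gives a field M₀ that contains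
all roots of f, with uniformizer ρ, ρ^e = π, and residues separable over k
(`exists_isKummerSetting`). Such fields (`IsTameField`) remain such, with the same ρ, when a root
that is simple modulo the maximal ideal is adjoined (`IsTameField.adjoin_simple_root`).

The invariant of a run (`State.IsGood`): `A` lies in such a field M ⊇ M₀, r divides e, every nonunit
of `V` in `A` is divisible by ϖ in `A`, and `A` is fixed by the inertia elements that fix ϖ. The
roots of the current polynomial come from roots of f by affine substitutions, so they lie in M. This
controls every choice. A slope a/b is the value of a root in M, so coprimality gives b ∣ e/r, and
the new ϖ' is a power of ρ times a root of unity of order dividing e: an étale change of M. A root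
of the reduction is the residue of a root in M, hence separable over k, so irreducible factors are
separable and the adjoined c is étale too. No Henselian property has to be invoked: `E` is
algebraically closed, and roots modulo the maximal ideal lift by splitting off linear factors
(`exists_root_of_valuation_eval_lt_one`).

The strict Henselizations are reached by Galois theory. A Taylor expansion argument
(`IsTameField.apply_eq`) shows that inertia elements fixing ρ fix M₀, and
`strictHenselField_adjoin_le_kummerField` identifies what such elements fix with a part of K^sh(ρ).

The value of ϖ^N in units of v(ρ) is an integer below he that grows with every scaling, so branches
are bounded. A given root is found by following, at each choice, the segment and the factor to which
it belongs. Expansions are unique because the first coefficient in which two of them differ is a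
unit. -/

theorem algebraMap_mem_of_valuation (hV : ∀ x : K, algebraMap K E x ∈ V ↔ x ∈ (algebraMap R K).range)
    (x : R) : algebraMap R E x ∈ V := by
  rw [IsScalarTower.algebraMap_apply R K E, hV]
  exact ⟨x, rfl⟩

theorem mem_of_isIntegral (hV : ∀ x : K, algebraMap K E x ∈ V ↔ x ∈ (algebraMap R K).range)
    {x : E} (hx : IsIntegral R x) : x ∈ V := by
  obtain ⟨p, hp, hpx⟩ := hx
  let φ : R →+* V := (algebraMap R E).codRestrict V.toSubring (algebraMap_mem_of_valuation hV)
  have : IsIntegral V x := ⟨p.map φ, hp.map φ, by rw [eval₂_map]; exact hpx⟩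
  obtain ⟨y, rfl⟩ := IsIntegrallyClosed.isIntegral_iff.mp this
  exact y.2

variable [IsFractionRing R K]

theorem valuation_algebraMap_lt_one_iff [IsLocalRing R]
    (hV : ∀ x : K, algebraMap K E x ∈ V ↔ x ∈ (algebraMap R K).range) (x : R) :
    V.valuation (algebraMap R E x) < 1 ↔ x ∈ IsLocalRing.maximalIdeal R := by
  have h1 : V.valuation (algebraMap R E x) ≤ 1 :=
    (V.valuation_le_one_iff _).mpr (algebraMap_mem_of_valuation hV x)
  rw [IsLocalRing.mem_maximalIdeal, mem_nonunits_iff]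
  constructor
  · rintro h ⟨u, rfl⟩
    have h2 := (V.valuation_le_one_iff _).mpr (algebraMap_mem_of_valuation (E := E) hV ↑(u⁻¹))
    have h3 : V.valuation (algebraMap R E u) * V.valuation (algebraMap R E ↑u⁻¹) = 1 := by
      rw [← map_mul, ← map_mul]; simp
    have := mul_lt_one_of_lt_of_le h h2
    exact this.ne h3
  · intro h
    refine lt_of_le_of_ne h1 fun h2 => h ?_
    have hx : algebraMap R E x ≠ 0 := by
      intro h0; rw [h0] at h2; simp at h2
    have h3 : algebraMap K E (algebraMap R K x)⁻¹ ∈ V := by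
      rw [map_inv₀, ← IsScalarTower.algebraMap_apply, ← V.valuation_le_one_iff, map_inv₀, h2, inv_one]
    obtain ⟨y, hy⟩ := (hV _).mp h3
    have hx' : algebraMap R K x ≠ 0 := by
      intro h0; apply hx; rw [IsScalarTower.algebraMap_apply R K E, h0, map_zero]
    refine IsUnit.of_mul_eq_one y (IsFractionRing.injective R K ?_)
    rw [map_mul, hy, map_one, mul_inv_cancel₀ hx']

/-- A nonzero multiple c·y⁻¹ with c in `R` is integral, hence in `V`, and c is a unit times a power
of π. So v has no elements infinitely close to zero; this replaces completeness in later limit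
arguments. -/
theorem exists_pow_valuation_le [IsDomain R] [IsDiscreteValuationRing R] [Algebra.IsAlgebraic K E]
    (hV : ∀ x : K, algebraMap K E x ∈ V ↔ x ∈ (algebraMap R K).range)
    {π : R} (hπ : Irreducible π) {y : E} (hy : y ≠ 0) :
    ∃ n : ℕ, V.valuation (algebraMap R E π) ^ n ≤ V.valuation y := by
  have halg : IsAlgebraic R y⁻¹ :=
    (IsFractionRing.isAlgebraic_iff R K E).mpr (Algebra.IsAlgebraic.isAlgebraic y⁻¹)
  obtain ⟨c, hc, hint⟩ := halg.exists_integral_multiple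
  have hmem := mem_of_isIntegral hV hint
  obtain ⟨n, u, rfl⟩ := IsDiscreteValuationRing.eq_unit_mul_pow_irreducible hc hπ
  refine ⟨n, ?_⟩
  have hu : V.valuation (algebraMap R E u) = 1 := by
    refine le_antisymm ((V.valuation_le_one_iff _).mpr (algebraMap_mem_of_valuation hV _))
      (not_lt.mp fun h => ?_)
    rw [valuation_algebraMap_lt_one_iff hV] at h
    exact h u.isUnit
  rw [← V.valuation_le_one_iff, Algebra.smul_def, map_mul, map_mul, map_mul, hu, one_mul, map_inv₀,
    map_pow, map_pow, ← div_eq_mul_inv] at hmem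
  rwa [div_le_one₀ (by simpa [zero_lt_iff] using hy)] at hmem

end Valuation

/-! ### Subrings of V with a uniformizer up to units -/

section ValuationRing

variable {E : Type*} [Field E] {V : ValuationSubring E}

/-- Elements of a subring with uniformizer `ϖ` up to units. -/
theorem exists_eq_pow_mul {S : Subring E} {ϖ : E}
    (harch : ∀ y : E, y ≠ 0 → ∃ n : ℕ, V.valuation ϖ ^ n ≤ V.valuation y)
    (hϖ : V.valuation ϖ < 1) (hSV : S ≤ V.toSubring)
    (hS : ∀ x ∈ S, V.valuation x < 1 → ∃ s ∈ S, ∃ y ∈ S, V.valuation s = 1 ∧ s * x = ϖ * y)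
    {x : E} (hx : x ∈ S) (hx0 : x ≠ 0) :
    ∃ n : ℕ, ∃ s ∈ S, ∃ y ∈ S, V.valuation s = 1 ∧ V.valuation y = 1 ∧ s * x = ϖ ^ n * y := by
  obtain ⟨n, hn⟩ := harch x hx0
  induction n generalizing x with
  | zero =>
    refine ⟨0, 1, S.one_mem, x, hx, map_one _, le_antisymm ?_ (by simpa using hn), by simp⟩
    exact (V.valuation_le_one_iff _).mpr (hSV hx)
  | succ n ih =>
    by_cases h1 : V.valuation x < 1
    · obtain ⟨s, hs, y, hy, hs1, h⟩ := hS x hx h1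
      have hs0 : s ≠ 0 := by rintro rfl; simp at hs1
      have hy0 : y ≠ 0 := by
        rintro rfl
        rw [mul_zero] at h
        exact (mul_ne_zero hs0 hx0) h
      have hϖ0 : ϖ ≠ 0 := by
        rintro rfl
        rw [zero_mul] at h
        exact (mul_ne_zero hs0 hx0) h
      have hv : V.valuation x = V.valuation ϖ * V.valuation y := by
        rw [← map_mul, ← h, map_mul, hs1, one_mul]
      have hpos : 0 < V.valuation ϖ := by simpa [zero_lt_iff] using hϖ0
      rw [hv, pow_succ'] at hn
      obtain ⟨m, s', hs', z, hz, h1, h2, h3⟩ := ih hy hy0 ((mul_le_mul_iff_right₀ hpos).mp hn)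
      refine ⟨m + 1, s' * s, S.mul_mem hs' hs, z, hz, by rw [map_mul, h1, hs1, one_mul], h2, ?_⟩
      linear_combination s' * h + ϖ * h3
    · refine ⟨0, 1, S.one_mem, x, hx, map_one _, le_antisymm ?_ (not_lt.mp h1), by simp⟩
      exact (V.valuation_le_one_iff _).mpr (hSV hx)

/-- Quotients of elements of a subring with uniformizer `ϖ` up to units. -/
theorem exists_zpow_of_div {S : Subring E} {ϖ : E}
    (harch : ∀ y : E, y ≠ 0 → ∃ n : ℕ, V.valuation ϖ ^ n ≤ V.valuation y)
    (hϖ : V.valuation ϖ < 1) (hϖ0 : ϖ ≠ 0) (hSV : S ≤ V.toSubring) 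
    (hS : ∀ x ∈ S, V.valuation x < 1 → ∃ s ∈ S, ∃ y ∈ S, V.valuation s = 1 ∧ s * x = ϖ * y)
    {x y : E} (hx : x ∈ S) (hy : y ∈ S) (hxy : x / y ≠ 0) :
    ∃ n : ℤ, ∃ p ∈ S, ∃ q ∈ S, V.valuation p = 1 ∧ V.valuation q = 1 ∧ x / y = ϖ ^ n * (p / q) := by
  have hx0 : x ≠ 0 := by rintro rfl; simp at hxy
  have hy0 : y ≠ 0 := by rintro rfl; simp at hxy
  obtain ⟨n, s, hs, z, hz, h1, h2, h3⟩ := exists_eq_pow_mul harch hϖ hSV hS hx hx0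
  obtain ⟨m, t, ht, w, hw, h4, h5, h6⟩ := exists_eq_pow_mul harch hϖ hSV hS hy hy0
  have hs0 : s ≠ 0 := by rintro rfl; simp at h1
  have ht0 : t ≠ 0 := by rintro rfl; simp at h4
  have hw0 : w ≠ 0 := by rintro rfl; simp at h5
  refine ⟨n - m, z * t, S.mul_mem hz ht, w * s, S.mul_mem hw hs, by rw [map_mul, h2, h4, one_mul],
    by rw [map_mul, h5, h1, one_mul], ?_⟩
  rw [zpow_sub₀ hϖ0, zpow_natCast, zpow_natCast]
  field_simp
  linear_combination (ϖ ^ m * w) * h3 - (ϖ ^ n * z) * h6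

theorem zpow_valuation_injective {ϖ : E} (hϖ : V.valuation ϖ < 1) (hϖ0 : ϖ ≠ 0) {m n : ℤ}
    (h : V.valuation ϖ ^ m = V.valuation ϖ ^ n) : m = n :=
  zpow_right_injective₀ (by simpa [zero_lt_iff] using hϖ0) hϖ.ne h

end ValuationRing

/-! ### Polynomials over a valuation ring -/

section Poly

variable {E : Type*} [Field E] {V : ValuationSubring E}

/-- A root of the reduction of a primitive polynomial is the reduction of a root. -/
theorem exists_root_of_valuation_eval_lt_one [IsAlgClosed E] {q : E[X]}
    (hq : ∀ i, V.valuation (q.coeff i) ≤ 1) (hprim : ∃ i, V.valuation (q.coeff i) = 1) {z : E}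
    (hz : V.valuation z ≤ 1) (hqz : V.valuation (q.eval z) < 1) :
    ∃ y, q.eval y = 0 ∧ V.valuation (z - y) < 1 := by
  induction hn : q.natDegree generalizing q with
  | zero =>
    rw [eq_C_of_natDegree_eq_zero hn, eval_C] at hqz
    obtain ⟨i, hi⟩ := hprim
    rw [eq_C_of_natDegree_eq_zero hn, coeff_C] at hi
    split_ifs at hi
    · exact absurd hi hqz.ne
    · simp at hi
  | succ n ih =>
    obtain ⟨y, hy⟩ := IsAlgClosed.exists_root q (by
      intro h; rw [natDegree_eq_zero_iff_degree_le_zero.mpr h.le] at hn; omega)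
    obtain ⟨q₁, rfl⟩ := dvd_iff_isRoot.mpr hy
    have hq0 : q₁ ≠ 0 := by rintro rfl; simp at hn
    rw [natDegree_mul (X_sub_C_ne_zero y) hq0, natDegree_X_sub_C] at hn
    -- X - y is rescaled to an integral factor l: a = 1 if y is integral, and a = y, l = y⁻¹X - 1
    -- otherwise. The complementary factor a·q₁ is then integral as well. Either y is already close
    -- to z, or l(z) is a unit and l can be split off.
    have key : ∃ (a : E) (l : E[X]), a ≠ 0 ∧ C a * l = X - C y ∧
        (∀ i, V.valuation (l.coeff i) ≤ 1) ∧ (∀ i, V.valuation ((C a * q₁).coeff i) ≤ 1) ∧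
        (V.valuation (z - y) < 1 ∨ V.valuation (l.eval z) = 1) := by
      by_cases h1 : V.valuation y ≤ 1
      · refine ⟨1, X - C y, one_ne_zero, by simp, fun i => ?_, fun i => ?_, ?_⟩
        · rw [coeff_sub, coeff_X, coeff_C]
          refine (V.valuation.map_sub _ _).trans (max_le ?_ ?_) <;> split_ifs <;> simp [h1]
        · rw [C_1, one_mul]
          by_contra h
          push Not at h
          -- the coefficients from the top down
          have : ∀ j, 1 < V.valuation (q₁.coeff (i + j)) := by
            intro j
            induction j with
            | zero => exact h
            | succ j ihj =>
              by_contra h2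
              push Not at h2
              have h3 := hq (i + j + 1)
              rw [sub_mul, coeff_sub, coeff_X_mul, coeff_C_mul] at h3
              have h4 : V.valuation (q₁.coeff (i + j)) ≤ 1 := by
                have : q₁.coeff (i + j) = (q₁.coeff (i + j) - y * q₁.coeff (i + j + 1)) +
                  y * q₁.coeff (i + j + 1) := by ring
                rw [this]
                refine V.valuation.map_add_le h3 ?_
                rw [map_mul]
                exact mul_le_one' h1 h2
              exact absurd ihj (not_lt.mpr h4)
          have h5 := this (q₁.natDegree + 1)
          rw [coeff_eq_zero_of_natDegree_lt (by omega)] at h5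
          simp at h5
        · rw [eval_sub, eval_X, eval_C]
          refine (lt_or_eq_of_le ?_)
          exact (V.valuation.map_sub _ _).trans (max_le hz h1)
      · push Not at h1
        have hy0 : y ≠ 0 := by rintro rfl; simp at h1
        have hinv : V.valuation y⁻¹ < 1 := by
          rw [map_inv₀]; exact inv_lt_one_of_one_lt₀ h1
        refine ⟨y, C y⁻¹ * X - 1, hy0, ?_, fun i => ?_, fun i => ?_, Or.inr ?_⟩
        · rw [mul_sub, ← mul_assoc, ← C_mul, mul_inv_cancel₀ hy0, C_1, one_mul, mul_one]
        · rw [coeff_sub, coeff_C_mul, coeff_X, coeff_one]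
          refine (V.valuation.map_sub _ _).trans (max_le ?_ ?_) <;> split_ifs <;> simp
          rw [map_inv₀] at hinv
          exact hinv.le
        · rw [coeff_C_mul]
          induction i with
          | zero =>
            have := hq 0
            rwa [sub_mul, coeff_sub, coeff_X_mul_zero, coeff_C_mul, zero_sub,
              Valuation.map_neg] at this
          | succ i ihi =>
            have h3 := hq (i + 1)
            rw [sub_mul, coeff_sub, coeff_X_mul, coeff_C_mul] at h3
            have : y * q₁.coeff (i + 1) = y⁻¹ * (y * q₁.coeff i) -
              (q₁.coeff i - y * q₁.coeff (i + 1)) := by field_simp; ring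
            rw [this]
            refine (V.valuation.map_sub _ _).trans (max_le ?_ h3)
            rw [map_mul]
            exact mul_le_one' hinv.le ihi
        · rw [eval_sub, eval_mul, eval_C, eval_X, eval_one, Valuation.map_sub_swap,
            Valuation.map_one_sub_of_lt]
          rw [map_mul]
          exact mul_lt_one_of_lt_of_le hinv hz
    obtain ⟨a, l, ha, hal, hl, hq1, h⟩ := key
    rcases h with h | h
    · exact ⟨y, by simp, h⟩
    have hfac : (X - C y) * q₁ = l * (C a * q₁) := by rw [← hal]; ring
    -- The cofactor is again primitive: if all its coefficients were in the maximal ideal, so would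
    -- be those of its product with l.
    obtain ⟨w, hw, hzw⟩ := ih (q := C a * q₁) hq1 (by
      by_contra hcon
      push Not at hcon
      obtain ⟨i, hi⟩ := hprim
      rw [hfac, coeff_mul] at hi
      refine absurd hi (ne_of_lt ?_)
      refine V.valuation.map_sum_lt one_ne_zero fun x _ => ?_
      rw [map_mul, mul_comm]
      exact mul_lt_one_of_lt_of_le (lt_of_le_of_ne (hq1 _) (hcon _)) (hl _))
      (by rwa [hfac, eval_mul, map_mul, h, one_mul] at hqz)
      (by rw [natDegree_C_mul ha]; omega)
    refine ⟨w, ?_, hzw⟩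
    rw [hfac, eval_mul, hw, mul_zero]

end Poly

/-! ### Newton polygons and roots -/

section Slope

variable {E : Type*} [Field E] {V : ValuationSubring E}

theorem residue_eq_zero_iff_valuation (x : V) :
    IsLocalRing.residue V x = 0 ↔ V.valuation (x : E) < 1 := by
  rw [IsLocalRing.residue_eq_zero_iff, ValuationSubring.valuation_lt_one_iff]

theorem residue_ne_zero_iff_valuation (x : V) :
    IsLocalRing.residue V x ≠ 0 ↔ V.valuation (x : E) = 1 := by
  rw [Ne, residue_eq_zero_iff_valuation, not_lt]
  exact ⟨fun h => le_antisymm ((V.valuation_le_one_iff _).mpr x.2) h, fun h => h.ge⟩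

/-- A monic lift has a root in `E`, which is integral over `V` and therefore lies in `V`. -/
theorem isAlgClosed_residueField [IsAlgClosed E] : IsAlgClosed (IsLocalRing.ResidueField V) := by
  refine IsAlgClosed.of_exists_root _ fun p hp hirr => ?_
  obtain ⟨q, hq, hdeg, hmon⟩ := lifts_and_natDegree_eq_and_monic
    (f := IsLocalRing.residue V) (p := p) (map_surjective _ IsLocalRing.residue_surjective p) hp
  have hd : (q.map V.subtype).degree ≠ 0 := by
    rw [(hmon.degree_map V.subtype), degree_eq_natDegree hmon.ne_zero, hdeg]
    exact_mod_cast hirr.natDegree_pos.ne'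
  obtain ⟨x, hx⟩ := IsAlgClosed.exists_root _ hd
  have hint : IsIntegral V x := ⟨q, hmon, by rw [← eval_map]; exact hx⟩
  obtain ⟨y, rfl⟩ := IsIntegrallyClosed.isIntegral_iff.mp hint
  refine ⟨IsLocalRing.residue V y, ?_⟩
  rw [← hq, eval_map, eval₂_at_apply]
  have : q.eval y = 0 := by
    apply Subtype.val_injective
    change V.subtype (q.eval y) = 0
    rw [← eval₂_at_apply, ← eval_map]
    exact hx
  rw [this, map_zero]

/-- A polynomial over `k` with no nonzero root is a constant times a power of X, so it has at most
one nonzero coefficient. -/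
theorem exists_ne_zero_root {k : Type*} [Field k] [IsAlgClosed k] {p : k[X]} {i j : ℕ} (hij : i ≠ j)
    (hi : p.coeff i ≠ 0) (hj : p.coeff j ≠ 0) : ∃ z, z ≠ 0 ∧ p.eval z = 0 := by
  have hp : p ≠ 0 := by rintro rfl; simp at hi
  obtain ⟨w, hw, hdvd⟩ := exists_eq_pow_rootMultiplicity_mul_and_not_dvd p hp 0
  rw [C_0, sub_zero] at hw hdvd
  by_cases hd : w.degree = 0
  · rw [eq_C_of_degree_eq_zero hd] at hw
    rw [hw, X_pow_mul_C, coeff_C_mul, coeff_X_pow] at hi hj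
    split_ifs at hi hj with h1 h2
    · exact absurd (h1.trans h2.symm) hij
    all_goals simp at hi hj
  · obtain ⟨z, hz⟩ := IsAlgClosed.exists_root w hd
    refine ⟨z, ?_, by rw [hw, eval_mul, hz.eq_zero, mul_zero]⟩
    rintro rfl
    apply hdvd
    simpa using dvd_iff_isRoot.mpr hz

theorem exists_lift {A : Subring E} (hA : A ≤ V.toSubring) {p : E[X]} (hp : ∀ i, p.coeff i ∈ A) :
    ∃ q : (inside V A)[X], q.map (incl V A) = p := by
  have : p ∈ lifts (incl V A) := by
    rw [lifts_iff_coeff_lifts]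
    exact fun i => ⟨⟨⟨p.coeff i, hA (hp i)⟩, hp i⟩, rfl⟩
  exact this

/-- The valuations of the roots are slopes of the Newton polygon. -/
theorem hasSlope_of_root {ϖ : E} {p : E[X]} (hp : p ≠ 0) {y : E} (hy : p.eval y = 0)
    (hy0 : y ≠ 0) {a b : ℕ} (hab : V.valuation y ^ b = V.valuation ϖ ^ a) : HasSlope V ϖ p a b := by
  have hterm : ∀ l, V.valuation (p.coeff l) ^ b * V.valuation ϖ ^ (a * l) =
      V.valuation (p.coeff l * y ^ l) ^ b := by
    intro l
    rw [pow_mul, ← hab, map_mul, map_pow, mul_pow, ← pow_mul, ← pow_mul, mul_comm b l]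
  have hne : p.support.Nonempty := nonempty_support_iff.mpr hp
  obtain ⟨i, hi, hmax⟩ := p.support.exists_max_image (fun l => V.valuation (p.coeff l * y ^ l)) hne
  have hi0 : p.coeff i * y ^ i ≠ 0 := mul_ne_zero (mem_support_iff.mp hi) (pow_ne_zero _ hy0)
  have hmax' : ∀ l, V.valuation (p.coeff l * y ^ l) ≤ V.valuation (p.coeff i * y ^ i) := by
    intro l
    by_cases hl : l ∈ p.support
    · exact hmax l hl
    · simp [notMem_support_iff.mp hl]
  -- The terms of p(y) sum to zero, so the largest value among them cannot be attained only once.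
  obtain ⟨j, hji, hj⟩ : ∃ j, j ≠ i ∧
      V.valuation (p.coeff j * y ^ j) = V.valuation (p.coeff i * y ^ i) := by
    by_contra! hcon
    have h1 : V.valuation (∑ l ∈ p.support.erase i, p.coeff l * y ^ l) <
        V.valuation (p.coeff i * y ^ i) :=
      V.valuation.map_sum_lt (by simpa using hi0) fun l hl =>
        lt_of_le_of_ne (hmax' l) (hcon l (Finset.ne_of_mem_erase hl))
    have h2 : p.coeff i * y ^ i = - ∑ l ∈ p.support.erase i, p.coeff l * y ^ l := by
      rw [eq_neg_iff_add_eq_zero, Finset.add_sum_erase _ (fun l => p.coeff l * y ^ l) hi, ← hy,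
        eval_eq_sum, Polynomial.sum]
    rw [h2, Valuation.map_neg] at h1
    exact lt_irrefl _ h1
  have hj0 : p.coeff j ≠ 0 := by
    intro h0
    rw [h0, zero_mul, map_zero] at hj
    exact hi0 (V.valuation.zero_iff.mp hj.symm)
  have hall : ∀ l, V.valuation (p.coeff l * y ^ l) ^ b ≤ V.valuation (p.coeff i * y ^ i) ^ b :=
    fun l => pow_le_pow_left₀ zero_le (hmax' l) b
  rcases lt_or_gt_of_ne hji with hlt | hlt
  · refine ⟨j, i, hlt, hj0, mem_support_iff.mp hi, by rw [hterm, hterm, hj], fun l => ?_⟩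
    rw [hterm, hterm, hj]
    exact hall l
  · refine ⟨i, j, hlt, mem_support_iff.mp hi, hj0, by rw [hterm, hterm, hj], fun l => ?_⟩
    rw [hterm, hterm]
    exact hall l

/-- Along an element x of value a/b the b-th powers can be cancelled: the endpoints of the segment
become the terms of largest value in p(xX). -/
theorem HasSlope.scaled {ϖ : E} {p : E[X]} {a b : ℕ} (hb : 0 < b) (h : HasSlope V ϖ p a b) {x : E}
    (hx : x ^ b = ϖ ^ a) : ∃ i j : ℕ, i < j ∧ p.coeff i ≠ 0 ∧ p.coeff j ≠ 0 ∧
      V.valuation (p.coeff i * x ^ i) = V.valuation (p.coeff j * x ^ j) ∧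
      ∀ l, V.valuation (p.coeff l * x ^ l) ≤ V.valuation (p.coeff i * x ^ i) := by
  have hterm : ∀ l, V.valuation (p.coeff l) ^ b * V.valuation ϖ ^ (a * l) =
      V.valuation (p.coeff l * x ^ l) ^ b := by
    intro l
    rw [pow_mul, ← map_pow V.valuation ϖ, ← hx, map_mul, map_pow, map_pow, mul_pow, ← pow_mul,
      ← pow_mul, mul_comm b l]
  obtain ⟨i, j, hij, hi, hj, heq, hall⟩ := h
  simp only [hterm] at heq hall
  refine ⟨i, j, hij, hi, hj, ?_, fun l => ?_⟩
  · exact (pow_left_inj₀ zero_le zero_le hb.ne').mp heq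
  · exact (pow_le_pow_iff_left₀ zero_le zero_le hb.ne').mp (hall l)

/-- The slopes of the Newton polygon are valuations of roots. -/
theorem HasSlope.exists_root [IsAlgClosed E] {ϖ : E} {p : E[X]} {a b : ℕ} (hb : 0 < b)
    (h : HasSlope V ϖ p a b) {x : E} (hx : x ^ b = ϖ ^ a) (hx0 : x ≠ 0) :
    ∃ y, p.eval y = 0 ∧ V.valuation y = V.valuation x := by
  obtain ⟨i, j, hij, hi, hj, heq, hall⟩ := h.scaled hb hx
  set m := p.coeff i * x ^ i with hm
  have hm0 : m ≠ 0 := mul_ne_zero hi (pow_ne_zero _ hx0)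
  have hvm : V.valuation m ≠ 0 := by simpa using hm0
  -- This is p(xX) divided by its largest coefficient. The two ends of the segment become units, so
  -- the reduction has a nonzero root, and a root of q lifting it has value 1.
  let q : E[X] := C m⁻¹ * p.comp (C x * X)
  have hqc : ∀ l, q.coeff l = m⁻¹ * (p.coeff l * x ^ l) := fun l => by
    rw [coeff_C_mul, comp_C_mul_X_coeff]
  have hq : ∀ l, V.valuation (q.coeff l) ≤ 1 := by
    intro l
    rw [hqc, map_mul, map_inv₀, inv_mul_le_one₀ (zero_lt_iff.mpr hvm)]
    exact hall l
  have hqi : V.valuation (q.coeff i) = 1 := by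
    rw [hqc, ← hm, inv_mul_cancel₀ hm0, map_one]
  have hqj : V.valuation (q.coeff j) = 1 := by
    rw [hqc, map_mul, ← heq, ← map_mul, inv_mul_cancel₀ hm0, map_one]
  obtain ⟨Q, hQ⟩ : ∃ Q : V[X], Q.map V.subtype = q := by
    have : q ∈ lifts V.subtype := by
      rw [lifts_iff_coeff_lifts]
      exact fun l => ⟨⟨_, (V.valuation_le_one_iff _).mp (hq l)⟩, rfl⟩
    exact this
  have hQc : ∀ l, ((Q.coeff l : V) : E) = q.coeff l := fun l => by rw [← hQ, coeff_map]; rfl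
  have := isAlgClosed_residueField (V := V)
  obtain ⟨z, hz0, hz⟩ := exists_ne_zero_root (p := Q.map (IsLocalRing.residue V)) hij.ne
    (by rw [coeff_map, residue_ne_zero_iff_valuation, hQc, hqi])
    (by rw [coeff_map, residue_ne_zero_iff_valuation, hQc, hqj])
  obtain ⟨w, rfl⟩ := IsLocalRing.residue_surjective z
  rw [residue_ne_zero_iff_valuation] at hz0
  rw [eval_map, eval₂_at_apply, residue_eq_zero_iff_valuation] at hz
  have hz' : V.valuation (q.eval (w : E)) < 1 := by
    rwa [← hQ, eval_map, show (w : E) = V.subtype w from rfl, eval₂_at_apply]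
  obtain ⟨y, hy, hwy⟩ := exists_root_of_valuation_eval_lt_one hq ⟨i, hqi⟩ hz0.le hz'
  refine ⟨x * y, ?_, ?_⟩
  · rw [eval_mul, eval_C, eval_comp] at hy
    simpa [hm0] using hy
  · have hy1 : V.valuation y = 1 := by
      rw [← hz0]
      have : y = w - (w - y) := by ring
      rw [this, Valuation.map_sub_eq_of_lt_left]
      rwa [hz0]
    rw [map_mul, hy1, mul_one]

end Slope

/-! ### Simple roots -/

section SimpleRoot

theorem isSeparable_of_simple_root {F k : Type*} [Field F] [Field k] [Algebra F k] {g : F[X]}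
    {c : k} (hg : aeval c g = 0) (hg' : aeval c (derivative g) ≠ 0) : IsSeparable F c := by
  have hg0 : g ≠ 0 := by rintro rfl; simp at hg'
  have hint : IsIntegral F c := isAlgebraic_iff_isIntegral.mp ⟨g, hg0, hg⟩
  refine (separable_iff_derivative_ne_zero (minpoly.irreducible hint)).mpr fun h0 => ?_
  obtain ⟨w, rfl⟩ := minpoly.dvd F c hg
  apply hg'
  rw [derivative_mul, h0]
  simp

theorem mem_separableClosure_of_simple_root {F k : Type*} [Field F] [Field k] [Algebra F k]
    {g : k[X]} {c : k} (hcoeff : ∀ i, g.coeff i ∈ separableClosure F k) (hg : g.eval c = 0)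
    (hg' : (derivative g).eval c ≠ 0) : c ∈ separableClosure F k := by
  have : g ∈ lifts (algebraMap (separableClosure F k) k) := by
    rw [lifts_iff_coeff_lifts]
    exact fun i => ⟨⟨_, hcoeff i⟩, rfl⟩
  obtain ⟨G, rfl⟩ : ∃ G, map (algebraMap (separableClosure F k) k) G = g := this
  rw [derivative_map] at hg'
  rw [eval_map_algebraMap] at hg hg'
  exact mem_separableClosure_iff.mpr
    (IsSeparable.of_algebra_isSeparable_of_isSeparable F (isSeparable_of_simple_root hg hg'))

/-- The factor h is the minimal polynomial of c. Simplicity of the root makes the cofactor nonzero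
at c, which substitutes for irreducibility of g when dividing in `A[c]`. -/
theorem exists_factor_of_simple_root {F k : Type*} [CommRing F] (hF : IsField F) [Field k]
    (φ : F →+* k) {g : F[X]} {c : k} (hg : g.eval₂ φ c = 0)
    (hg' : (derivative g).eval₂ φ c ≠ 0) :
    ∃ h w : F[X], g = h * w ∧ w.eval₂ φ c ≠ 0 ∧ ∀ p : F[X], p.eval₂ φ c = 0 → h ∣ p := by
  let := hF.toField
  let := φ.toAlgebra
  have hae : ∀ p : F[X], p.eval₂ φ c = aeval c p := fun p => rfl
  obtain ⟨w, hw⟩ := minpoly.dvd F c hg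
  refine ⟨minpoly F c, w, hw, fun h0 => hg' ?_, fun p hp => minpoly.dvd F c hp⟩
  rw [hae] at h0 ⊢
  rw [hw, derivative_mul]
  simp [h0]

theorem dvd_of_irreducible_of_root {F k : Type*} [CommRing F] (hF : IsField F) [Field k]
    (φ : F →+* k) {g p : F[X]} {c : k} (hirr : Irreducible g) (hg : g.eval₂ φ c = 0)
    (hp : p.eval₂ φ c = 0) : g ∣ p := by
  let := hF.toField
  let := φ.toAlgebra
  have h1 : minpoly F c ∣ g := minpoly.dvd F c hg
  have hint : IsIntegral F c := isAlgebraic_iff_isIntegral.mp ⟨g, hirr.ne_zero, hg⟩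
  exact ((minpoly.irreducible hint).associated_of_dvd hirr h1).dvd_iff_dvd_left.mp
    (minpoly.dvd F c hp)

end SimpleRoot

/-! ### Residue fields of subrings -/

section Res

variable {E : Type*} [Field E] {V : ValuationSubring E}

/-- A domain algebraic over a subfield is a field. This is why `A` can be reduced without first
being localized. -/
theorem isField_resField {A : Subring E} {k₀ : Subfield (IsLocalRing.ResidueField V)}
    (hk : k₀.toSubring ≤ resField V A)
    (halg : ∀ x (hx : x ∈ V), x ∈ A → IsAlgebraic k₀ (IsLocalRing.residue V ⟨x, hx⟩)) :
    IsField (resField V A) := by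
  let S : Subalgebra k₀ (IsLocalRing.ResidueField V) :=
    { resField V A with algebraMap_mem' := fun r => hk r.2 }
  refine ⟨⟨0, 1, zero_ne_one⟩, mul_comm, fun {x} hx => ?_⟩
  have hx' : IsAlgebraic k₀ ((⟨x, x.2⟩ : S) : IsLocalRing.ResidueField V) := by
    obtain ⟨y, hy⟩ := x.2
    change IsAlgebraic k₀ (x : IsLocalRing.ResidueField V)
    rw [← hy]
    exact halg y.1 y.1.2 y.2
  refine ⟨⟨(x : IsLocalRing.ResidueField V)⁻¹, S.inv_mem_of_algebraic hx'⟩, ?_⟩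
  apply Subtype.ext
  exact mul_inv_cancel₀ (fun h => hx (Subtype.ext h))

theorem coe_red {A : Subring E} (x : inside V A) :
    ((red V A x : resField V A) : IsLocalRing.ResidueField V) = IsLocalRing.residue V x.1 := rfl

theorem red_surjective (A : Subring E) : Function.Surjective (red V A) :=
  RingHom.rangeRestrict_surjective _

theorem eval₂_incl_mem {A : Subring E} {c : E} (hc : c ∈ V) (p : (inside V A)[X]) :
    p.eval₂ (incl V A) c = ((p.eval₂ (inside V A).subtype ⟨c, hc⟩ : V) : E) := by
  change _ = V.subtype _
  rw [hom_eval₂]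
  rfl

theorem eval₂_red {A : Subring E} {c : E} (hc : c ∈ V) (p : (inside V A)[X]) :
    (p.map (red V A)).eval₂ (resField V A).subtype (IsLocalRing.residue V ⟨c, hc⟩) =
      IsLocalRing.residue V (p.eval₂ (inside V A).subtype ⟨c, hc⟩) := by
  rw [eval₂_map, hom_eval₂]
  rfl

theorem eval₂_red_eq_zero_iff {A : Subring E} {c : E} (hc : c ∈ V) (p : (inside V A)[X]) :
    (p.map (red V A)).eval₂ (resField V A).subtype (IsLocalRing.residue V ⟨c, hc⟩) = 0 ↔
      V.valuation (p.eval₂ (incl V A) c) < 1 := by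
  rw [eval₂_red, residue_eq_zero_iff_valuation, eval₂_incl_mem hc]

theorem mem_adjoinElem_iff {A : Subring E} (hA : A ≤ V.toSubring) {c x : E} :
    x ∈ adjoinElem A c ↔ ∃ p : (inside V A)[X], p.eval₂ (incl V A) c = x := by
  constructor
  · intro hx
    have : adjoinElem A c ≤ (eval₂RingHom (incl V A) c).range := by
      refine Subring.closure_le.mpr (Set.insert_subset ⟨X, by simp⟩ fun a ha => ?_)
      exact ⟨C ⟨⟨a, hA ha⟩, ha⟩, by simp; rfl⟩
    exact this hx
  · rintro ⟨p, rfl⟩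
    rw [eval₂_eq_sum]
    refine Subring.sum_mem _ fun i _ => Subring.mul_mem _ ?_ (Subring.pow_mem _ ?_ _)
    · exact Subring.subset_closure (Set.mem_insert_of_mem _ (p.coeff i).2)
    · exact Subring.subset_closure (Set.mem_insert _ _)

theorem le_adjoinElem (A : Subring E) (c : E) : A ≤ adjoinElem A c :=
  fun _ ha => Subring.subset_closure (Set.mem_insert_of_mem _ ha)

theorem self_mem_adjoinElem (A : Subring E) (c : E) : c ∈ adjoinElem A c :=
  Subring.subset_closure (Set.mem_insert _ _)

theorem adjoinElem_le {A B : Subring E} {c : E} (hA : A ≤ B) (hc : c ∈ B) : adjoinElem A c ≤ B :=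
  Subring.closure_le.mpr (Set.insert_subset hc hA)

theorem exists_eq_C_mul_of_map_red_eq_zero {A : Subring E} (hA : A ≤ V.toSubring) {ϖ : E}
    (hϖ : ϖ ∈ A) (hdiv : ∀ x ∈ A, V.valuation x < 1 → ∃ y ∈ A, x = ϖ * y)
    {p : (inside V A)[X]} (hp : p.map (red V A) = 0) :
    ∃ q : (inside V A)[X], ∀ c, p.eval₂ (incl V A) c = ϖ * q.eval₂ (incl V A) c := by
  have : C (⟨⟨ϖ, hA hϖ⟩, hϖ⟩ : inside V A) ∣ p := by
    rw [C_dvd_iff_dvd_coeff]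
    intro i
    have h0 : red V A (p.coeff i) = 0 := by rw [← coeff_map, hp, coeff_zero]
    have h1 : V.valuation ((p.coeff i : V) : E) < 1 := by
      rw [← residue_eq_zero_iff_valuation, ← coe_red, h0]; rfl
    obtain ⟨y, hy, h⟩ := hdiv _ (p.coeff i).2 h1
    exact ⟨⟨⟨y, hA hy⟩, hy⟩, Subtype.ext (Subtype.ext h)⟩
  obtain ⟨q, rfl⟩ := this
  exact ⟨q, fun c => by rw [eval₂_mul, eval₂_C]; rfl⟩

/-- Division by the uniformizer in `A[c]`, up to units, for a simple root `c` modulo `ϖ`. -/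
theorem adjoinElem_div_of_simple_root {A : Subring E} (hA : A ≤ V.toSubring) {ϖ : E}
    (hϖ : ϖ ∈ A) (hdiv : ∀ x ∈ A, V.valuation x < 1 → ∃ y ∈ A, x = ϖ * y)
    (hF : IsField (resField V A)) {c : E} (hc : c ∈ V) {g : (inside V A)[X]}
    (hg : g.eval₂ (incl V A) c = 0)
    (hg' : V.valuation ((derivative g).eval₂ (incl V A) c) = 1) :
    ∀ x ∈ adjoinElem A c, V.valuation x < 1 →
      ∃ s ∈ adjoinElem A c, ∃ y ∈ adjoinElem A c, V.valuation s = 1 ∧ s * x = ϖ * y := by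
  intro x hx hx1
  obtain ⟨p, rfl⟩ := (mem_adjoinElem_iff hA).mp hx
  obtain ⟨h, w, hgw, hw, hdvd⟩ := exists_factor_of_simple_root hF (resField V A).subtype
    (g := g.map (red V A)) (c := IsLocalRing.residue V ⟨c, hc⟩)
    (by rw [eval₂_red_eq_zero_iff, hg]; simp)
    (by rw [derivative_map, Ne, eval₂_red_eq_zero_iff, hg']; simp)
  obtain ⟨q, hq⟩ := hdvd (p.map (red V A)) (by rwa [eval₂_red_eq_zero_iff])
  obtain ⟨h, rfl⟩ := map_surjective (red V A) (red_surjective A) h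
  obtain ⟨w, rfl⟩ := map_surjective (red V A) (red_surjective A) w
  obtain ⟨q, rfl⟩ := map_surjective (red V A) (red_surjective A) q
  obtain ⟨g₁, hg₁⟩ := exists_eq_C_mul_of_map_red_eq_zero hA hϖ hdiv (p := g - h * w)
    (by rw [Polynomial.map_sub, Polynomial.map_mul, hgw, sub_self])
  obtain ⟨p₁, hp₁⟩ := exists_eq_C_mul_of_map_red_eq_zero hA hϖ hdiv (p := p - h * q)
    (by rw [Polynomial.map_sub, Polynomial.map_mul, hq, sub_self])
  have h1 := hg₁ c
  have h2 := hp₁ c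
  rw [eval₂_sub, eval₂_mul] at h1 h2
  rw [hg] at h1
  -- With g = hw + ϖg₁ and p = hq + ϖp₁, the equation g(c) = 0 gives w(c)p(c) = ϖ(wp₁ - qg₁)(c). The
  -- unit w(c) remains because g may be reducible modulo ϖ.
  refine ⟨w.eval₂ (incl V A) c, (mem_adjoinElem_iff hA).mpr ⟨w, rfl⟩,
    (w * p₁ - q * g₁).eval₂ (incl V A) c, (mem_adjoinElem_iff hA).mpr ⟨_, rfl⟩, ?_, ?_⟩
  · rw [Ne, eval₂_red_eq_zero_iff, not_lt] at hw
    refine le_antisymm ?_ hw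
    rw [eval₂_incl_mem hc, V.valuation_le_one_iff]
    exact Subtype.mem _
  · rw [eval₂_sub, eval₂_mul, eval₂_mul]
    linear_combination (w.eval₂ (incl V A) c) * h2 - (q.eval₂ (incl V A) c) * h1

/-- Division by the uniformizer in `A[c]`, for a root `c` of a polynomial that is
irreducible modulo `ϖ`. -/
theorem adjoinElem_div_of_irreducible {A : Subring E} (hA : A ≤ V.toSubring) {ϖ : E}
    (hϖ : ϖ ∈ A) (hdiv : ∀ x ∈ A, V.valuation x < 1 → ∃ y ∈ A, x = ϖ * y)
    (hF : IsField (resField V A)) {c : E} (hc : c ∈ V) {g : (inside V A)[X]}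
    (hg : g.eval₂ (incl V A) c = 0) (hirr : Irreducible (g.map (red V A))) :
    ∀ x ∈ adjoinElem A c, V.valuation x < 1 → ∃ y ∈ adjoinElem A c, x = ϖ * y := by
  intro x hx hx1
  obtain ⟨p, rfl⟩ := (mem_adjoinElem_iff hA).mp hx
  obtain ⟨q, hq⟩ := dvd_of_irreducible_of_root hF (resField V A).subtype hirr
    (c := IsLocalRing.residue V ⟨c, hc⟩) (by rw [eval₂_red_eq_zero_iff, hg]; simp)
    (p := p.map (red V A)) (by rwa [eval₂_red_eq_zero_iff])
  obtain ⟨q, rfl⟩ := map_surjective (red V A) (red_surjective A) q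
  obtain ⟨p₁, hp₁⟩ := exists_eq_C_mul_of_map_red_eq_zero hA hϖ hdiv (p := p - g * q)
    (by rw [Polynomial.map_sub, Polynomial.map_mul, hq, sub_self])
  have h2 := hp₁ c
  rw [eval₂_sub, eval₂_mul, hg, zero_mul, sub_zero] at h2
  exact ⟨_, (mem_adjoinElem_iff hA).mpr ⟨p₁, rfl⟩, h2⟩

/-- Division by a root of the uniformizer in a Kummer extension. -/
theorem adjoinElem_div_of_pow_eq {A : Subring E} (hA : A ≤ V.toSubring) {ϖ ρ : E}
    (hdiv : ∀ x ∈ A, V.valuation x < 1 → ∃ y ∈ A, x = ϖ * y) (hρ : V.valuation ρ < 1) {b : ℕ}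
    (hb : 0 < b) (hρb : ρ ^ b = ϖ) :
    ∀ x ∈ adjoinElem A ρ, V.valuation x < 1 → ∃ y ∈ adjoinElem A ρ, x = ρ * y := by
  intro x hx hx1
  obtain ⟨p, rfl⟩ := (mem_adjoinElem_iff hA).mp hx
  have hp : p.eval₂ (incl V A) ρ = ρ * (p.divX.eval₂ (incl V A) ρ) + ((p.coeff 0 : V) : E) := by
    conv_lhs => rw [← divX_mul_X_add p]
    rw [eval₂_add, eval₂_mul, eval₂_X, eval₂_C, mul_comm]
    rfl
  -- Modulo ρ only the constant coefficient of p survives. It is a nonunit of `A`, so it is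
  -- divisible by ϖ = ρ^b and therefore by ρ.
  have hmem : p.divX.eval₂ (incl V A) ρ ∈ adjoinElem A ρ := (mem_adjoinElem_iff hA).mpr ⟨_, rfl⟩
  have hV : p.divX.eval₂ (incl V A) ρ ∈ V := by
    have : adjoinElem A ρ ≤ V.toSubring :=
      adjoinElem_le hA ((V.valuation_le_one_iff _).mp hρ.le)
    exact this hmem
  have h0 : V.valuation ((p.coeff 0 : V) : E) < 1 := by
    have : ((p.coeff 0 : V) : E) = p.eval₂ (incl V A) ρ - ρ * (p.divX.eval₂ (incl V A) ρ) := by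
      rw [hp]; ring
    rw [this]
    refine V.valuation.map_sub_lt hx1 ?_
    rw [map_mul]
    exact mul_lt_one_of_lt_of_le hρ ((V.valuation_le_one_iff _).mpr hV)
  obtain ⟨y, hy, hy'⟩ : ∃ y ∈ A, ((p.coeff 0 : V) : E) = ϖ * y := hdiv _ (p.coeff 0).2 h0
  obtain ⟨b, rfl⟩ := Nat.exists_eq_succ_of_ne_zero hb.ne'
  refine ⟨p.divX.eval₂ (incl V A) ρ + ρ ^ b * y, Subring.add_mem _ hmem (Subring.mul_mem _
    (Subring.pow_mem _ (self_mem_adjoinElem A ρ) _) (le_adjoinElem A ρ hy)), ?_⟩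
  rw [hp, hy', ← hρb, pow_succ]
  ring

end Res

/-! ### Fields with a given uniformizer and separable residue field -/

section Good

variable {K E : Type*} [Field K] [Field E] [Algebra K E] {V : ValuationSubring E}
  {k₀ : Subfield (IsLocalRing.ResidueField V)}

/-- Residues of quotients of elements of a subring with uniformizer `ϖ` up to units. -/
theorem residue_div_mem {S : Subring E} {ϖ : E}
    {F : IntermediateField k₀ (IsLocalRing.ResidueField V)}
    (harch : ∀ y : E, y ≠ 0 → ∃ n : ℕ, V.valuation ϖ ^ n ≤ V.valuation y)
    (hϖ : V.valuation ϖ < 1) (hϖ0 : ϖ ≠ 0) (hSV : S ≤ V.toSubring)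
    (hS : ∀ x ∈ S, V.valuation x < 1 → ∃ s ∈ S, ∃ y ∈ S, V.valuation s = 1 ∧ s * x = ϖ * y)
    (hSres : ∀ x (hx : x ∈ V), x ∈ S → IsLocalRing.residue V ⟨x, hx⟩ ∈ F)
    {p q : E} (hp : p ∈ S) (hq : q ∈ S) (hxV : p / q ∈ V) :
    IsLocalRing.residue V ⟨p / q, hxV⟩ ∈ F := by
  by_cases hx1 : V.valuation (p / q) < 1
  · have : IsLocalRing.residue V ⟨p / q, hxV⟩ = 0 := (residue_eq_zero_iff_valuation _).mpr hx1
    rw [this]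
    exact zero_mem _
  · have hx1 : V.valuation (p / q) = 1 :=
      le_antisymm ((V.valuation_le_one_iff _).mpr hxV) (not_lt.mp hx1)
    have hx0 : p / q ≠ 0 := by intro h; rw [h] at hx1; simp at hx1
    obtain ⟨n, p', hp', q', hq', h1, h2, h3⟩ :=
      exists_zpow_of_div harch hϖ hϖ0 hSV hS hp hq hx0
    -- The quotient is a unit, so no power of ϖ is left over, and its residue is a quotient of
    -- residues of units of S.
    have hn : n = 0 := by
      rw [h3, map_mul, map_zpow₀, map_div₀, h1, h2, div_one, mul_one] at hx1
      exact zpow_valuation_injective hϖ hϖ0 (by simpa using hx1)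
    rw [hn, zpow_zero, one_mul] at h3
    have hq0 : q' ≠ 0 := by rintro rfl; simp at h2
    have h4 : (⟨p / q, hxV⟩ : V) * ⟨q', hSV hq'⟩ = ⟨p', hSV hp'⟩ := by
      apply Subtype.ext
      change p / q * q' = p'
      rw [h3]; field_simp
    have h5 := congrArg (IsLocalRing.residue V) h4
    rw [map_mul] at h5
    rw [eq_div_of_mul_eq ((residue_ne_zero_iff_valuation _).mpr h2) h5]
    exact div_mem (hSres _ _ hp') (hSres _ _ hq')

/-- The valuation ring `M ∩ V` is a discrete valuation ring with uniformizer `ϖ`, its residue field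
is separable over `k₀`, and `M` is separable over `K`. -/
structure IsTameField (V : ValuationSubring E) (k₀ : Subfield (IsLocalRing.ResidueField V))
    (M : IntermediateField K E) (ϖ : E) : Prop where
  mem : ϖ ∈ M
  ne_zero : ϖ ≠ 0
  lt_one : V.valuation ϖ < 1
  arch : ∀ y : E, y ≠ 0 → ∃ n : ℕ, V.valuation ϖ ^ n ≤ V.valuation y
  val : ∀ x ∈ M, x ≠ 0 → ∃ n : ℤ, V.valuation x = V.valuation ϖ ^ n
  res : ∀ x (hx : x ∈ V), x ∈ M →
    IsLocalRing.residue V ⟨x, hx⟩ ∈ separableClosure k₀ (IsLocalRing.ResidueField V)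
  le_base : ∀ r ∈ k₀, ∃ x : V, (x : E) ∈ M ∧ IsLocalRing.residue V x = r
  sep : M ≤ separableClosure K E

/-- The valuation ring of the field `M`. -/
def valuationRingOf (V : ValuationSubring E) (M : IntermediateField K E) : Subring E :=
  M.toSubfield.toSubring ⊓ V.toSubring

variable {M : IntermediateField K E} {ϖ : E}

theorem valuationRingOf_le (M : IntermediateField K E) : valuationRingOf V M ≤ V.toSubring :=
  inf_le_right

namespace IsTameField

theorem valuation_pos (hM : IsTameField V k₀ M ϖ) : 0 < V.valuation ϖ := by
  simpa [zero_lt_iff] using hM.ne_zero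

theorem isField (hM : IsTameField V k₀ M ϖ) : IsField (resField V (valuationRingOf V M)) := by
  refine isField_resField (k₀ := k₀) (fun r hr => ?_) fun x hx hxM => ?_
  · obtain ⟨x, hx, rfl⟩ := hM.le_base r hr
    exact ⟨⟨x, hx, x.2⟩, rfl⟩
  · exact (mem_separableClosure_iff.mp (hM.res x hx hxM.1)).isIntegral.isAlgebraic

theorem div (hM : IsTameField V k₀ M ϖ) :
    ∀ x ∈ valuationRingOf V M, V.valuation x < 1 → ∃ y ∈ valuationRingOf V M, x = ϖ * y := by
  rintro x ⟨hxM, hxV⟩ hx1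
  by_cases hx0 : x = 0
  · exact ⟨0, Subring.zero_mem _, by simp [hx0]⟩
  obtain ⟨n, hn⟩ := hM.val x hxM hx0
  refine ⟨x / ϖ, ⟨show x / ϖ ∈ M from div_mem hxM hM.mem, ?_⟩,
    by field_simp [hM.ne_zero]⟩
  change x / ϖ ∈ V
  rw [← V.valuation_le_one_iff, map_div₀, hn, div_le_one₀ hM.valuation_pos]
  rw [hn] at hx1
  have hn1 : 1 ≤ n := by
    by_contra h
    exact absurd hx1 (not_lt.mpr (one_le_zpow_of_nonpos₀ hM.valuation_pos hM.lt_one.le (by omega)))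
  calc V.valuation ϖ ^ n ≤ V.valuation ϖ ^ (1 : ℤ) :=
        zpow_le_zpow_right_of_le_one₀ hM.valuation_pos hM.lt_one.le hn1
    _ = V.valuation ϖ := zpow_one _

/-- Denominators are powers of the uniformizer. -/
theorem exists_lift_pow_mul (hM : IsTameField V k₀ M ϖ) (r : M[X]) :
    ∃ (n : ℕ) (p : (inside V (valuationRingOf V M))[X]),
      ∀ c, p.eval₂ (incl V _) c = ϖ ^ n * aeval c r := by
  have h1 : ∀ i, ∃ n : ℕ, V.valuation (ϖ ^ n * (r.coeff i : E)) ≤ 1 := by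
    intro i
    by_cases h0 : (r.coeff i : E) = 0
    · exact ⟨0, by simp [h0]⟩
    · obtain ⟨n, hn⟩ := hM.arch (r.coeff i : E)⁻¹ (inv_ne_zero h0)
      refine ⟨n, ?_⟩
      rw [map_mul, map_pow]
      rw [map_inv₀] at hn
      rwa [le_inv_comm₀ (pow_pos hM.valuation_pos n) (by simpa [zero_lt_iff] using h0),
        ← one_div, le_div_iff₀ (pow_pos hM.valuation_pos n), mul_comm] at hn
  choose n hn using h1
  let N := r.support.sup n
  have hN : ∀ i, V.valuation (ϖ ^ N * (r.coeff i : E)) ≤ 1 := by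
    intro i
    by_cases hi : i ∈ r.support
    · obtain ⟨k, hk⟩ := Nat.exists_eq_add_of_le (Finset.le_sup (f := n) hi)
      rw [show N = n i + k from hk, add_comm, pow_add, mul_assoc, map_mul, map_pow]
      exact mul_le_one' (pow_le_one' hM.lt_one.le k) (hn i)
    · simp [notMem_support_iff.mp hi]
  obtain ⟨p, hp⟩ := exists_lift (valuationRingOf_le (V := V) M)
    (p := C (ϖ ^ N) * r.map (algebraMap M E)) (fun i => by
      rw [coeff_C_mul, coeff_map]
      exact ⟨mul_mem (pow_mem hM.mem _) (r.coeff i).2, (V.valuation_le_one_iff _).mp (hN i)⟩)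
  refine ⟨N, p, fun c => ?_⟩
  rw [← eval_map, hp, eval_mul, eval_C, eval_map_algebraMap]

/-- Étale extensions. -/
theorem adjoin_simple_root (hM : IsTameField V k₀ M ϖ) {c : E} (hc : c ∈ V) {g : E[X]}
    (hgM : ∀ i, g.coeff i ∈ M) (hgV : ∀ i, g.coeff i ∈ V) (hg : g.eval c = 0)
    (hg' : V.valuation ((derivative g).eval c) = 1) :
    ∃ M' : IntermediateField K E, M ≤ M' ∧ c ∈ M' ∧ IsTameField V k₀ M' ϖ := by
  set A := valuationRingOf V M with hAdef
  have hA : A ≤ V.toSubring := valuationRingOf_le M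
  obtain ⟨g, rfl⟩ := exists_lift hA (p := g) fun i => ⟨hgM i, hgV i⟩
  rw [derivative_map] at hg'
  rw [eval_map] at hg hg'
  have hϖA : ϖ ∈ A := ⟨hM.mem, (V.valuation_le_one_iff _).mp hM.lt_one.le⟩
  have hdiv := adjoinElem_div_of_simple_root hA hϖA hM.div hM.isField hc hg hg'
  have hSV : adjoinElem A c ≤ V.toSubring := adjoinElem_le hA hc
  have hcres : IsLocalRing.residue V ⟨c, hc⟩ ∈
      separableClosure k₀ (IsLocalRing.ResidueField V) := by
    refine mem_separableClosure_of_simple_root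
      (g := (g.map (red V A)).map (resField V A).subtype) (fun i => ?_) ?_ ?_
    · rw [coeff_map, coeff_map]
      exact hM.res _ (g.coeff i).1.2 (g.coeff i).2.1
    · rw [eval_map, eval₂_red_eq_zero_iff, hg]; simp
    · rw [derivative_map, derivative_map, eval_map, Ne, eval₂_red_eq_zero_iff, hg']; simp
  have hSres : ∀ x (hx : x ∈ V), x ∈ adjoinElem A c →
      IsLocalRing.residue V ⟨x, hx⟩ ∈ separableClosure k₀ (IsLocalRing.ResidueField V) := by
    intro x hx hxS
    obtain ⟨p, rfl⟩ := (mem_adjoinElem_iff hA).mp hxS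
    have : (⟨p.eval₂ (incl V A) c, hx⟩ : V) = p.eval₂ (inside V A).subtype ⟨c, hc⟩ :=
      Subtype.ext (eval₂_incl_mem hc p)
    rw [this, ← eval₂_red, eval₂_eq_sum]
    refine sum_mem fun i _ => mul_mem ?_ (pow_mem hcres i)
    rw [coeff_map]
    exact hM.res _ (p.coeff i).1.2 (p.coeff i).2.1
  have hsep : IsSeparable M c := by
    let j : inside V A →+* M := (incl V A).codRestrict M.toSubfield.toSubring fun a => a.2.1
    have hj : ∀ p : (inside V A)[X], aeval c (p.map j) = p.eval₂ (incl V A) c := fun p => by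
      rw [aeval_def, eval₂_map]; rfl
    refine isSeparable_of_simple_root (g := g.map j) (by rw [hj, hg]) ?_
    rw [derivative_map, hj]
    intro h0
    rw [h0] at hg'
    simp at hg'
  -- `A[c]` need not be the valuation ring of M(c), since other maximal ideals can occur. Values and
  -- residues on M(c) are therefore read off from quotients of elements of `A[c]`, after clearing
  -- denominators by powers of ϖ.
  have hrep : ∀ x ∈ (M⟮c⟯).restrictScalars K, ∃ p ∈ adjoinElem A c, ∃ q ∈ adjoinElem A c,
      x = p / q := by
    intro x hx
    obtain ⟨r, s, rfl⟩ := mem_adjoin_simple_iff M x |>.mp hx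
    obtain ⟨n, p, hp⟩ := hM.exists_lift_pow_mul r
    obtain ⟨m, q, hq⟩ := hM.exists_lift_pow_mul s
    have hϖc := le_adjoinElem A c hϖA
    refine ⟨ϖ ^ m * p.eval₂ (incl V A) c, mul_mem (pow_mem hϖc _)
      ((mem_adjoinElem_iff hA).mpr ⟨p, rfl⟩), ϖ ^ n * q.eval₂ (incl V A) c, mul_mem (pow_mem hϖc _)
      ((mem_adjoinElem_iff hA).mpr ⟨q, rfl⟩), ?_⟩
    rw [hp, hq]
    have := hM.ne_zero
    field_simp
  have hle : ∀ x ∈ M, x ∈ (M⟮c⟯).restrictScalars K :=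
    fun x hx => (M⟮c⟯).algebraMap_mem ⟨x, hx⟩
  refine ⟨(M⟮c⟯).restrictScalars K, hle, mem_adjoin_simple_self M c,
    ⟨hle _ hM.mem, hM.ne_zero, hM.lt_one, hM.arch, ?_, ?_, ?_, ?_⟩⟩
  · intro x hx hx0
    obtain ⟨p, hp, q, hq, rfl⟩ := hrep x hx
    obtain ⟨n, p', hp', q', hq', h1, h2, h3⟩ :=
      exists_zpow_of_div hM.arch hM.lt_one hM.ne_zero hSV hdiv hp hq hx0
    exact ⟨n, by rw [h3, map_mul, map_zpow₀, map_div₀, h1, h2, div_one, mul_one]⟩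
  · intro x hxV hx
    obtain ⟨p, hp, q, hq, rfl⟩ := hrep x hx
    exact residue_div_mem hM.arch hM.lt_one hM.ne_zero hSV hdiv hSres hp hq hxV
  · intro r hr
    obtain ⟨x, hx, h⟩ := hM.le_base r hr
    exact ⟨x, hle _ hx, h⟩
  · have h2 : Algebra.IsSeparable K M := (le_separableClosure_iff K E M).mp hM.sep
    have h1 : M⟮c⟯ ≤ separableClosure M E :=
      adjoin_simple_le_iff.mpr (mem_separableClosure_iff.mpr hsep)
    intro x hx
    have h3 : IsSeparable M x := mem_separableClosure_iff.mp (h1 hx)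
    exact mem_separableClosure_iff.mpr (IsSeparable.of_algebra_isSeparable_of_isSeparable K h3)

theorem congr (hM : IsTameField V k₀ M ϖ) {ρ : E} (hρ : ρ ∈ M)
    (h : V.valuation ρ = V.valuation ϖ) : IsTameField V k₀ M ρ where
  mem := hρ
  ne_zero := by
    rintro rfl
    rw [map_zero] at h
    exact hM.ne_zero (V.valuation.zero_iff.mp h.symm)
  lt_one := h ▸ hM.lt_one
  arch := by rw [h]; exact hM.arch
  val := by rw [h]; exact hM.val
  res := hM.res
  le_base := hM.le_base
  sep := hM.sep

end IsTameField

end Good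

/-! ### Inertia groups -/

section Inertia

open scoped Pointwise

variable {E : Type*} [Field E] {V : ValuationSubring E}

/-- The congruence σx ≡ x on `V` already forces σ to stabilize `V`. If x were outside `V` with σx
inside, then x⁻¹, and with it σ(x⁻¹), would lie in the maximal ideal, contradicting σx·σ(x⁻¹) = 1.
-/
theorem mem_inertia_iff {F : Type*} [Field F] [Algebra F E] (σ : E ≃ₐ[F] E) :
    σ ∈ (V.inertiaSubgroup F).map (V.decompositionSubgroup F).subtype ↔
      ∀ x ∈ V, V.valuation (σ x - x) < 1 := by
  constructor
  · rintro ⟨τ, hτ, rfl⟩ x hx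
    have h1 : MulSemiringAction.toRingAut (V.decompositionSubgroup F)
      (IsLocalRing.ResidueField V) τ = 1 := hτ
    have h2 := DFunLike.congr_fun h1 (IsLocalRing.residue V ⟨x, hx⟩)
    have h3 : IsLocalRing.residue V (τ • (⟨x, hx⟩ : V)) = IsLocalRing.residue V ⟨x, hx⟩ := h2
    rw [← sub_eq_zero, ← map_sub, residue_eq_zero_iff_valuation] at h3
    exact h3
  · intro h
    have hle : ∀ x, x ∈ V ↔ σ x ∈ V := by
      intro x
      constructor
      · intro hx
        have : σ x = (σ x - x) + x := by ring
        rw [this]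
        exact add_mem ((V.valuation_le_one_iff _).mp (h x hx).le) hx
      · intro hx
        by_contra hxV
        rw [← V.valuation_le_one_iff, not_le] at hxV
        have hinv : V.valuation x⁻¹ < 1 := by
          rw [map_inv₀]; exact inv_lt_one_of_one_lt₀ hxV
        have h1 := h x⁻¹ ((V.valuation_le_one_iff _).mp hinv.le)
        have h2 : V.valuation (σ x⁻¹) < 1 := by
          have : σ x⁻¹ = (σ x⁻¹ - x⁻¹) + x⁻¹ := by ring
          rw [this]
          exact V.valuation.map_add_lt h1 hinv
        have h3 : σ x * σ x⁻¹ = 1 := by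
          rw [← map_mul, mul_inv_cancel₀, map_one]
          rintro rfl
          simp at hxV
        have h4 := congrArg V.valuation h3
        rw [map_mul, map_one, mul_comm] at h4
        exact (mul_lt_one_of_lt_of_le h2 ((V.valuation_le_one_iff _).mpr hx)).ne h4
    have hσ : σ ∈ V.decompositionSubgroup F := by
      rw [MulAction.mem_stabilizer_iff]
      ext x
      rw [ValuationSubring.mem_smul_pointwise_iff_exists]
      constructor
      · rintro ⟨y, hy, rfl⟩
        exact (hle y).mp hy
      · intro hx
        refine ⟨σ.symm x, (hle _).mpr ?_, ?_⟩
        · rwa [AlgEquiv.apply_symm_apply]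
        · exact AlgEquiv.apply_symm_apply σ x
    refine ⟨⟨σ, hσ⟩, ?_, rfl⟩
    change MulSemiringAction.toRingAut (V.decompositionSubgroup F)
      (IsLocalRing.ResidueField V) ⟨σ, hσ⟩ = 1
    ext x
    obtain ⟨x, rfl⟩ := IsLocalRing.residue_surjective x
    change IsLocalRing.residue V ((⟨σ, hσ⟩ : V.decompositionSubgroup F) • x) =
      IsLocalRing.residue V x
    rw [← sub_eq_zero, ← map_sub, residue_eq_zero_iff_valuation]
    exact h x x.2

theorem mem_strictHenselField_iff {F : Type*} [Field F] [Algebra F E] {x : E} :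
    x ∈ strictHenselField F V ↔ IsSeparable F x ∧
      ∀ σ : E ≃ₐ[F] E, (∀ y ∈ V, V.valuation (σ y - y) < 1) → σ x = x := by
  rw [strictHenselField, IntermediateField.mem_inf, mem_separableClosure_iff, mem_fixedField_iff]
  simp only [mem_inertia_iff]

variable {K : Type*} [Field K] [Algebra K E]

theorem mem_strictHenselField_adjoin {ϖ x : E} (hx : IsSeparable K x)
    (h : ∀ σ : E ≃ₐ[K] E, (∀ y ∈ V, V.valuation (σ y - y) < 1) → σ ϖ = ϖ → σ x = x) :
    x ∈ strictHenselField K⟮ϖ⟯ V := by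
  rw [mem_strictHenselField_iff]
  refine ⟨hx.tower_top K⟮ϖ⟯, fun σ hσ => h (σ.restrictScalars K) hσ ?_⟩
  exact σ.commutes ⟨ϖ, mem_adjoin_simple_self K ϖ⟩

/-- Inertia over K(ϖ) consists of the inertia elements over K that fix ϖ, so both kinds of statement
can be made with automorphisms over K. -/
theorem fixed_of_mem_strictHenselField_adjoin {ϖ x : E} (hx : x ∈ strictHenselField K⟮ϖ⟯ V)
    (σ : E ≃ₐ[K] E) (hσ : ∀ y ∈ V, V.valuation (σ y - y) < 1) (hϖ : σ ϖ = ϖ) : σ x = x := by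
  have hfix : ∀ z : K⟮ϖ⟯, σ z = z := by
    have : K⟮ϖ⟯ ≤ fixedField (Subgroup.zpowers σ) := by
      rw [adjoin_simple_le_iff, mem_fixedField_iff]
      rintro τ hτ
      obtain ⟨n, rfl⟩ := Subgroup.mem_zpowers_iff.mp hτ
      have : σ ∈ MulAction.stabilizer (E ≃ₐ[K] E) ϖ := hϖ
      exact Subgroup.zpow_mem _ this n
    exact fun z => (mem_fixedField_iff _ _).mp (this z.2) σ (Subgroup.mem_zpowers σ)
  let τ : E ≃ₐ[K⟮ϖ⟯] E := { σ with commutes' := hfix }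
  exact (mem_strictHenselField_iff.mp hx).2 τ hσ

/-- An automorphism over the strict Henselization agrees with an element of the inertia group on
finite Galois extensions. -/
theorem exists_inertia_eqOn (L : IntermediateField K E) [FiniteDimensional K L] [IsGalois K L]
    (σ : E ≃ₐ[K] E) (hσ : ∀ x ∈ strictHenselField K V, σ x = x) :
    ∃ τ : E ≃ₐ[K] E, (∀ y ∈ V, V.valuation (τ y - y) < 1) ∧ ∀ x ∈ L, τ x = σ x := by
  let I := (V.inertiaSubgroup K).map (V.decompositionSubgroup K).subtype
  let H := I.map (AlgEquiv.restrictNormalHom L)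
  -- Elements of L fixed by the image H of inertia lie in the strict Henselization, so σ fixes them.
  -- The Galois correspondence for the finite extension L then puts the restriction of σ in H,
  -- without any closedness of inertia in the Krull topology.
  have h1 : AlgEquiv.restrictNormalHom L σ ∈ fixingSubgroup (fixedField H) := by
    rw [IntermediateField.mem_fixingSubgroup_iff]
    intro x hx
    have hx' : (x : E) ∈ strictHenselField K V := by
      rw [mem_strictHenselField_iff]
      refine ⟨(IsGalois.separable K x).map (f := L.val) Subtype.val_injective, fun τ hτ => ?_⟩
      have := (mem_fixedField_iff _ _).mp hx (AlgEquiv.restrictNormalHom L τ)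
        ⟨τ, (mem_inertia_iff τ).mpr hτ, rfl⟩
      rw [← AlgEquiv.restrictNormalHom_apply, this]
    apply Subtype.ext
    change ((AlgEquiv.restrictNormalHom L σ x : L) : E) = x
    rw [AlgEquiv.restrictNormalHom_apply]
    exact hσ _ hx'
  rw [IntermediateField.fixingSubgroup_fixedField] at h1
  obtain ⟨τ, hτ, h2⟩ := h1
  refine ⟨τ, (mem_inertia_iff τ).mp hτ, fun x hx => ?_⟩
  have := congrArg (fun s : L ≃ₐ[K] L => ((s ⟨x, hx⟩ : L) : E)) h2
  simpa only [AlgEquiv.restrictNormalHom_apply] using this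

/-- If x were outside K^sh(ϖ), an automorphism over that field would move x. On a finite Galois
extension containing x and ϖ it agrees with an inertia element, which fixes ϖ and hence x.
Separability of ϖ is what makes such an extension available. -/
theorem strictHenselField_adjoin_le_kummerField [IsAlgClosure K E] {ϖ : E} (hϖ : IsSeparable K ϖ) :
    ∀ x ∈ strictHenselField K⟮ϖ⟯ V, x ∈ kummerField K V ϖ := by
  intro x hx
  have hE : IsAlgClosed E := IsAlgClosure.isAlgClosed K
  have halg : Algebra.IsAlgebraic K E := IsAlgClosure.isAlgebraic
  have hxK : IsSeparable K x := by
    have := (isSeparable_adjoin_simple_iff_isSeparable K E).mpr hϖ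
    exact IsSeparable.of_algebra_isSeparable_of_isSeparable K (mem_strictHenselField_iff.mp hx).1
  set N := kummerField K V ϖ with hN
  by_contra hxN
  have hbot : x ∉ (⊥ : Subalgebra N E) := by
    rintro ⟨y, rfl⟩
    exact hxN y.2
  obtain ⟨y, hy, hconj⟩ := (notMem_iff_exists_ne_and_isConjRoot (hxK.tower_top N)
    (IsAlgClosed.splits _)).mp hbot
  have hNE : Algebra.IsAlgebraic N E := Algebra.IsAlgebraic.tower_top (K := K) N
  have : IsAlgClosure N E := ⟨hE, hNE⟩
  have : Normal N E := normal_iff.mpr fun z => ⟨(hNE.isAlgebraic z).isIntegral, IsAlgClosed.splits _⟩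
  obtain ⟨σ, hσ⟩ := isConjRoot_iff_exists_algEquiv.mp hconj
  have hle : K⟮x, ϖ⟯ ≤ separableClosure K E := by
    rw [adjoin_le_iff]
    rintro z (rfl | rfl)
    exacts [mem_separableClosure_iff.mpr hxK, mem_separableClosure_iff.mpr hϖ]
  let L := normalClosure K K⟮x, ϖ⟯ E
  have hKE : Normal K E := normal_iff.mpr fun z =>
    ⟨(halg.isAlgebraic z).isIntegral, IsAlgClosed.splits _⟩
  have hfin : FiniteDimensional K K⟮x, ϖ⟯ := finiteDimensional_adjoin fun z _ =>
    (halg.isAlgebraic z).isIntegral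
  have hLsep : Algebra.IsSeparable K L := by
    refine (le_separableClosure_iff K E L).mp (normalClosure_le_iff.mpr ?_)
    rintro f _ ⟨z, rfl⟩
    have hz : IsSeparable K z := ((le_separableClosure_iff K E _).mp hle).isSeparable K z
    exact mem_separableClosure_iff.mpr (hz.map (f := f) f.injective)
  have hL : IsGalois K L := ⟨⟩
  have hxL : x ∈ L := le_normalClosure _ (subset_adjoin K _ (by simp))
  have hϖL : ϖ ∈ L := le_normalClosure _ (subset_adjoin K _ (by simp))
  have hfix : ∀ z ∈ N, σ.restrictScalars K z = z := fun z hz => σ.commutes ⟨z, hz⟩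
  obtain ⟨τ, hτ, hτL⟩ := exists_inertia_eqOn (V := V) L (σ.restrictScalars K) fun z hz =>
    hfix z ((le_sup_left : strictHenselField K V ≤ N) hz)
  have hτϖ : τ ϖ = ϖ := by
    rw [hτL ϖ hϖL]
    exact hfix ϖ ((le_sup_right : K⟮ϖ⟯ ≤ N) (mem_adjoin_simple_self K ϖ))
  have h1 := fixed_of_mem_strictHenselField_adjoin hx τ hτ hτϖ
  rw [hτL x hxL] at h1
  have h2 : σ x = x := h1
  apply hy
  apply σ.injective
  rw [hσ, h2]

/-- Simple roots of polynomials over the fixed ring are fixed by inertia. -/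
theorem apply_eq_of_simple_root {σ : E →+* E} (hσ : ∀ y ∈ V, V.valuation (σ y - y) < 1) {g : E[X]}
    (hgV : ∀ i, g.coeff i ∈ V) (hgσ : ∀ i, σ (g.coeff i) = g.coeff i) {c : E} (hc : c ∈ V)
    (hg : g.eval c = 0) (hg' : V.valuation ((derivative g).eval c) = 1) : σ c = c := by
  have h1 : g.eval (σ c) = 0 := by
    have h2 : g.map σ = g := by ext i; rw [coeff_map, hgσ]
    rw [← h2, eval_map, eval₂_at_apply, hg, map_zero]
  obtain ⟨g, rfl⟩ : ∃ G : V[X], G.map V.subtype = g := by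
    have : g ∈ lifts V.subtype := by
      rw [lifts_iff_coeff_lifts]
      exact fun l => ⟨⟨_, hgV l⟩, rfl⟩
    exact this
  set d : V := ⟨σ c - c, (V.valuation_le_one_iff _).mp (hσ c hc).le⟩ with hd
  obtain ⟨w, hw⟩ := binomExpansion g ⟨c, hc⟩ d
  have hev : ∀ (p : V[X]) (z : V), (p.map V.subtype).eval (z : E) = ((p.eval z : V) : E) :=
    fun p z => by
      rw [eval_map, show (z : E) = V.subtype z from rfl, eval₂_at_apply]; rfl
  have e1 : g.eval (⟨c, hc⟩ + d) = 0 := by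
    apply Subtype.ext
    rw [← hev]
    simpa [hd] using h1
  have e2 : g.eval ⟨c, hc⟩ = 0 := by
    apply Subtype.ext
    rw [← hev]
    exact hg
  rw [derivative_map, show c = ((⟨c, hc⟩ : V) : E) from rfl, hev] at hg'
  rw [e1, e2, zero_add] at hw
  by_contra hne
  have hd0 : d ≠ 0 := fun h0 => hne (sub_eq_zero.mp (congrArg Subtype.val h0))
  -- Both c and c + d are roots, so the Taylor expansion gives g'(c)d + wd² = 0. If d ≠ 0,
  -- cancelling it makes the unit g'(c) an element of the maximal ideal.
  have h3 : (derivative g).eval ⟨c, hc⟩ = - (w * d) := by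
    refine mul_right_cancel₀ hd0 ?_
    linear_combination -hw
  rw [h3] at hg'
  have h4 : V.valuation ((-(w * d) : V) : E) < 1 := by
    push_cast
    rw [Valuation.map_neg, map_mul, mul_comm]
    exact mul_lt_one_of_lt_of_le (hσ c hc) ((V.valuation_le_one_iff _).mpr w.2)
  exact h4.ne hg'

end Inertia

/-! ### The residue field of the base ring -/

section Base

set_option linter.unusedSectionVars false

variable {R K E : Type*} [CommRing R] [IsDomain R] [IsLocalRing R]
    [Field K] [Algebra R K] [IsFractionRing R K]
    [Field E] [Algebra K E] [Algebra R E] [IsScalarTower R K E]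
    {V : ValuationSubring E}

/-- The residue field of `R`, as a subfield of the residue field of `V`. -/
def baseResidueField (hV : ∀ x : K, algebraMap K E x ∈ V ↔ x ∈ (algebraMap R K).range) :
    Subfield (IsLocalRing.ResidueField V) :=
  { resField V (algebraMap R E).range with
    inv_mem' := by
      rintro _ ⟨⟨⟨y, hx⟩, ⟨x, hxy⟩⟩, rfl⟩
      change algebraMap R E x = y at hxy
      subst hxy
      by_cases h : x ∈ IsLocalRing.maximalIdeal R
      · rw [← valuation_algebraMap_lt_one_iff hV, ← residue_eq_zero_iff_valuation ⟨_, hx⟩] at h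
        change (IsLocalRing.residue V ⟨_, hx⟩)⁻¹ ∈ resField V _
        rw [h, inv_zero]
        exact zero_mem _
      · rw [IsLocalRing.mem_maximalIdeal, mem_nonunits_iff, not_not] at h
        obtain ⟨u, rfl⟩ := h
        refine ⟨⟨⟨algebraMap R E ↑u⁻¹, algebraMap_mem_of_valuation hV _⟩, ⟨_, rfl⟩⟩, ?_⟩
        change IsLocalRing.residue V _ = (IsLocalRing.residue V ⟨_, hx⟩)⁻¹
        refine eq_inv_of_mul_eq_one_left ?_
        rw [← map_mul, ← map_one (IsLocalRing.residue V)]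
        congr 1
        apply Subtype.ext
        change algebraMap R E _ * algebraMap R E _ = 1
        rw [← map_mul]; simp }

variable (hV : ∀ x : K, algebraMap K E x ∈ V ↔ x ∈ (algebraMap R K).range)

theorem residue_algebraMap_mem (x : R) (hx : algebraMap R E x ∈ V) :
    IsLocalRing.residue V ⟨algebraMap R E x, hx⟩ ∈ baseResidueField hV :=
  ⟨⟨⟨_, hx⟩, ⟨x, rfl⟩⟩, rfl⟩

theorem baseResidueField_le {A : Subring E} (hA : (algebraMap R E).range ≤ A) :
    (baseResidueField hV).toSubring ≤ resField V A := by
  rintro _ ⟨x, rfl⟩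
  exact ⟨⟨x.1, hA x.2⟩, rfl⟩

theorem exists_of_mem_baseResidueField {r : IsLocalRing.ResidueField V}
    (hr : r ∈ baseResidueField hV) :
    ∃ (x : R), IsLocalRing.residue V ⟨algebraMap R E x, algebraMap_mem_of_valuation hV x⟩ = r := by
  obtain ⟨⟨⟨y, hx⟩, ⟨x, hxy⟩⟩, rfl⟩ := hr
  change algebraMap R E x = y at hxy
  subst hxy
  exact ⟨x, rfl⟩

/-- The inclusion of `R` into `V`. -/
def baseMap : R →+* V :=
  (algebraMap R E).codRestrict V.toSubring (algebraMap_mem_of_valuation hV)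

theorem valuation_eval_algebraMap (g : R[X]) (y : V) :
    (g.map (baseMap hV)).eval y =
      aeval (y : E) g := by
  change V.subtype _ = _
  rw [eval_map, hom_eval₂, aeval_def]
  rfl

/-- Elements with separable residue are simple roots modulo the maximal ideal. -/
theorem exists_lift_of_mem_separableClosure {x : V}
    (hx : IsLocalRing.residue V x ∈
      separableClosure (baseResidueField hV) (IsLocalRing.ResidueField V)) :
    ∃ g : R[X], V.valuation (aeval (x : E) g) < 1 ∧
      V.valuation (aeval (x : E) (derivative g)) = 1 := by
  rw [mem_separableClosure_iff] at hx
  let φ : R →+* baseResidueField hV :=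
    ((IsLocalRing.residue V).comp (baseMap hV)).codRestrict _
      fun x => residue_algebraMap_mem hV x _
  have hφ : Function.Surjective φ := by
    rintro ⟨r, hr⟩
    obtain ⟨x, rfl⟩ := exists_of_mem_baseResidueField hV hr
    exact ⟨x, rfl⟩
  obtain ⟨g, hg⟩ := map_surjective φ hφ (minpoly (baseResidueField hV) (IsLocalRing.residue V x))
  have key : ∀ p : R[X], aeval (IsLocalRing.residue V x) (p.map φ) = IsLocalRing.residue V
      ((p.map (baseMap hV)).eval x) := by
    intro p
    rw [aeval_def, eval₂_map, eval_map, hom_eval₂]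
    rfl
  refine ⟨g, ?_, ?_⟩
  · rw [← valuation_eval_algebraMap hV, ← residue_eq_zero_iff_valuation, ← key, hg,
      minpoly.aeval]
  · rw [← valuation_eval_algebraMap hV, ← residue_ne_zero_iff_valuation, ← key, ← derivative_map,
      hg]
    exact Separable.aeval_derivative_ne_zero hx (minpoly.aeval _ _)

/-- Inertial automorphisms that fix the uniformizer fix the whole field. -/
theorem IsTameField.apply_eq {M : IntermediateField K E} {ϖ : E}
    (hM : IsTameField V (baseResidueField hV) M ϖ) {σ : E ≃ₐ[K] E}
    (hσ : ∀ y ∈ V, V.valuation (σ y - y) < 1) (hϖ : σ ϖ = ϖ) {x : E} (hx : x ∈ M) : σ x = x := by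
  -- The displacement σx - x is shown to be smaller than every power of ϖ, hence zero. Choose g over
  -- `R` for which x is a simple root modulo the maximal ideal. Then g(x) = ϖz with z in M ∩ V, and
  -- since σ fixes ϖ and the coefficients of g, Taylor expansion gives ϖ(σz - z) = (σx - x)·unit.
  -- Each such passage gains one factor ϖ.
  have key : ∀ m : ℕ, ∀ x ∈ M, x ∈ V → V.valuation (σ x - x) < V.valuation ϖ ^ m := by
    intro m
    induction m with
    | zero => intro x _ hxV; simpa using hσ x hxV
    | succ m ih =>
      intro x hxM hxV
      obtain ⟨g, hg, hg'⟩ := exists_lift_of_mem_separableClosure hV (hM.res x hxV hxM)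
      have hgK : ∀ y : E, aeval y g = aeval y (g.map (algebraMap R K)) := fun y => by
        rw [aeval_map_algebraMap]
      have hgM : aeval x g ∈ M := by
        rw [hgK]
        have := aeval_algHom_apply M.val (⟨x, hxM⟩ : M) (g.map (algebraMap R K))
        exact this ▸ Subtype.property _
      obtain ⟨z, ⟨hzM, hzV⟩, hz⟩ := hM.div _ ⟨hgM, (V.valuation_le_one_iff _).mp hg.le⟩ hg
      have hσg : aeval (σ x) g = ϖ * σ z := by
        rw [hgK, ← AlgEquiv.coe_toAlgHom, aeval_algHom_apply, AlgEquiv.coe_toAlgHom, ← hgK, hz, map_mul, hϖ]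
      set d : V := ⟨σ x - x, (V.valuation_le_one_iff _).mp (hσ x hxV).le⟩ with hd
      obtain ⟨k, hk⟩ := binomExpansion (g.map (baseMap hV)) ⟨x, hxV⟩ d
      have hk' := congrArg V.subtype hk
      rw [map_add, map_add, map_mul, map_mul, map_pow, derivative_map] at hk'
      simp only [ValuationSubring.subtype_apply, valuation_eval_algebraMap] at hk'
      have hxd : ((⟨x, hxV⟩ + d : V) : E) = σ x := by
        change x + (σ x - x) = σ x
        ring
      rw [hxd, hσg, hz] at hk'
      have h1 : V.valuation ((k : E) * (σ x - x)) < 1 := by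
        rw [map_mul, mul_comm]
        exact mul_lt_one_of_lt_of_le (hσ x hxV) ((V.valuation_le_one_iff _).mpr k.2)
      have h2 : V.valuation (aeval x (derivative g) + k * (σ x - x)) = 1 := by
        rw [Valuation.map_add_eq_of_lt_left, hg']
        rwa [hg']
      have h3 : ϖ * (σ z - z) = (σ x - x) * (aeval x (derivative g) + k * (σ x - x)) := by
        change ϖ * σ z = ϖ * z + aeval x (derivative g) * (σ x - x) + k * (σ x - x) ^ 2 at hk'
        linear_combination hk'
      have h4 := congrArg V.valuation h3
      rw [map_mul, map_mul, h2, mul_one] at h4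
      rw [← h4, pow_succ']
      exact (mul_lt_mul_iff_right₀ hM.valuation_pos).mpr (ih z hzM hzV)
  have hfix : ∀ x ∈ M, x ∈ V → σ x = x := by
    intro x hxM hxV
    by_contra hne
    obtain ⟨n, hn⟩ := hM.arch _ (sub_ne_zero.mpr hne)
    exact absurd (key n x hxM hxV) (not_lt.mpr hn)
  rcases V.mem_or_inv_mem x with hxV | hxV
  · exact hfix x hx hxV
  · have := hfix x⁻¹ (inv_mem hx) hxV
    rw [map_inv₀] at this
    exact inv_injective this

end Base

/-! ### The splitting field of a tame polynomial -/

section Tame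

set_option linter.unusedSectionVars false

variable {R K : Type*} [CommRing R] [IsDomain R] [IsDiscreteValuationRing R]
    [Field K] [Algebra R K] [IsFractionRing R K]

theorem isGalois_splitField {f : R[X]} (hf : Algebra.IsSeparable K (SplitField R K f)) :
    IsGalois K (SplitField R K f) where
  to_isSeparable := hf
  to_normal := Normal.of_isSplittingField (f.map (algebraMap R K))

/-- The Galois group acts faithfully on the set of roots, which has at most deg f elements. -/
theorem card_gal_dvd_factorial (f : R[X]) :
    Nat.card (SplitField R K f ≃ₐ[K] SplitField R K f) ∣ f.natDegree.factorial := by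
  let p := f.map (algebraMap R K)
  have : Fact ((p.map (algebraMap K p.SplittingField)).Splits) := ⟨SplittingField.splits p⟩
  have h1 := Subgroup.card_dvd_of_injective _ (Gal.galActionHom_injective p p.SplittingField)
  rw [Nat.card_perm] at h1
  refine h1.trans (Nat.factorial_dvd_factorial ?_)
  have := ncard_rootSet_le p p.SplittingField
  rw [← Nat.card_coe_set_eq] at this
  exact this.trans natDegree_map_le

/-- In the Galois case the number of primes, the ramification index and the residue degree multiply
to the order of the group. -/
theorem ramificationIdx_dvd_factorial {f : R[X]} (hf : Algebra.IsSeparable K (SplitField R K f))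
    (𝔐 : Ideal (integralClosure R (SplitField R K f))) [𝔐.IsPrime]
    [𝔐.LiesOver (IsLocalRing.maximalIdeal R)] :
    𝔐.ramificationIdx R ∣ f.natDegree.factorial := by
  let L := SplitField R K f
  let S := integralClosure R L
  have : IsGalois K L := isGalois_splitField hf
  have : Module.Finite R S := IsIntegralClosure.finite R K L S
  have : IsFractionRing S L := IsIntegralClosure.isFractionRing_of_finite_extension R K L S
  let : MulSemiringAction (L ≃ₐ[K] L) S := IsIntegralClosure.MulSemiringAction R K L S
  have : IsGaloisGroup (L ≃ₐ[K] L) R S := IsGaloisGroup.of_isFractionRing _ _ _ K L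
  have : FaithfulSMul R L := (faithfulSMul_iff_algebraMap_injective R L).mpr (by
    rw [IsScalarTower.algebraMap_eq R K L]
    exact (algebraMap K L).injective.comp (IsFractionRing.injective R K))
  have : Module.IsTorsionFree R S := inferInstance
  have h1 := Ideal.ncard_primesOver_mul_ramificationIdxIn_mul_inertiaDegIn
    (IsLocalRing.maximalIdeal R) S (L ≃ₐ[K] L)
  rw [Ideal.ramificationIdxIn_eq_ramificationIdx (IsLocalRing.maximalIdeal R) 𝔐 (L ≃ₐ[K] L)] at h1
  refine dvd_trans ?_ (card_gal_dvd_factorial (K := K) f)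
  rw [← h1]
  exact Dvd.dvd.mul_left (Dvd.intro _ rfl) _

variable {E : Type*} [Field E] [Algebra K E] [IsAlgClosure K E] [Algebra R E] [IsScalarTower R K E]
    {V : ValuationSubring E}

theorem arch_of_pow_eq [Algebra.IsAlgebraic K E]
    (hV : ∀ x : K, algebraMap K E x ∈ V ↔ x ∈ (algebraMap R K).range)
    {π : R} (hπ : Irreducible π) {ϖ : E} {e : ℕ}
    (h : V.valuation ϖ ^ e = V.valuation (algebraMap R E π)) (y : E) (hy : y ≠ 0) :
    ∃ n : ℕ, V.valuation ϖ ^ n ≤ V.valuation y := by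
  obtain ⟨n, hn⟩ := exists_pow_valuation_le hV hπ hy
  exact ⟨e * n, by rwa [pow_mul, h]⟩

theorem algebraMap_irreducible_ne_zero (K : Type*) [Field K] [Algebra R K] [IsFractionRing R K]
    {E : Type*} [Field E] [Algebra K E] [Algebra R E] [IsScalarTower R K E]
    {π : R} (hπ : Irreducible π) : algebraMap R E π ≠ 0 := by
  rw [IsScalarTower.algebraMap_apply R K E, Ne, map_eq_zero, IsFractionRing.to_map_eq_zero_iff]
  exact hπ.ne_zero

/-- The image in `E` of the splitting field of a tame polynomial. -/
theorem exists_isTameField_of_isTame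
    (hV : ∀ x : K, algebraMap K E x ∈ V ↔ x ∈ (algebraMap R K).range)
    {π : R} (hπ : Irreducible π) {f : R[X]} (hf : IsTame R K f) (hf0 : f ≠ 0) :
    ∃ e : ℕ, e ∣ f.natDegree.factorial ∧ V.valuation (e : E) = 1 ∧
      ∃ (ϖ : E) (M : IntermediateField K E), IsTameField V (baseResidueField hV) M ϖ ∧
        V.valuation ϖ ^ e = V.valuation (algebraMap R E π) ∧
        ∀ γ : E, aeval γ f = 0 → γ ∈ M := by
  have hE : IsAlgClosed E := IsAlgClosure.isAlgClosed K
  have halg : Algebra.IsAlgebraic K E := IsAlgClosure.isAlgebraic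
  let L := SplitField R K f
  let S := integralClosure R L
  have hfin : FiniteDimensional K L := inferInstance
  have hsepL : Algebra.IsSeparable K L := hf.1
  have : IsFractionRing S L := IsIntegralClosure.isFractionRing_of_finite_extension R K L S
  have : IsDedekindDomain S := IsIntegralClosure.isDedekindDomain R K L S
  let ι : L →ₐ[K] E := IsAlgClosed.lift
  have hιR : ∀ x : R, ι (algebraMap R L x) = algebraMap R E x := fun x => by
    rw [IsScalarTower.algebraMap_apply R K L, AlgHom.commutes, ← IsScalarTower.algebraMap_apply]
  let j : S →+* V := ((ι : L →+* E).comp S.val.toRingHom).codRestrict V.toSubring fun x =>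
    mem_of_isIntegral hV (by
      have : IsIntegral R (x : L) := x.2
      exact this.map (ι.restrictScalars R))
  have hj : ∀ x : S, ((j x : V) : E) = ι (x : L) := fun x => rfl
  have hjinj : ∀ x : S, x ≠ 0 → ((j x : V) : E) ≠ 0 := fun x hx h => by
    rw [hj, map_eq_zero] at h
    exact hx (Subtype.ext h)
  let 𝔐 : Ideal S := (IsLocalRing.maximalIdeal V).comap j
  have hmem : ∀ x : S, x ∈ 𝔐 ↔ V.valuation ((j x : V) : E) < 1 := fun x => by
    rw [Ideal.mem_comap, ← IsLocalRing.residue_eq_zero_iff, residue_eq_zero_iff_valuation]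
  have hnotmem : ∀ x : S, x ∉ 𝔐 → V.valuation ((j x : V) : E) = 1 := fun x hx => by
    rw [hmem, not_lt] at hx
    exact le_antisymm ((V.valuation_le_one_iff _).mpr (j x).2) hx
  have hprime : 𝔐.IsPrime := Ideal.IsPrime.comap j
  have hover : 𝔐.LiesOver (IsLocalRing.maximalIdeal R) := ⟨by
    ext x
    rw [Ideal.under, Ideal.mem_comap, hmem, hj, ← valuation_algebraMap_lt_one_iff hV, ← hιR]
    rfl⟩
  obtain ⟨he, hres⟩ := hf.2 𝔐 hprime hover
  set e := 𝔐.ramificationIdx R with he_def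
  have hπS : algebraMap R S π ∈ 𝔐 := by
    rw [hmem, hj]
    change V.valuation (ι (algebraMap R L π)) < 1
    rw [hιR, valuation_algebraMap_lt_one_iff hV]
    exact hπ.not_isUnit
  have hjπ : ((j (algebraMap R S π) : V) : E) = algebraMap R E π := hιR π
  have hπ0 : algebraMap R E π ≠ 0 := algebraMap_irreducible_ne_zero K hπ
  have hbot : 𝔐 ≠ ⊥ := by
    intro h
    rw [h, Ideal.mem_bot] at hπS
    rw [hπS, map_zero] at hjπ
    exact hπ0 hjπ.symm
  obtain ⟨P, hP, hP2⟩ := Ideal.exists_mem_pow_notMem_pow_succ 𝔐 hbot hprime.ne_top 1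
  rw [pow_one] at hP
  -- P is a uniformizer at 𝔐 but may lie in other primes of `S`. An element s of the cofactor ideal
  -- J outside 𝔐 removes them: it is a unit of `V` and multiplies 𝔐 into (P).
  obtain ⟨J, hJ⟩ : 𝔐 ∣ Ideal.span {P} := Ideal.dvd_span_singleton.mpr hP
  have hJ' : ¬ J ≤ 𝔐 := by
    intro h
    apply hP2
    have : Ideal.span {P} ≤ 𝔐 ^ (1 + 1) := by
      rw [hJ, pow_succ, pow_one]
      exact Ideal.mul_mono le_rfl h
    exact this (Ideal.mem_span_singleton_self P)
  obtain ⟨s, hsJ, hs⟩ := Set.not_subset.mp hJ'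
  have hsv := hnotmem s hs
  have hdvd : ∀ x ∈ 𝔐, ∃ y : S, s * x = P * y := by
    intro x hx
    have : s * x ∈ Ideal.span {P} := by
      rw [hJ, mul_comm 𝔐 J]
      exact Ideal.mul_mem_mul hsJ hx
    exact Ideal.mem_span_singleton.mp this
  have hP0 : P ≠ 0 := by
    rintro rfl
    exact hP2 (Ideal.zero_mem _)
  set ϖ : E := ((j P : V) : E) with hϖ_def
  have hϖ0 : ϖ ≠ 0 := hjinj P hP0
  have hϖ1 : V.valuation ϖ < 1 := (hmem P).mp hP
  -- the valuation of `π`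
  have hSle : ∀ x ∈ 𝔐, V.valuation ((j x : V) : E) ≤ V.valuation ϖ := by
    intro x hx
    obtain ⟨y, hy⟩ := hdvd x hx
    have h1 := congrArg (fun z : S => V.valuation ((j z : V) : E)) hy
    simp only [map_mul, MulMemClass.coe_mul] at h1
    rw [hsv, one_mul] at h1
    rw [h1]
    exact mul_le_of_le_one_right' ((V.valuation_le_one_iff _).mpr (j y).2)
  have hpow : ∀ n, ∀ x ∈ 𝔐 ^ n, V.valuation ((j x : V) : E) ≤ V.valuation ϖ ^ n := by
    intro n
    induction n with
    | zero => intro x _; simp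
    | succ n ih =>
      intro x hx
      rw [pow_succ] at hx
      refine Submodule.mul_induction_on hx (fun a ha b hb => ?_) fun a b ha hb => ?_
      · rw [map_mul, MulMemClass.coe_mul, map_mul, pow_succ]
        exact mul_le_mul' (ih a ha) (hSle b hb)
      · rw [map_add, AddMemClass.coe_add]
        exact V.valuation.map_add_le ha hb
  have hk : ∀ k, ∀ x : S, x ∉ 𝔐 ^ k → ∃ n : ℕ, V.valuation ϖ ^ n ≤ V.valuation ((j x : V) : E) := by
    intro k
    induction k with
    | zero => intro x hx; simp at hx
    | succ k ih =>
      intro x hx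
      by_cases hx1 : x ∈ 𝔐
      · obtain ⟨y, hy⟩ := hdvd x hx1
        obtain ⟨n, hn⟩ := ih y fun hyk => by
          have h1 : s * x ∈ 𝔐 ^ (k + 1) := by
            rw [hy, pow_succ']
            exact Ideal.mul_mem_mul hP hyk
          exact (Ideal.IsPrime.mul_mem_pow 𝔐 h1).elim hs hx
        have h1 := congrArg (fun z : S => V.valuation ((j z : V) : E)) hy
        simp only [map_mul, MulMemClass.coe_mul] at h1
        rw [hsv, one_mul] at h1
        exact ⟨n + 1, by rw [h1, pow_succ']; exact mul_le_mul' le_rfl hn⟩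
      · exact ⟨0, by rw [hnotmem x hx1, pow_zero]⟩
  -- The exact relation between the values of ϖ and π is not yet available, and its proof needs a
  -- bound of this kind. Krull's intersection theorem puts π outside some power of 𝔐, which bounds
  -- v(π) below by a power of v(ϖ).
  have harch₀ : ∀ y : E, y ≠ 0 → ∃ n : ℕ, V.valuation ϖ ^ n ≤ V.valuation y := by
    intro y hy
    obtain ⟨n, hn⟩ := exists_pow_valuation_le hV hπ hy
    obtain ⟨k, hk'⟩ : ∃ k, algebraMap R S π ∉ 𝔐 ^ k := by
      by_contra! hcon
      have h1 : algebraMap R S π ∈ ⨅ i, 𝔐 ^ i := by simpa [Ideal.mem_iInf] using hcon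
      rw [Ideal.iInf_pow_eq_bot_of_isDomain 𝔐 hprime.ne_top, Ideal.mem_bot] at h1
      rw [h1, map_zero] at hjπ
      exact hπ0 hjπ.symm
    obtain ⟨m, hm⟩ := hk k _ hk'
    rw [hjπ] at hm
    exact ⟨m * n, by rw [pow_mul]; exact (pow_le_pow_left₀ zero_le hm n).trans hn⟩
  let S' : Subring E := (V.subtype.comp j).range
  have hS'V : S' ≤ V.toSubring := by
    rintro _ ⟨x, rfl⟩
    exact (j x).2
  have hS' : ∀ x ∈ S', V.valuation x < 1 →
      ∃ s ∈ S', ∃ y ∈ S', V.valuation s = 1 ∧ s * x = ϖ * y := by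
    rintro _ ⟨x, rfl⟩ hx
    obtain ⟨y, hy⟩ := hdvd x ((hmem x).mpr hx)
    exact ⟨_, ⟨s, rfl⟩, _, ⟨y, rfl⟩, hsv, by
      have := congrArg (V.subtype.comp j) hy
      rwa [map_mul, map_mul] at this⟩
  -- Writing tπ = P^n y with t and y units at 𝔐 shows that π lies in 𝔐^n but not in 𝔐^(n+1), so n is
  -- the ramification index.
  have hϖπ : V.valuation ϖ ^ e = V.valuation (algebraMap R E π) := by
    obtain ⟨n, _, ⟨t, rfl⟩, _, ⟨y, rfl⟩, ht, hy, h⟩ := exists_eq_pow_mul harch₀ hϖ1 hS'V hS'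
      (x := algebraMap R E π) ⟨algebraMap R S π, hjπ⟩ hπ0
    have hval : V.valuation (algebraMap R E π) = V.valuation ϖ ^ n := by
      have := congrArg V.valuation h
      rwa [map_mul, map_mul, map_pow, ht, hy, one_mul, mul_one] at this
    have hS : t * algebraMap R S π = P ^ n * y := by
      apply Subtype.ext
      apply ι.injective
      have h1 : V.subtype.comp j (t * algebraMap R S π) = V.subtype.comp j (P ^ n * y) := by
        rw [map_mul, map_mul, map_pow]
        refine Eq.trans ?_ h
        congr 1
      exact h1
    have hspan : IsLocalRing.maximalIdeal R = Ideal.span {π} := hπ.maximalIdeal_eq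
    have h1 : Ideal.ramificationIdx' (IsLocalRing.maximalIdeal R) 𝔐 = n := by
      apply Ideal.ramificationIdx'_spec
      · rw [hspan, Ideal.map_span, Set.image_singleton, Ideal.span_singleton_le_iff_mem]
        have h2 : t * algebraMap R S π ∈ 𝔐 ^ n := by
          rw [hS]
          exact Ideal.mul_mem_right _ _ (Ideal.pow_mem_pow hP n)
        refine (Ideal.IsPrime.mul_mem_pow 𝔐 h2).resolve_left fun h3 => ?_
        exact absurd ((hmem t).mp h3) (not_lt.mpr ht.ge)
      · rw [hspan, Ideal.map_span, Set.image_singleton, Ideal.span_singleton_le_iff_mem]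
        intro h2
        have h3 := hpow _ _ h2
        rw [hjπ, hval] at h3
        exact absurd h3 (not_le.mpr (pow_lt_pow_right_of_lt_one₀
          (by simpa [zero_lt_iff] using hϖ0) hϖ1 (Nat.lt_succ_self n)))
    have : FaithfulSMul R L := (faithfulSMul_iff_algebraMap_injective R L).mpr (by
      rw [IsScalarTower.algebraMap_eq R K L]
      exact (algebraMap K L).injective.comp (IsFractionRing.injective R K))
    have : Module.IsTorsionFree R S := inferInstance
    rw [Ideal.ramificationIdx'_eq_ramificationIdx _ _
      (IsDiscreteValuationRing.not_a_field R)] at h1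
    rw [hval, he_def, h1]
  have he0 : e ≠ 0 := by
    intro h0
    rw [h0] at he
    simp at he
  have hfrac : ∀ x ∈ ι.fieldRange, ∃ p ∈ S', ∃ q ∈ S', x = p / q := by
    rintro _ ⟨x, rfl⟩
    obtain ⟨a, b, hb, rfl⟩ := IsFractionRing.div_surjective S x
    exact ⟨_, ⟨a, rfl⟩, _, ⟨b, rfl⟩, map_div₀ ι _ _⟩
  have hSres : ∀ x (hx : x ∈ V), x ∈ S' → IsLocalRing.residue V ⟨x, hx⟩ ∈
      separableClosure (baseResidueField hV) (IsLocalRing.ResidueField V) := by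
    rintro _ hx ⟨a, rfl⟩
    change IsLocalRing.residue V (j a) ∈ _
    let χ : S ⧸ 𝔐 →+* IsLocalRing.ResidueField V :=
      Ideal.Quotient.lift 𝔐 ((IsLocalRing.residue V).comp j) fun x hx =>
        (IsLocalRing.residue_eq_zero_iff _).mpr hx
    let ψ := χ.comp (algebraMap (R ⧸ IsLocalRing.maximalIdeal R) (S ⧸ 𝔐))
    have hsep := hres.isSeparable' (Ideal.Quotient.mk 𝔐 a)
    set m := minpoly (R ⧸ IsLocalRing.maximalIdeal R) (Ideal.Quotient.mk 𝔐 a) with hm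
    have h0 : m.eval₂ ψ (IsLocalRing.residue V (j a)) = 0 := by
      have h1 : IsLocalRing.residue V (j a) = χ (Ideal.Quotient.mk 𝔐 a) := rfl
      rw [h1, ← hom_eval₂, ← aeval_def, minpoly.aeval, map_zero]
    refine mem_separableClosure_of_simple_root (g := m.map ψ) (fun i => ?_) ?_ ?_
    · rw [coeff_map]
      obtain ⟨r, hr⟩ := Ideal.Quotient.mk_surjective (m.coeff i)
      rw [← hr]
      have h1 : ψ (Ideal.Quotient.mk _ r) = IsLocalRing.residue V
          ⟨algebraMap R E r, algebraMap_mem_of_valuation hV r⟩ := by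
        change IsLocalRing.residue V (j (algebraMap R S r)) = _
        congr 1
        exact Subtype.ext (hιR r)
      rw [h1]
      exact (separableClosure (baseResidueField hV) (IsLocalRing.ResidueField V)).algebraMap_mem
        ⟨_, residue_algebraMap_mem hV r _⟩
    · rw [eval_map, h0]
    · rw [derivative_map, eval_map]
      exact hsep.eval₂_derivative_ne_zero ψ h0
  have harch : ∀ y : E, y ≠ 0 → ∃ n : ℕ, V.valuation ϖ ^ n ≤ V.valuation y :=
    arch_of_pow_eq hV hπ hϖπ
  refine ⟨e, ramificationIdx_dvd_factorial hf.1 𝔐, ?_, ϖ, ι.fieldRange,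
    ⟨⟨(P : L), rfl⟩, hϖ0, hϖ1, harch, ?_, ?_, ?_, ?_⟩, hϖπ, ?_⟩
  · have h1 : V.valuation ((algebraMap R E) (e : R)) = 1 := by
      refine le_antisymm ((V.valuation_le_one_iff _).mpr (algebraMap_mem_of_valuation hV _))
        (not_lt.mp fun h => he ?_)
      rw [valuation_algebraMap_lt_one_iff hV, ← IsLocalRing.residue_eq_zero_iff, map_natCast] at h
      exact h
    rwa [map_natCast] at h1
  · intro x hx hx0
    obtain ⟨p, hp, q, hq, rfl⟩ := hfrac x hx
    obtain ⟨n, p', hp', q', hq', h1, h2, h3⟩ :=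
      exists_zpow_of_div harch hϖ1 hϖ0 hS'V hS' hp hq hx0
    exact ⟨n, by rw [h3, map_mul, map_zpow₀, map_div₀, h1, h2, div_one, mul_one]⟩
  · intro x hxV hx
    obtain ⟨p, hp, q, hq, rfl⟩ := hfrac x hx
    exact residue_div_mem harch hϖ1 hϖ0 hS'V hS' hSres hp hq hxV
  · intro r hr
    obtain ⟨x, rfl⟩ := exists_of_mem_baseResidueField hV hr
    exact ⟨_, ⟨algebraMap R L x, hιR x⟩, rfl⟩
  · rintro _ ⟨x, rfl⟩
    exact mem_separableClosure_iff.mpr ((hsepL.isSeparable K x).map (f := ι) ι.injective)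
  · intro γ hγ
    have hsp : ((f.map (algebraMap R K)).map (algebraMap K L)).Splits :=
      SplittingField.splits _
    have h1 : γ ∈ (((f.map (algebraMap R K)).map (algebraMap K L)).map (ι : L →+* E)).roots := by
      rw [Polynomial.map_map, Polynomial.map_map, mem_roots']
      have h2 : ((ι : L →+* E).comp (algebraMap K L)).comp (algebraMap R K) = algebraMap R E := by
        ext x
        change ι (algebraMap K L (algebraMap R K x)) = _
        rw [AlgHom.commutes, ← IsScalarTower.algebraMap_apply]
      rw [h2]
      refine ⟨?_, by rwa [IsRoot.def, eval_map_algebraMap]⟩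
      refine (Polynomial.map_ne_zero_iff ?_).mpr hf0
      rw [IsScalarTower.algebraMap_eq R K E]
      exact (algebraMap K E).injective.comp (IsFractionRing.injective R K)
    rw [hsp.roots_map, Multiset.mem_map] at h1
    obtain ⟨x, _, rfl⟩ := h1
    exact ⟨x, rfl⟩

end Tame

/-! ### Coefficients of compositions -/

section Coeff

variable {E : Type*} [Field E] {V : ValuationSubring E}

theorem coeff_comp_mem {A : Subring E} {p q : E[X]} (hp : ∀ i, p.coeff i ∈ A)
    (hq : ∀ i, q.coeff i ∈ A) (i : ℕ) : (p.comp q).coeff i ∈ A := by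
  have key : ∀ p : E[X], (∀ i, p.coeff i ∈ A) → ∃ P : A[X], P.map A.subtype = p := by
    intro p hp
    have : p ∈ lifts A.subtype := by
      rw [lifts_iff_coeff_lifts]
      exact fun i => ⟨⟨_, hp i⟩, rfl⟩
    exact this
  obtain ⟨p, rfl⟩ := key p hp
  obtain ⟨q, rfl⟩ := key q hq
  rw [← map_comp, coeff_map]
  exact Subtype.property _

theorem coeff_X_add_C_mem {A : Subring E} {c : E} (hc : c ∈ A) (i : ℕ) :
    (X + C c : E[X]).coeff i ∈ A := by
  rw [coeff_add, coeff_X, coeff_C]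
  refine add_mem ?_ ?_ <;> split_ifs
  exacts [one_mem _, zero_mem _, hc, zero_mem _]

theorem valuation_coeff_comp_lt_one {p : E[X]} (hp : ∀ i, V.valuation (p.coeff i) < 1) {c : E}
    (hc : c ∈ V) (i : ℕ) : V.valuation ((p.comp (X + C c)).coeff i) < 1 := by
  rw [comp_eq_sum_left, Polynomial.sum, finsetSum_coeff]
  refine V.valuation.map_sum_lt one_ne_zero fun n _ => ?_
  rw [coeff_C_mul, map_mul]
  refine mul_lt_one_of_lt_of_le (hp n) ((V.valuation_le_one_iff _).mpr ?_)
  have h1 := coeff_comp_mem (A := V.toSubring) (p := X ^ n) (q := X + C c) (fun i => by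
    rw [coeff_X_pow]; split_ifs; exacts [one_mem _, zero_mem _]) (coeff_X_add_C_mem hc) i
  rwa [pow_comp, X_comp] at h1

/-- Translation by an integral c is invertible: if all coefficients fell into the maximal ideal,
translating back by -c would keep them there. -/
theorem exists_valuation_coeff_comp_eq_one {p : E[X]} (hp : ∀ i, p.coeff i ∈ V)
    (hprim : ∃ i, V.valuation (p.coeff i) = 1) {c : E} (hc : c ∈ V) :
    ∃ i, V.valuation ((p.comp (X + C c)).coeff i) = 1 := by
  by_contra! hcon
  have h1 : ∀ i, V.valuation ((p.comp (X + C c)).coeff i) < 1 := fun i =>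
    lt_of_le_of_ne ((V.valuation_le_one_iff _).mpr
      (coeff_comp_mem (A := V.toSubring) hp (coeff_X_add_C_mem hc) i)) (hcon i)
  obtain ⟨i, hi⟩ := hprim
  have h2 := valuation_coeff_comp_lt_one h1 (neg_mem hc) i
  rw [comp_assoc] at h2
  simp only [add_comp, X_comp, C_comp, C_neg, neg_add_cancel_right, comp_X] at h2
  exact h2.ne hi

end Coeff

/-! ### The invariants of the algorithm -/

section Invariant

variable {R K E : Type*} [CommRing R] [Field K] [Field E] [Algebra K E] [Algebra R E]
    {V : ValuationSubring E} {k₀ : Subfield (IsLocalRing.ResidueField V)}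

/-- A field that contains the roots of `f` and has a uniformizer `ϖ` with `ϖ ^ e = π`. -/
structure IsKummerSetting (V : ValuationSubring E) (k₀ : Subfield (IsLocalRing.ResidueField V))
    (π : R) (f : R[X]) (M : IntermediateField K E) (ϖ : E) (e : ℕ) : Prop where
  mem_base : ∀ x : R, algebraMap R E x ∈ V
  base_le : k₀.toSubring ≤ resField V (algebraMap R E).range
  tame : IsTameField V k₀ M ϖ
  pow : ϖ ^ e = algebraMap R E π
  index : V.valuation (e : E) = 1
  root_mem : ∀ γ : E, aeval γ f = 0 → γ ∈ M
  unit_lead : V.valuation (algebraMap R E f.leadingCoeff) = 1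
  base_mem : ∀ x : R, algebraMap R E x ∈ M
  fix_base : ∀ (σ : E ≃ₐ[K] E) (x : R), σ (algebraMap R E x) = algebraMap R E x
  base_div : ∀ x : R, V.valuation (algebraMap R E x) < 1 → ∃ y : R, x = π * y

/-- The properties of the ring, the uniformizer and the expansion. -/
structure State.IsGood (V : ValuationSubring E) (k₀ : Subfield (IsLocalRing.ResidueField V))
    (π : R) (M₀ : IntermediateField K E) (ρ : E) (e h : ℕ) (s : State E) : Prop where
  r_pos : 0 < s.r
  r_dvd : s.r ∣ e
  pow : s.ϖ ^ s.r = algebraMap R E π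
  base_le : (algebraMap R E).range ≤ s.A
  mem : s.ϖ ∈ s.A
  le : s.A ≤ V.toSubring
  div : ∀ x ∈ s.A, V.valuation x < 1 → ∃ y ∈ s.A, x = s.ϖ * y
  fix : ∀ σ : E ≃ₐ[K] E, (∀ y ∈ V, V.valuation (σ y - y) < 1) → σ s.ϖ = s.ϖ → ∀ x ∈ s.A, σ x = x
  field : ∃ M : IntermediateField K E, M₀ ≤ M ∧ IsTameField V k₀ M ρ ∧ ∀ x ∈ s.A, x ∈ M
  f_mem : ∀ i, s.f.coeff i ∈ s.A
  P_mem : ∀ i, s.P.coeff i ∈ s.A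
  P_deg : s.P.degree < ((s.r * h : ℕ) : WithBot ℕ)

/-- The roots of the current polynomial stand for the roots of the original one. -/
structure State.IsCurrent (V : ValuationSubring E) (f : R[X]) (h : ℕ) (s : State E) : Prop where
  prim : ∃ i, V.valuation (s.f.coeff i) = 1
  root : ∃ u : E, u ≠ 0 ∧
    C u * s.f = (f.map (algebraMap R E)).comp (C (s.P.eval s.ϖ) + C (s.ϖ ^ s.N) * X)
  N_lt : s.N < s.r * h

/-- The invariants of the algorithm. -/
def Config.IsGood (V : ValuationSubring E) (k₀ : Subfield (IsLocalRing.ResidueField V))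
    (π : R) (f : R[X]) (M₀ : IntermediateField K E) (ρ : E) (e h : ℕ) : Config E → Prop
  | .polygon s => s.IsGood V k₀ π M₀ ρ e h ∧ s.IsCurrent V f h ∧
      (s.pass = 0 → s.f = f.map (algebraMap R E) ∧ s.P = 0 ∧ s.N = 0) ∧
      (s.pass ≠ 0 → V.valuation (s.f.coeff 0) < 1)
  | .residual s => s.IsGood V k₀ π M₀ ρ e h ∧ s.IsCurrent V f h ∧
      (0 < f.natDegree → ∃ j, 0 < j ∧ V.valuation (s.f.coeff j) = 1)
  | .done s => s.IsGood V k₀ π M₀ ρ e h ∧ ∃ γ : E, aeval γ f = 0 ∧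
      V.valuation (γ - s.P.eval s.ϖ) ≤ V.valuation s.ϖ ^ (s.r * h)

variable {π : R} {f : R[X]} {M₀ : IntermediateField K E} {ρ : E} {e h : ℕ}

theorem IsKummerSetting.index_ne_zero (hS : IsKummerSetting V k₀ π f M₀ ρ e) : e ≠ 0 := by
  rintro rfl
  simpa using hS.index

theorem IsKummerSetting.valuation_natCast (hS : IsKummerSetting V k₀ π f M₀ ρ e) {r : ℕ}
    (hr : r ∣ e) : V.valuation (r : E) = 1 := by
  obtain ⟨t, rfl⟩ := hr
  have h1 := hS.index
  rw [Nat.cast_mul, map_mul] at h1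
  have hle : ∀ n : ℕ, V.valuation (n : E) ≤ 1 := fun n =>
    (V.valuation_le_one_iff _).mpr (natCast_mem V n)
  refine le_antisymm (hle r) (not_lt.mp fun h2 => ?_)
  exact (mul_lt_one_of_lt_of_le h2 (hle t)).ne h1

namespace State.IsGood

variable {s : State E}

theorem unif_ne_zero (hs : s.IsGood V k₀ π M₀ ρ e h) (hS : IsKummerSetting V k₀ π f M₀ ρ e) :
    s.ϖ ≠ 0 := by
  intro h0
  have h1 := hs.pow
  rw [h0, zero_pow hs.r_pos.ne', ← hS.pow] at h1
  exact pow_ne_zero _ hS.tame.ne_zero h1.symm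

theorem unif_pos (hs : s.IsGood V k₀ π M₀ ρ e h) (hS : IsKummerSetting V k₀ π f M₀ ρ e) :
    0 < V.valuation s.ϖ := by
  simpa [zero_lt_iff] using hs.unif_ne_zero hS

theorem valuation_unif (hs : s.IsGood V k₀ π M₀ ρ e h) (hS : IsKummerSetting V k₀ π f M₀ ρ e) :
    V.valuation s.ϖ = V.valuation ρ ^ (e / s.r) := by
  refine (pow_left_inj₀ zero_le zero_le hs.r_pos.ne').mp ?_
  rw [← map_pow, hs.pow, ← pow_mul, Nat.div_mul_cancel hs.r_dvd, ← map_pow, hS.pow]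

theorem unif_lt_one (hs : s.IsGood V k₀ π M₀ ρ e h) (hS : IsKummerSetting V k₀ π f M₀ ρ e) :
    V.valuation s.ϖ < 1 := by
  rw [hs.valuation_unif hS]
  exact pow_lt_one₀ zero_le hS.tame.lt_one
    (Nat.div_pos (Nat.le_of_dvd (Nat.pos_of_ne_zero hS.index_ne_zero) hs.r_dvd) hs.r_pos).ne'

theorem isField (hs : s.IsGood V k₀ π M₀ ρ e h) (hS : IsKummerSetting V k₀ π f M₀ ρ e) :
    IsField (resField V s.A) := by
  obtain ⟨M, _, hM, hAM⟩ := hs.field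
  refine isField_resField (k₀ := k₀) (fun r hr => ?_) fun x hx hxA => ?_
  · obtain ⟨x, rfl⟩ := hS.base_le hr
    exact ⟨⟨x.1, hs.base_le x.2⟩, rfl⟩
  · exact (mem_separableClosure_iff.mp (hM.res x hx (hAM x hxA))).isIntegral.isAlgebraic

theorem exists_eq_pow_mul (hs : s.IsGood V k₀ π M₀ ρ e h) (hS : IsKummerSetting V k₀ π f M₀ ρ e)
    {x : E} (hx : x ∈ s.A) (hx0 : x ≠ 0) :
    ∃ n : ℕ, V.valuation x = V.valuation s.ϖ ^ n := by
  have harch : ∀ y : E, y ≠ 0 → ∃ n : ℕ, V.valuation s.ϖ ^ n ≤ V.valuation y := by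
    intro y hy
    obtain ⟨n, hn⟩ := hS.tame.arch y hy
    refine ⟨n, le_trans ?_ hn⟩
    rw [hs.valuation_unif hS]
    refine pow_le_pow_left₀ zero_le (pow_le_of_le_one zero_le hS.tame.lt_one.le ?_) n
    exact (Nat.div_pos (Nat.le_of_dvd (Nat.pos_of_ne_zero hS.index_ne_zero) hs.r_dvd) hs.r_pos).ne'
  obtain ⟨n, t, _, y, _, ht, hy, h1⟩ := DiscreteNP.exists_eq_pow_mul harch (hs.unif_lt_one hS) hs.le
    (fun x hx hx1 => by
      obtain ⟨y, hy, h⟩ := hs.div x hx hx1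
      exact ⟨1, one_mem _, y, hy, map_one _, by rw [one_mul, h]⟩) hx hx0
  refine ⟨n, ?_⟩
  have := congrArg V.valuation h1
  rwa [map_mul, map_mul, map_pow, ht, hy, one_mul, mul_one] at this

/-- Division by powers of the uniformizer. -/
theorem div_pow (hs : s.IsGood V k₀ π M₀ ρ e h) (hS : IsKummerSetting V k₀ π f M₀ ρ e)
    {n : ℕ} {x : E} (hx : x ∈ s.A) (hxn : V.valuation x ≤ V.valuation s.ϖ ^ n) :
    ∃ y ∈ s.A, x = s.ϖ ^ n * y := by
  induction n generalizing x with
  | zero => exact ⟨x, hx, by simp⟩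
  | succ n ih =>
    have h1 : V.valuation x < 1 :=
      hxn.trans_lt (pow_lt_one₀ zero_le (hs.unif_lt_one hS) n.succ_ne_zero)
    obtain ⟨y, hy, rfl⟩ := hs.div x hx h1
    rw [map_mul, pow_succ', mul_le_mul_iff_right₀ (hs.unif_pos hS)] at hxn
    obtain ⟨z, hz, rfl⟩ := ih hy hxn
    exact ⟨z, hz, by ring⟩

theorem root_iff (hs : s.IsCurrent V f h) (y : E) :
    s.f.eval y = 0 ↔ aeval (s.P.eval s.ϖ + s.ϖ ^ s.N * y) f = 0 := by
  obtain ⟨u, hu, h1⟩ := hs.root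
  have h2 := congrArg (eval y) h1
  rw [eval_mul, eval_C, eval_comp, eval_map_algebraMap] at h2
  simp only [eval_add, eval_C, eval_mul, eval_X] at h2
  rw [← h2, mul_eq_zero, or_iff_right hu]

/-- The substitution P(ϖ) + ϖ^N y has its coefficients in M, so y is recovered inside M from a root
of f. Through this lemma, information about the splitting field reaches every later polynomial. -/
theorem root_mem (hs : s.IsGood V k₀ π M₀ ρ e h) (hS : IsKummerSetting V k₀ π f M₀ ρ e)
    (hc : s.IsCurrent V f h) {M : IntermediateField K E} (hM₀ : M₀ ≤ M) (hM : ∀ x ∈ s.A, x ∈ M)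
    {y : E} (hy : s.f.eval y = 0) : y ∈ M := by
  have h1 := hM₀ (hS.root_mem _ ((root_iff hc y).mp hy))
  have hϖ : s.ϖ ∈ M := hM _ hs.mem
  have hP : s.P.eval s.ϖ ∈ M := by
    rw [eval_eq_sum]
    exact sum_mem fun i _ => mul_mem (hM _ (hs.P_mem i)) (pow_mem hϖ i)
  have h2 : y = (s.P.eval s.ϖ + s.ϖ ^ s.N * y - s.P.eval s.ϖ) / s.ϖ ^ s.N := by
    have := pow_ne_zero s.N (hs.unif_ne_zero hS)
    field_simp
    ring
  rw [h2]
  exact div_mem (sub_mem h1 hP) (pow_mem hϖ _)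

/-- Roots of valuation `a / b` force ramification of index `b`. -/
theorem mul_dvd (hs : s.IsGood V k₀ π M₀ ρ e h) (hS : IsKummerSetting V k₀ π f M₀ ρ e)
    (hc : s.IsCurrent V f h) {a b : ℕ} (hb : 0 < b) (hab : a.Coprime b) {y : E}
    (hy : s.f.eval y = 0) (hval : V.valuation y ^ b = V.valuation s.ϖ ^ a) : b * s.r ∣ e := by
  obtain ⟨M, hM₀, hM, hAM⟩ := hs.field
  have hyM := root_mem hs hS hc hM₀ hAM hy
  have hy0 : y ≠ 0 := by
    rintro rfl
    rw [map_zero, zero_pow hb.ne'] at hval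
    exact pow_ne_zero a (hs.unif_pos hS).ne' hval.symm
  obtain ⟨n, hn⟩ := hM.val y hyM hy0
  rw [hn, hs.valuation_unif hS, ← zpow_natCast, ← zpow_mul, ← pow_mul, ← zpow_natCast] at hval
  -- In units of v(ρ), y has value n and ϖ has value e/r. Hence nb = (e/r)a, and coprimality forces
  -- b to divide e/r.
  have h1 := zpow_valuation_injective hM.lt_one hM.ne_zero hval
  have h2 : (b : ℤ) ∣ ((e / s.r * a : ℕ) : ℤ) := ⟨n, by rw [← h1]; ring⟩
  have h3 : b ∣ e / s.r := hab.symm.dvd_of_dvd_mul_right (Int.natCast_dvd_natCast.mp h2)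
  obtain ⟨t, ht⟩ := h3
  exact ⟨t, by rw [← Nat.div_mul_cancel hs.r_dvd, ht]; ring⟩

/-- The Kummer step. -/
theorem extend (hs : s.IsGood V k₀ π M₀ ρ e h) (hS : IsKummerSetting V k₀ π f M₀ ρ e)
    (ch : Choices V) {a b : ℕ} (hb : 0 < b) (hbr : b * s.r ∣ e) {p : E[X]}
    (hp : ∀ i, p.coeff i ∈ adjoinElem s.A (ch.root s b)) :
    State.IsGood V k₀ π M₀ ρ e h { DiscreteNP.extend ch s a b with f := p } := by
  set τ := ch.root s b with hτ
  have hτb : τ ^ b = s.ϖ := ch.root_pow s b hb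
  have hτ1 : V.valuation τ < 1 := by
    by_contra h1
    have h2 := hs.unif_lt_one hS
    rw [← hτb, map_pow] at h2
    exact absurd h2 (not_lt.mpr (one_le_pow₀ (not_lt.mp h1)))
  have hτV : τ ∈ V := (V.valuation_le_one_iff _).mp hτ1.le
  have hτA := self_mem_adjoinElem s.A τ
  have hτr : τ ^ (b * s.r) = algebraMap R E π := by rw [pow_mul, hτb, hs.pow]
  refine ⟨Nat.mul_pos hb hs.r_pos, hbr, hτr, hs.base_le.trans (le_adjoinElem _ _), hτA,
    adjoinElem_le hs.le hτV, adjoinElem_div_of_pow_eq hs.le hs.div hτ1 hb hτb, ?_, ?_, hp, ?_, ?_⟩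
  · intro σ hσ hσϖ x hx
    have hA : s.A ≤ RingHom.eqLocus (σ : E →+* E) (RingHom.id E) := fun y hy => by
      refine hs.fix σ hσ ?_ y hy
      rw [← hτb, map_pow]
      exact congrArg (· ^ b) hσϖ
    exact adjoinElem_le hA (show τ ∈ RingHom.eqLocus (σ : E →+* E) (RingHom.id E) from hσϖ) hx
  · obtain ⟨M, hM₀, hM, hAM⟩ := hs.field
    obtain ⟨t, ht⟩ := hbr
    have hρ0 := pow_ne_zero t hM.ne_zero
    -- With e = b·r·t, both τ and ρ^t have br-th power π, so their quotient is a root of unity. It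
    -- is a simple root of X^(br) - 1 modulo the maximal ideal because br divides the unit e.
    -- Adjoining τ is thus étale over M, whose uniformizer remains ρ.
    have hζ : (τ / ρ ^ t) ^ (b * s.r) = 1 := by
      rw [_root_.div_pow, hτr, ← pow_mul, mul_comm t, ← ht, hS.pow]
      refine div_self ?_
      rw [← hS.pow]
      exact pow_ne_zero _ hM.ne_zero
    have hn : b * s.r ≠ 0 := (Nat.mul_pos hb hs.r_pos).ne'
    have hζ1 : V.valuation (τ / ρ ^ t) = 1 := by
      have := congrArg V.valuation hζ
      rw [map_pow, map_one] at this
      exact (pow_eq_one_iff_of_nonneg zero_le hn).mp this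
    obtain ⟨M', hMM', hζM', hM'⟩ := hM.adjoin_simple_root (c := τ / ρ ^ t)
      ((V.valuation_le_one_iff _).mp hζ1.le) (g := X ^ (b * s.r) - 1) (fun i => by
        rw [coeff_sub, coeff_X_pow, coeff_one]
        refine sub_mem ?_ ?_ <;> split_ifs <;> simp) (fun i => by
        rw [coeff_sub, coeff_X_pow, coeff_one]
        refine sub_mem ?_ ?_ <;> split_ifs <;> simp [one_mem, zero_mem]) (by simp [hζ]) (by
        rw [derivative_sub, derivative_X_pow, derivative_one, sub_zero, eval_mul, eval_C, eval_pow,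
          eval_X, map_mul, map_pow, hζ1, one_pow, mul_one]
        exact hS.valuation_natCast ⟨t, ht⟩)
    refine ⟨M', hM₀.trans hMM', hM', fun x hx => ?_⟩
    have hτM' : τ ∈ M'.toSubfield.toSubring := by
      have : τ = τ / ρ ^ t * ρ ^ t := by field_simp
      rw [this]
      exact mul_mem hζM' (pow_mem hM'.mem t)
    exact adjoinElem_le (fun y hy => hMM' (hAM y hy)) hτM' hx
  · intro i
    change (Polynomial.expand E b s.P).coeff i ∈ _
    rw [coeff_expand hb]
    split_ifs
    exacts [le_adjoinElem _ _ (hs.P_mem _), zero_mem _]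
  · change (Polynomial.expand E b s.P).degree < ((b * s.r * h : ℕ) : WithBot ℕ)
    by_cases hP : s.P = 0
    · rw [hP, map_zero, degree_zero]
      exact WithBot.bot_lt_coe _
    · have h1 := hs.P_deg
      have hP' : Polynomial.expand E b s.P ≠ 0 := (expand_ne_zero hb).mpr hP
      rw [degree_eq_natDegree hP, Nat.cast_lt] at h1
      rw [degree_eq_natDegree hP', Nat.cast_lt, natDegree_expand, mul_assoc, mul_comm]
      exact Nat.mul_lt_mul_of_pos_left h1 hb

end State.IsGood

end Invariant

/-! ### Irreducible factors of the reduction -/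

section Factor

theorem exists_root_of_irreducible {F k : Type*} [CommRing F] (hF : IsField F) [Field k]
    [IsAlgClosed k] (φ : F →+* k) {g : F[X]} (hirr : Irreducible g) : ∃ z, g.eval₂ φ z = 0 := by
  let := hF.toField
  exact IsAlgClosed.exists_eval₂_eq_zero φ g (degree_pos_of_irreducible hirr).ne'

theorem exists_irreducible_of_root {F k : Type*} [CommRing F] (hF : IsField F) [Field k]
    (φ : F →+* k) {p : F[X]} (hp0 : p ≠ 0) {z : k} (hp : p.eval₂ φ z = 0) :
    ∃ g : F[X], Irreducible g ∧ g ∣ p ∧ g.eval₂ φ z = 0 := by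
  let := hF.toField
  let := φ.toAlgebra
  have hint : IsIntegral F z := isAlgebraic_iff_isIntegral.mp ⟨p, hp0, hp⟩
  exact ⟨minpoly F z, minpoly.irreducible hint, minpoly.dvd F z hp, minpoly.aeval F z⟩

/-- Over F, g divides the separable minimal polynomial of z over `k₀`. -/
theorem separable_of_irreducible_of_root {k : Type*} [Field k] {k₀ : Subfield k} {F : Subring k}
    (hF : IsField F) (hk : k₀.toSubring ≤ F) {g : F[X]} (hirr : Irreducible g) {z : k}
    (hg : g.eval₂ F.subtype z = 0) (hz : z ∈ separableClosure k₀ k) : g.Separable := by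
  have hsep : (minpoly k₀ z).Separable := mem_separableClosure_iff.mp hz
  let ψ : k₀ →+* F := Subring.inclusion hk
  refine (hsep.map (f := ψ)).of_dvd (dvd_of_irreducible_of_root hF F.subtype hirr hg ?_)
  rw [eval₂_map]
  exact minpoly.aeval k₀ z

variable {E : Type*} [Field E] {V : ValuationSubring E}

/-- The lift has the same degree as its reduction, so its leading coefficient is a unit of `V`; the
lift itself need not be monic. -/
theorem mem_of_root_of_lift {A : Subring E} {G : (inside V A)[X]} {g : (resField V A)[X]}
    (hmap : G.map (red V A) = g) (hdeg : G.natDegree = g.natDegree) (hg : g ≠ 0) {c : E}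
    (hc : G.eval₂ (incl V A) c = 0) : c ∈ V := by
  have h1 : red V A G.leadingCoeff ≠ 0 := by
    rw [leadingCoeff, hdeg, ← coeff_map, hmap]
    exact leadingCoeff_ne_zero.mpr hg
  have h2 : V.valuation ((G.leadingCoeff : V) : E) = 1 := by
    rw [← residue_ne_zero_iff_valuation, ← coe_red]
    exact fun h => h1 (Subtype.ext h)
  let := (incl V A).toAlgebra
  have h3 : IsIntegral (inside V A) (G.leadingCoeff • c) := isIntegral_leadingCoeff_smul G c hc
  obtain ⟨p, hp, hpc⟩ := h3
  have h4 : IsIntegral V (((G.leadingCoeff : V) : E) * c) :=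
    ⟨p.map (inside V A).subtype, hp.map _, by rw [eval₂_map]; exact hpc⟩
  obtain ⟨y, hy⟩ := IsIntegrallyClosed.isIntegral_iff.mp h4
  have h5 := y.2
  rw [← V.valuation_le_one_iff, show (y : E) = _ from hy, map_mul, h2, one_mul] at h5
  exact (V.valuation_le_one_iff _).mp h5

end Factor

/-! ### Steps preserve the invariants -/

section Preserve

variable {R K E : Type*} [CommRing R] [Field K] [Field E] [Algebra K E] [Algebra R E]
    {V : ValuationSubring E} {k₀ : Subfield (IsLocalRing.ResidueField V)}
    {π : R} {f : R[X]} {M₀ : IntermediateField K E} {ρ : E} {e h : ℕ}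

namespace State.IsGood

variable {s : State E}

/-- A root of the factor lifts to a root of the current polynomial, which lies in M and so has
residue separable over `k₀`. Here separability of the residue extension in the definition of
tameness takes effect. -/
theorem separable [IsAlgClosed E] (hs : s.IsGood V k₀ π M₀ ρ e h)
    (hS : IsKummerSetting V k₀ π f M₀ ρ e) (hc : s.IsCurrent V f h) {g : (resField V s.A)[X]}
    (hg : IsIrredFactor V s g) : g.Separable := by
  obtain ⟨hirr, p, hp, hdvd⟩ := hg
  have hF := hs.isField hS
  have := isAlgClosed_residueField (V := V)
  obtain ⟨z, hz⟩ := exists_root_of_irreducible hF (resField V s.A).subtype hirr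
  obtain ⟨w, rfl⟩ := IsLocalRing.residue_surjective z
  have h1 : V.valuation (s.f.eval (w : E)) < 1 := by
    rw [← hp, eval_map, ← eval₂_red_eq_zero_iff w.2]
    exact eval₂_eq_zero_of_dvd_of_eval₂_eq_zero _ _ hdvd hz
  obtain ⟨y, hy, hwy⟩ := exists_root_of_valuation_eval_lt_one
    (fun i => (V.valuation_le_one_iff _).mpr (hs.le (hs.f_mem i))) hc.prim
    ((V.valuation_le_one_iff _).mpr w.2) h1
  obtain ⟨M, hM₀, hM, hAM⟩ := hs.field
  have hyV : y ∈ V := by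
    have : y = w - (w - y) := by ring
    rw [this]
    exact sub_mem w.2 ((V.valuation_le_one_iff _).mp hwy.le)
  have h2 : IsLocalRing.residue V w = IsLocalRing.residue V ⟨y, hyV⟩ := by
    rw [← sub_eq_zero, ← map_sub, residue_eq_zero_iff_valuation]
    exact hwy
  refine separable_of_irreducible_of_root hF
    (hS.base_le.trans ?_) hirr hz (h2 ▸ hM.res y hyV (root_mem hs hS hc hM₀ hAM hy))
  rintro _ ⟨x, rfl⟩
  exact ⟨⟨x.1, hs.base_le x.2⟩, rfl⟩

/-- The étale step. -/
theorem translate [IsAlgClosed E] (hs : s.IsGood V k₀ π M₀ ρ e h)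
    (hS : IsKummerSetting V k₀ π f M₀ ρ e) (hc : s.IsCurrent V f h) (ch : Choices V)
    {g : (resField V s.A)[X]} (hg : IsIrredFactor V s g) {c : E}
    (hroot : (ch.lift s g).eval₂ (incl V s.A) c = 0) :
    (DiscreteNP.translate s c).IsGood V k₀ π M₀ ρ e h ∧
      (DiscreteNP.translate s c).IsCurrent V f h ∧
      V.valuation ((DiscreteNP.translate s c).f.coeff 0) < 1 := by
  have hsep := hs.separable hS hc hg
  obtain ⟨hirr, p, hp, hdvd⟩ := hg
  have hF := hs.isField hS
  set G := ch.lift s g with hG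
  have hGmap : G.map (red V s.A) = g := ch.lift_map s g
  have hcV : c ∈ V := mem_of_root_of_lift hGmap (ch.lift_natDegree s g) hirr.ne_zero hroot
  have hres : g.eval₂ (resField V s.A).subtype (IsLocalRing.residue V ⟨c, hcV⟩) = 0 := by
    rw [← hGmap, eval₂_red_eq_zero_iff, hroot]; simp
  have hder : V.valuation ((derivative G).eval₂ (incl V s.A) c) = 1 := by
    have h1 := hsep.eval₂_derivative_ne_zero (resField V s.A).subtype hres
    rw [← hGmap, derivative_map, Ne, eval₂_red_eq_zero_iff, not_lt] at h1
    refine le_antisymm ?_ h1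
    rw [eval₂_incl_mem hcV, V.valuation_le_one_iff]
    exact Subtype.mem _
  have hle := le_adjoinElem s.A c
  have hcA := self_mem_adjoinElem s.A c
  have hGcoeff : ∀ i, (G.map (incl V s.A)).coeff i ∈ s.A := fun i => by
    rw [coeff_map]
    exact (G.coeff i).2
  have hGroot : (G.map (incl V s.A)).eval c = 0 := by rw [eval_map, hroot]
  have hGder : V.valuation ((derivative (G.map (incl V s.A))).eval c) = 1 := by
    rw [derivative_map, eval_map, hder]
  refine ⟨⟨hs.r_pos, hs.r_dvd, hs.pow, hs.base_le.trans hle, hle hs.mem, adjoinElem_le hs.le hcV,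
    adjoinElem_div_of_irreducible hs.le hs.mem hs.div hF hcV hroot (by rwa [hGmap]), ?_, ?_, ?_,
    ?_, ?_⟩, ⟨?_, ?_, hc.N_lt⟩, ?_⟩
  · intro σ hσ hσϖ x hx
    have hA : s.A ≤ RingHom.eqLocus (σ : E →+* E) (RingHom.id E) := fun y hy =>
      hs.fix σ hσ hσϖ y hy
    have hσc : (σ : E →+* E) c = c := apply_eq_of_simple_root (σ := (σ : E →+* E)) hσ
      (fun i => hs.le (hGcoeff i)) (fun i => hA (hGcoeff i)) hcV hGroot hGder
    exact adjoinElem_le hA hσc hx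
  · obtain ⟨M, hM₀, hM, hAM⟩ := hs.field
    obtain ⟨M', hMM', hcM', hM'⟩ := hM.adjoin_simple_root hcV (fun i => hAM _ (hGcoeff i))
      (fun i => hs.le (hGcoeff i)) hGroot hGder
    exact ⟨M', hM₀.trans hMM', hM', fun x hx => adjoinElem_le (B := M'.toSubfield.toSubring)
      (fun y hy => hMM' (hAM y hy)) hcM' hx⟩
  · exact coeff_comp_mem (fun i => hle (hs.f_mem i)) (coeff_X_add_C_mem hcA)
  · intro i
    change (s.P + C c * X ^ s.N).coeff i ∈ _
    rw [coeff_add, coeff_C_mul, coeff_X_pow]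
    refine add_mem (hle (hs.P_mem i)) (mul_mem hcA ?_)
    split_ifs
    exacts [one_mem _, zero_mem _]
  · refine (degree_add_le _ _).trans_lt (max_lt hs.P_deg ?_)
    exact (degree_C_mul_X_pow_le _ _).trans_lt (Nat.cast_lt.mpr hc.N_lt)
  · exact exists_valuation_coeff_comp_eq_one (fun i => hs.le (hs.f_mem i)) hc.prim hcV
  · obtain ⟨u, hu, h1⟩ := hc.root
    refine ⟨u, hu, ?_⟩
    change C u * s.f.comp (X + C c) =
      (f.map (algebraMap R E)).comp (C ((s.P + C c * X ^ s.N).eval s.ϖ) + C (s.ϖ ^ s.N) * X)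
    have h2 := congrArg (fun q : E[X] => q.comp (X + C c)) h1
    simp only [mul_comp, C_comp, comp_assoc, add_comp, X_comp] at h2
    rw [h2]
    congr 1
    simp only [eval_add, eval_mul, eval_C, eval_pow, eval_X, C_add, C_mul]
    ring
  · change V.valuation ((s.f.comp (X + C c)).coeff 0) < 1
    rw [coeff_zero_eq_eval_zero, eval_comp, eval_add, eval_X, eval_C, zero_add, ← hp, eval_map,
      ← eval₂_red_eq_zero_iff hcV]
    exact eval₂_eq_zero_of_dvd_of_eval₂_eq_zero _ _ hdvd hres

theorem exists_root_of_hasSlope [IsAlgClosed E] (hs : s.IsGood V k₀ π M₀ ρ e h)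
    (hS : IsKummerSetting V k₀ π f M₀ ρ e) (ch : Choices V) {a b : ℕ} (hb : 0 < b)
    (hab : HasSlope V s.ϖ s.f a b) :
    ∃ y, s.f.eval y = 0 ∧ V.valuation y = V.valuation (ch.root s b) ^ a := by
  have h1 := ch.root_pow s b hb
  have h2 : ch.root s b ≠ 0 := by
    intro h0
    rw [h0, zero_pow hb.ne'] at h1
    exact hs.unif_ne_zero hS h1.symm
  obtain ⟨y, hy, hv⟩ := hab.exists_root hb (x := ch.root s b ^ a)
    (by rw [← pow_mul, mul_comm, pow_mul, h1]) (pow_ne_zero _ h2)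
  exact ⟨y, hy, by rw [hv, map_pow]⟩

theorem mul_dvd_of_hasSlope [IsAlgClosed E] (hs : s.IsGood V k₀ π M₀ ρ e h)
    (hS : IsKummerSetting V k₀ π f M₀ ρ e) (hc : s.IsCurrent V f h) (ch : Choices V) {a b : ℕ}
    (hb : 0 < b) (hcop : a.Coprime b) (hab : HasSlope V s.ϖ s.f a b) : b * s.r ∣ e := by
  obtain ⟨y, hy, hv⟩ := hs.exists_root_of_hasSlope hS ch hb hab
  refine mul_dvd hs hS hc hb hcop hy ?_
  rw [hv, ← pow_mul, mul_comm, pow_mul, ← map_pow, ch.root_pow s b hb]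

/-- The polynomial has a root of positive valuation, so its Newton polygon has a segment of positive
slope. -/
theorem exists_hasSlope [IsAlgClosed E] (hs : s.IsGood V k₀ π M₀ ρ e h)
    (hS : IsKummerSetting V k₀ π f M₀ ρ e) (hc : s.IsCurrent V f h) {y : E}
    (hy : s.f.eval y = 0) (hy0 : y ≠ 0) (hy1 : V.valuation y < 1) :
    ∃ a b : ℕ, 0 < a ∧ 0 < b ∧ a.Coprime b ∧ V.valuation y ^ b = V.valuation s.ϖ ^ a ∧
      HasSlope V s.ϖ s.f a b := by
  obtain ⟨M, hM₀, hM, hAM⟩ := hs.field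
  obtain ⟨n, hn⟩ := hM.val y (root_mem hs hS hc hM₀ hAM hy) hy0
  have hn0 : 0 < n := by
    by_contra h1
    rw [hn] at hy1
    exact absurd hy1 (not_lt.mpr
      (one_le_zpow_of_nonpos₀ hM.valuation_pos hM.lt_one.le (not_lt.mp h1)))
  obtain ⟨a, rfl⟩ := Int.eq_ofNat_of_zero_le hn0.le
  have ha : 0 < a := by exact_mod_cast hn0
  set b := e / s.r with hb_def
  have hb : 0 < b :=
    Nat.div_pos (Nat.le_of_dvd (Nat.pos_of_ne_zero hS.index_ne_zero) hs.r_dvd) hs.r_pos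
  -- Relative to v(ϖ), the root y has value n/(e/r). The slope is this fraction in lowest terms.
  obtain ⟨d, a', b', hd, hcop, rfl, hb'⟩ := Nat.exists_coprime' (Nat.gcd_pos_of_pos_left b ha)
  have hval : V.valuation y ^ b' = V.valuation s.ϖ ^ a' := by
    refine (pow_left_inj₀ zero_le zero_le hd.ne').mp ?_
    rw [← pow_mul, ← pow_mul, ← hb', hs.valuation_unif hS, ← hb_def, hn, zpow_natCast, ← pow_mul,
      ← pow_mul, mul_comm]
  have hf0 : s.f ≠ 0 := by
    intro h0
    obtain ⟨i, hi⟩ := hc.prim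
    simp [h0] at hi
  exact ⟨a', b', Nat.pos_of_mul_pos_right ha, Nat.pos_of_mul_pos_right (hb' ▸ hb), hcop, hval,
    hasSlope_of_root hf0 hy hy0 hval⟩

end State.IsGood

theorem Config.IsGood.isGood {x : Config E} (hx : x.IsGood V k₀ π f M₀ ρ e h) :
    x.state.IsGood V k₀ π M₀ ρ e h := by
  cases x <;> exact hx.1

theorem valuation_coeff_natDegree (hS : IsKummerSetting V k₀ π f M₀ ρ e) :
    V.valuation ((f.map (algebraMap R E)).coeff f.natDegree) = 1 := by
  rw [coeff_map]
  exact hS.unit_lead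

theorem Config.IsGood.step [IsAlgClosed E] (hS : IsKummerSetting V k₀ π f M₀ ρ e)
    {ch : Choices V} {x y : Config E} (hx : x.IsGood V k₀ π f M₀ ρ e h)
    (hxy : Step ch h x y) : y.IsGood V k₀ π f M₀ ρ e h := by
  cases hxy with
  | infinite s h0 =>
    obtain ⟨hs, hc, -, -⟩ := hx
    refine ⟨hs, s.P.eval s.ϖ, ?_, by simp⟩
    have := (State.IsGood.root_iff hc 0).mp (by rw [← coeff_zero_eq_eval_zero, h0])
    rwa [mul_zero, add_zero] at this
  | flat s h0 hflat =>
    obtain ⟨hs, hc, hp0, hp⟩ := hx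
    refine ⟨hs, hc, fun hd => ⟨f.natDegree, hd, ?_⟩⟩
    by_cases hpass : s.pass = 0
    · rw [(hp0 hpass).1, valuation_coeff_natDegree hS]
    -- After the first pass the constant coefficient lies in the maximal ideal, so there is a root
    -- of positive value. It is nonzero and produces a positive slope, so this case arises only in
    -- the first pass.
    · exfalso
      obtain ⟨y, hy, hy1⟩ := exists_root_of_valuation_eval_lt_one (z := 0)
        (fun i => (V.valuation_le_one_iff _).mpr (hs.le (hs.f_mem i))) hc.prim (by simp)
        (by rw [← coeff_zero_eq_eval_zero]; exact hp hpass)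
      rw [zero_sub, Valuation.map_neg] at hy1
      obtain ⟨a, b, ha, hb, -, -, hab⟩ := hs.exists_hasSlope hS hc hy (by
        rintro rfl
        rw [← coeff_zero_eq_eval_zero] at hy
        exact h0 hy) hy1
      exact hflat a b ha hb hab
  | zero s h0 hab =>
    obtain ⟨hs, hc, hp0, hp⟩ := hx
    exact ⟨hs, hc, fun hd => ⟨f.natDegree, hd, by
      rw [(hp0 h0).1, valuation_coeff_natDegree hS]⟩⟩
  | halt s a b ha hb hcop hab hN =>
    obtain ⟨hs, hc, -, -⟩ := hx
    refine ⟨hs.extend hS ch hb (hs.mul_dvd_of_hasSlope hS hc ch hb hcop hab)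
      (fun i => le_adjoinElem _ _ (hs.f_mem i)), ?_⟩
    obtain ⟨y, hy, hv⟩ := hs.exists_root_of_hasSlope hS ch hb hab
    refine ⟨_, (State.IsGood.root_iff hc y).mp hy, ?_⟩
    change V.valuation (_ - (Polynomial.expand E b s.P).eval (ch.root s b)) ≤
      V.valuation (ch.root s b) ^ (b * s.r * h)
    have h1 := ch.root_pow s b hb
    have hr1 : V.valuation (ch.root s b) ≤ 1 := by
      by_contra h2
      have h3 := hs.unif_lt_one hS
      rw [← h1, map_pow] at h3
      exact absurd h3 (not_lt.mpr (one_le_pow₀ (not_le.mp h2).le))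
    rw [expand_eval, h1, add_sub_cancel_left, map_mul, hv, map_pow, ← h1, map_pow, ← pow_mul,
      ← pow_add]
    exact pow_le_pow_of_le_one zero_le hr1 hN
  | scale s a b ha hb hcop hab hN m fe hfe hprim =>
    obtain ⟨hs, hc, -, -⟩ := hx
    have h1 := ch.root_pow s b hb
    have hτ0 : ch.root s b ≠ 0 := by
      intro h0
      rw [h0, zero_pow hb.ne'] at h1
      exact hs.unif_ne_zero hS h1.symm
    refine ⟨hs.extend hS ch hb (hs.mul_dvd_of_hasSlope hS hc ch hb hcop hab) hprim.1,
      ⟨hprim.2, ?_, hN⟩, fun _ => ?_⟩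
    · obtain ⟨u, hu, h2⟩ := hc.root
      refine ⟨u * ch.root s b ^ m, mul_ne_zero hu (pow_ne_zero _ hτ0), ?_⟩
      change C (u * ch.root s b ^ m) * fe = (f.map (algebraMap R E)).comp
        (C ((Polynomial.expand E b s.P).eval (ch.root s b)) + C (ch.root s b ^ (b * s.N + a)) * X)
      have h3 : C (ch.root s b ^ m) * fe = s.f.comp (C (ch.root s b ^ a) * X) := hfe
      rw [C_mul, mul_assoc, h3]
      have h4 := congrArg (fun q : E[X] => q.comp (C (ch.root s b ^ a) * X)) h2
      simp only [mul_comp, C_comp, comp_assoc, add_comp, X_comp] at h4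
      rw [h4, expand_eval, h1, pow_add, pow_mul, h1, C_mul, mul_assoc]
    -- The right end j of the segment has positive index and largest value. Primitivity makes that
    -- coefficient of fe a unit, so the reduction is nonconstant.
    · obtain ⟨i, j, hij, hi, hj, heq, hall⟩ := hab.scaled hb (x := ch.root s b ^ a)
        (by rw [← pow_mul, mul_comm, pow_mul, h1])
      have hcoeff : ∀ l, V.valuation (ch.root s b ^ m) * V.valuation (fe.coeff l) =
          V.valuation (s.f.coeff l * (ch.root s b ^ a) ^ l) := fun l => by
        rw [← map_mul, ← comp_C_mul_X_coeff, ← coeff_C_mul]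
        exact congrArg (fun q : E[X] => V.valuation (q.coeff l)) hfe
      have hm0 : 0 < V.valuation (ch.root s b ^ m) := by
        simpa [zero_lt_iff] using pow_ne_zero m hτ0
      refine ⟨j, (Nat.zero_le i).trans_lt hij, ?_⟩
      obtain ⟨l, hl⟩ := hprim.2
      refine le_antisymm ?_ ?_
      · exact (V.valuation_le_one_iff _).mpr (adjoinElem_le hs.le (by
          by_contra h2
          have h3 := hs.unif_lt_one hS
          change ¬ (ch.root s b ∈ V) at h2
          rw [← V.valuation_le_one_iff, not_le] at h2
          rw [← h1, map_pow] at h3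
          exact absurd h3 (not_lt.mpr (one_le_pow₀ h2.le))) (hprim.1 j))
      · rw [← hl, ← mul_le_mul_iff_right₀ hm0, hcoeff, hcoeff, ← heq]
        exact hall l
  | factor s g hg c hroot =>
    obtain ⟨hs, hc, -⟩ := hx
    obtain ⟨h1, h2, h3⟩ := hs.translate hS hc ch hg hroot
    exact ⟨h1, h2, fun h0 => absurd h0 (Nat.succ_ne_zero _), fun _ => h3⟩

end Preserve

section Run

variable {R K E : Type*} [CommRing R] [Field K] [Field E] [Algebra K E] [Algebra R E]
    {V : ValuationSubring E} {k₀ : Subfield (IsLocalRing.ResidueField V)}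
    {π : R} {f : R[X]} {M₀ : IntermediateField K E} {ρ : E} {e h : ℕ}

/-! ### Every unfinished branch can be continued -/

/-- The largest coefficient after scaling lies in A[ϖ'], so its value is that of a power ϖ'^m. All
the other coefficients are divisible by this power within A[ϖ']. -/
theorem State.IsGood.exists_step_of_hasSlope [IsAlgClosed E] {s : State E}
    (hs : s.IsGood V k₀ π M₀ ρ e h) (hS : IsKummerSetting V k₀ π f M₀ ρ e)
    (hc : s.IsCurrent V f h) (ch : Choices V) {a b : ℕ} (ha : 0 < a) (hb : 0 < b)
    (hcop : a.Coprime b) (hab : HasSlope V s.ϖ s.f a b) :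
    ((DiscreteNP.extend ch s a b).r * h ≤ (DiscreteNP.extend ch s a b).N ∧
      Step ch h (.polygon s) (.done (DiscreteNP.extend ch s a b))) ∨
    ∃ fe, Step ch h (.polygon s) (.residual { DiscreteNP.extend ch s a b with f := fe }) := by
  by_cases hN : (DiscreteNP.extend ch s a b).r * h ≤ (DiscreteNP.extend ch s a b).N
  · exact Or.inl ⟨hN, Step.halt s a b ha hb hcop hab hN⟩
  refine Or.inr ?_
  set τ := ch.root s b with hτ
  have h1 : τ ^ b = s.ϖ := ch.root_pow s b hb
  have hτ0 : τ ≠ 0 := by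
    intro h0
    rw [h0, zero_pow hb.ne'] at h1
    exact hs.unif_ne_zero hS h1.symm
  obtain ⟨i, j, -, hi, -, -, hall⟩ := hab.scaled hb (x := τ ^ a)
    (by rw [← pow_mul, mul_comm, pow_mul, h1])
  have hτA := self_mem_adjoinElem s.A τ
  have hmem : ∀ l, s.f.coeff l * (τ ^ a) ^ l ∈ adjoinElem s.A τ := fun l =>
    mul_mem (le_adjoinElem _ _ (hs.f_mem l)) (pow_mem (pow_mem hτA a) l)
  have hs' := hs.extend hS ch hb (hs.mul_dvd_of_hasSlope hS hc ch hb hcop hab) (a := a)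
    (p := s.f.comp (C (τ ^ a) * X)) (fun l => by rw [comp_C_mul_X_coeff]; exact hmem l)
  obtain ⟨m, hm⟩ := hs'.exists_eq_pow_mul hS (hmem i) (mul_ne_zero hi (pow_ne_zero _
    (pow_ne_zero _ hτ0)))
  have hm' : V.valuation (s.f.coeff i * (τ ^ a) ^ i) = V.valuation τ ^ m := hm
  have hτm : τ ^ m ≠ 0 := pow_ne_zero m hτ0
  refine ⟨C (τ ^ m)⁻¹ * s.f.comp (C (τ ^ a) * X), Step.scale s a b ha hb hcop hab (not_le.mp hN) m _
    ?_ ⟨fun l => ?_, i, ?_⟩⟩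
  · change C (τ ^ m) * _ = s.f.comp (C (τ ^ a) * X)
    rw [← mul_assoc, ← C_mul, mul_inv_cancel₀ hτm, C_1, one_mul]
  · rw [coeff_C_mul, comp_C_mul_X_coeff]
    obtain ⟨y, hy, hxy⟩ := hs'.div_pow hS (n := m) (hmem l) ((hall l).trans hm'.le)
    have hxy' : s.f.coeff l * (τ ^ a) ^ l = τ ^ m * y := hxy
    rw [hxy', inv_mul_cancel_left₀ hτm]
    exact hy
  · rw [coeff_C_mul, comp_C_mul_X_coeff, map_mul, hm', ← map_pow, ← map_mul,
      inv_mul_cancel₀ hτm, map_one]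

theorem Config.IsGood.exists_step [IsAlgClosed E] (hS : IsKummerSetting V k₀ π f M₀ ρ e)
    (ch : Choices V) (hd : 0 < f.natDegree) {x : Config E} (hx : x.IsGood V k₀ π f M₀ ρ e h) :
    (∃ s, x = .done s) ∨ ∃ y, Step ch h x y := by
  cases x with
  | done s => exact Or.inl ⟨s, rfl⟩
  | polygon s =>
    refine Or.inr ?_
    obtain ⟨hs, hc, -, -⟩ := hx
    by_cases h0 : s.f.coeff 0 = 0
    · exact ⟨_, Step.infinite s h0⟩
    by_cases hflat : ∀ a b : ℕ, 0 < a → 0 < b → ¬ HasSlope V s.ϖ s.f a b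
    · exact ⟨_, Step.flat s h0 hflat⟩
    push Not at hflat
    obtain ⟨a, b, ha, hb, hab⟩ := hflat
    -- The slope found need not be in lowest terms. Passing to a root of that value and back reduces
    -- the fraction.
    obtain ⟨y, hy, hv⟩ := hs.exists_root_of_hasSlope hS ch hb hab
    have hy0 : y ≠ 0 := by
      rintro rfl
      rw [← coeff_zero_eq_eval_zero] at hy
      exact h0 hy
    have hy1 : V.valuation y < 1 := by
      by_contra h1
      have h2 : V.valuation y ^ b = V.valuation s.ϖ ^ a := by
        rw [hv, ← pow_mul, mul_comm, pow_mul, ← map_pow, ch.root_pow s b hb]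
      exact absurd (h2 ▸ one_le_pow₀ (not_lt.mp h1))
        (not_le.mpr (pow_lt_one₀ zero_le (hs.unif_lt_one hS) ha.ne'))
    obtain ⟨a', b', ha', hb', hcop, -, hab'⟩ := hs.exists_hasSlope hS hc hy hy0 hy1
    rcases hs.exists_step_of_hasSlope hS hc ch ha' hb' hcop hab' with ⟨-, h1⟩ | ⟨fe, h1⟩
    exacts [⟨_, h1⟩, ⟨_, h1⟩]
  | residual s =>
    refine Or.inr ?_
    obtain ⟨hs, hc, hj⟩ := hx
    obtain ⟨j, hj0, hj⟩ := hj hd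
    obtain ⟨p, hp⟩ := exists_lift hs.le hs.f_mem
    have hF := hs.isField hS
    have := isAlgClosed_residueField (V := V)
    have hpj : (p.map (red V s.A)).coeff j ≠ 0 := by
      rw [coeff_map]
      intro h1
      have h2 : IsLocalRing.residue V (p.coeff j).1 = 0 := by
        rw [← coe_red, h1]; rfl
      rw [residue_eq_zero_iff_valuation] at h2
      have h3 : (((p.coeff j).1 : V) : E) = s.f.coeff j := by rw [← hp, coeff_map]; rfl
      rw [h3, hj] at h2
      exact lt_irrefl _ h2
    have hp0 : p.map (red V s.A) ≠ 0 := fun h0 => hpj (by rw [h0, coeff_zero])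
    obtain ⟨z, hz⟩ := IsAlgClosed.exists_root
      ((p.map (red V s.A)).map (resField V s.A).subtype) (by
        rw [degree_map_eq_of_injective Subtype.val_injective]
        exact fun h1 => hpj (coeff_eq_zero_of_degree_lt (by rw [h1]; exact_mod_cast hj0)))
    rw [IsRoot.def, eval_map] at hz
    obtain ⟨g, hirr, hdvd, -⟩ := exists_irreducible_of_root hF _ hp0 hz
    have hg : IsIrredFactor V s g := ⟨hirr, p, hp, hdvd⟩
    obtain ⟨w, hw⟩ := exists_root_of_irreducible hF (resField V s.A).subtype hirr
    have hdeg : g.natDegree ≠ 0 := by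
      intro h1
      rw [eq_C_of_natDegree_eq_zero h1, eval₂_C] at hw
      apply hirr.ne_zero
      rw [eq_C_of_natDegree_eq_zero h1, show g.coeff 0 = 0 from Subtype.ext hw, C_0]
    have hinj : Function.Injective (incl V s.A) := fun a b hab => Subtype.ext (Subtype.ext hab)
    obtain ⟨c, hroot⟩ := IsAlgClosed.exists_root ((ch.lift s g).map (incl V s.A)) (by
      intro h1
      apply hdeg
      rw [← ch.lift_natDegree s g, ← natDegree_map_eq_of_injective hinj]
      exact natDegree_eq_of_degree_eq_some h1)
    rw [IsRoot.def, eval_map] at hroot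
    exact ⟨_, Step.factor s g hg c hroot⟩

/-! ### Termination -/

/-- A bound for the number of remaining steps. -/
def Config.bound (e h : ℕ) : Config E → ℕ
  | .polygon s => if s.pass = 0 then 2 * (h * e) + 3 else 2 * (h * e - s.N * (e / s.r)) + 1
  | .residual s => 2 * (h * e - s.N * (e / s.r)) + 2
  | .done _ => 0

theorem State.IsGood.mul_lt {s : State E} (hs : s.IsGood V k₀ π M₀ ρ e h)
    (hS : IsKummerSetting V k₀ π f M₀ ρ e) (hc : s.IsCurrent V f h) :
    s.N * (e / s.r) < h * e := by
  have h1 : 0 < e / s.r :=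
    Nat.div_pos (Nat.le_of_dvd (Nat.pos_of_ne_zero hS.index_ne_zero) hs.r_dvd) hs.r_pos
  calc s.N * (e / s.r) < s.r * h * (e / s.r) := Nat.mul_lt_mul_of_pos_right hc.N_lt h1
    _ = h * (e / s.r * s.r) := by ring
    _ = h * e := by rw [Nat.div_mul_cancel hs.r_dvd]

/-- N·(e/r) is the value of ϖ^N in units of v(ρ): Kummer extensions do not change this unit, and
scaling strictly increases the number. A pass consists of two steps, whence the factor 2. The first
pass may leave N = 0, whence the larger bound at the start. -/
theorem Config.IsGood.bound_lt [IsAlgClosed E] (hS : IsKummerSetting V k₀ π f M₀ ρ e)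
    {ch : Choices V} {x y : Config E} (hx : x.IsGood V k₀ π f M₀ ρ e h) (hxy : Step ch h x y) :
    y.bound e h < x.bound e h := by
  have hy := hx.step hS hxy
  cases hxy with
  | infinite s h0 => simp only [Config.bound]; split_ifs <;> omega
  | flat s h0 hflat =>
    obtain ⟨hs, hc, hp0, hp⟩ := hx
    have hpass : s.pass = 0 := by
      by_contra hpass
      obtain ⟨y, hy, hy1⟩ := exists_root_of_valuation_eval_lt_one (z := 0)
        (fun i => (V.valuation_le_one_iff _).mpr (hs.le (hs.f_mem i))) hc.prim (by simp)
        (by rw [← coeff_zero_eq_eval_zero]; exact hp hpass)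
      rw [zero_sub, Valuation.map_neg] at hy1
      obtain ⟨a, b, ha, hb, -, -, hab⟩ := hs.exists_hasSlope hS hc hy (by
        rintro rfl
        rw [← coeff_zero_eq_eval_zero] at hy
        exact h0 hy) hy1
      exact hflat a b ha hb hab
    simp only [Config.bound, hpass, if_true]
    omega
  | zero s h0 hab =>
    simp only [Config.bound, h0, if_true]
    omega
  | halt s a b ha hb hcop hab hN => simp only [Config.bound]; split_ifs <;> omega
  | scale s a b ha hb hcop hab hN m fe hfe hprim =>
    obtain ⟨hs, hc, -, -⟩ := hx
    obtain ⟨hs', hc', -⟩ := hy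
    -- Staying below he makes the truncated subtraction a genuine one, so it really drops.
    have h1 := hs'.mul_lt hS hc'
    have hbr : b * s.r ∣ e := hs'.r_dvd
    change (b * s.N + a) * (e / (b * s.r)) < h * e at h1
    change 2 * (h * e - (b * s.N + a) * (e / (b * s.r))) + 2 < _
    have h2 : 0 < e / (b * s.r) := Nat.div_pos
      (Nat.le_of_dvd (Nat.pos_of_ne_zero hS.index_ne_zero) hbr) (Nat.mul_pos hb hs.r_pos)
    have h3 : e / s.r = b * (e / (b * s.r)) := by
      refine Nat.div_eq_of_eq_mul_left hs.r_pos ?_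
      rw [mul_right_comm, Nat.mul_div_cancel' hbr]
    have h4 : s.N * (e / s.r) < (b * s.N + a) * (e / (b * s.r)) := by
      rw [h3]
      have := Nat.mul_pos ha h2
      calc s.N * (b * (e / (b * s.r))) < b * s.N * (e / (b * s.r)) + a * (e / (b * s.r)) := by
            rw [show s.N * (b * (e / (b * s.r))) = b * s.N * (e / (b * s.r)) by ring]; omega
        _ = (b * s.N + a) * (e / (b * s.r)) := by ring
    simp only [Config.bound]
    split_ifs <;> omega
  | factor s g hg c hroot =>
    simp only [Config.bound, translate, Nat.succ_ne_zero, if_false]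
    omega

/-! ### Every root is found -/

/-- The root `γ` belongs to the branch. -/
def Config.Tracks (V : ValuationSubring E) (h : ℕ) (γ : E) : Config E → Prop
  | .polygon s => s.pass ≠ 0 → V.valuation (γ - s.P.eval s.ϖ) < V.valuation s.ϖ ^ s.N
  | .residual s => V.valuation (γ - s.P.eval s.ϖ) ≤ V.valuation s.ϖ ^ s.N
  | .done s => V.valuation (γ - s.P.eval s.ϖ) ≤ V.valuation s.ϖ ^ (s.r * h)

/-- The quotient y = (γ - P(ϖ))/ϖ^N is a root of the current polynomial. Its value selects the
segment and its residue selects the irreducible factor. -/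
theorem Config.Tracks.exists_step [IsAlgClosed E] (hS : IsKummerSetting V k₀ π f M₀ ρ e)
    (ch : Choices V) {γ : E} (hγ : aeval γ f = 0) (hγV : γ ∈ V) {x : Config E}
    (hx : x.IsGood V k₀ π f M₀ ρ e h) (ht : x.Tracks V h γ) :
    (∃ s, x = .done s) ∨ ∃ y, Step ch h x y ∧ y.Tracks V h γ := by
  have key : ∀ s : State E, s.IsGood V k₀ π M₀ ρ e h → s.IsCurrent V f h →
      ∃ y, s.f.eval y = 0 ∧ γ - s.P.eval s.ϖ = s.ϖ ^ s.N * y := by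
    intro s hs hc
    have h0 := pow_ne_zero s.N (hs.unif_ne_zero hS)
    refine ⟨(γ - s.P.eval s.ϖ) / s.ϖ ^ s.N, ?_, by field_simp⟩
    rw [State.IsGood.root_iff hc, mul_div_cancel₀ _ h0, add_sub_cancel, hγ]
  cases x with
  | done s => exact Or.inl ⟨s, rfl⟩
  | polygon s =>
    refine Or.inr ?_
    obtain ⟨hs, hc, hp0, -⟩ := hx
    obtain ⟨y, hy, hyγ⟩ := key s hs hc
    have hϖN : 0 < V.valuation s.ϖ ^ s.N := pow_pos (hs.unif_pos hS) _
    have hy1 : V.valuation y ≤ 1 := by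
      by_cases hpass : s.pass = 0
      · obtain ⟨-, hP, hN⟩ := hp0 hpass
        rw [hP, hN, eval_zero, sub_zero, pow_zero, one_mul] at hyγ
        rw [← hyγ]
        exact (V.valuation_le_one_iff _).mpr hγV
      · have h1 := ht hpass
        rw [hyγ, map_mul, map_pow] at h1
        exact ((mul_lt_iff_lt_one_right hϖN).mp h1).le
    by_cases hy0 : y = 0
    · refine ⟨_, Step.infinite s (by rw [hy0] at hy; rwa [coeff_zero_eq_eval_zero]), ?_⟩
      change V.valuation (γ - s.P.eval s.ϖ) ≤ _
      rw [hyγ, hy0, mul_zero, map_zero]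
      exact zero_le
    rcases hy1.lt_or_eq with hy1 | hy1
    · obtain ⟨a, b, ha, hb, hcop, hval, hab⟩ := hs.exists_hasSlope hS hc hy hy0 hy1
      have h1 := ch.root_pow s b hb
      have hτ1 : V.valuation (ch.root s b) ≤ 1 := by
        by_contra h2
        have h3 := hs.unif_lt_one hS
        rw [← h1, map_pow] at h3
        exact absurd h3 (not_lt.mpr (one_le_pow₀ (not_le.mp h2).le))
      have hval' : V.valuation y = V.valuation (ch.root s b) ^ a := by
        refine (pow_left_inj₀ zero_le zero_le hb.ne').mp ?_
        rw [hval, ← h1, map_pow, ← pow_mul, ← pow_mul, mul_comm]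
      have hγ' : V.valuation (γ - (Polynomial.expand E b s.P).eval (ch.root s b)) =
          V.valuation (ch.root s b) ^ (b * s.N + a) := by
        rw [expand_eval, h1, hyγ, map_mul, hval', pow_add, pow_mul, ← map_pow V.valuation _ b, h1, map_pow]
      rcases hs.exists_step_of_hasSlope hS hc ch ha hb hcop hab with ⟨hN, hstep⟩ | ⟨fe, hstep⟩
      · refine ⟨_, hstep, ?_⟩
        change V.valuation (γ - (Polynomial.expand E b s.P).eval (ch.root s b)) ≤
          V.valuation (ch.root s b) ^ (b * s.r * h)
        rw [hγ']
        exact pow_le_pow_of_le_one zero_le hτ1 hN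
      · exact ⟨_, hstep, hγ'.le⟩
    -- A y of value 1 can occur only before the first coefficient is recorded; it is served by the
    -- segment of slope zero.
    · have hpass : s.pass = 0 := by
        by_contra hpass
        have h1 := ht hpass
        rw [hyγ, map_mul, map_pow, hy1, mul_one] at h1
        exact lt_irrefl _ h1
      have hf0 : s.f ≠ 0 := by
        intro h0
        obtain ⟨i, hi⟩ := hc.prim
        simp [h0] at hi
      refine ⟨_, Step.zero s hpass (hasSlope_of_root hf0 hy hy0 (by rw [hy1, one_pow, pow_zero])),
        ?_⟩
      change V.valuation (γ - s.P.eval s.ϖ) ≤ V.valuation s.ϖ ^ s.N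
      rw [hyγ, map_mul, hy1, mul_one, map_pow]
  | residual s =>
    refine Or.inr ?_
    obtain ⟨hs, hc, -⟩ := hx
    obtain ⟨y, hy, hyγ⟩ := key s hs hc
    have hϖN : 0 < V.valuation s.ϖ ^ s.N := pow_pos (hs.unif_pos hS) _
    have hy1 : V.valuation y ≤ 1 := by
      have h1 : V.valuation (γ - s.P.eval s.ϖ) ≤ V.valuation s.ϖ ^ s.N := ht
      rw [hyγ, map_mul, map_pow] at h1
      exact (mul_le_iff_le_one_right hϖN).mp h1
    have hyV : y ∈ V := (V.valuation_le_one_iff _).mp hy1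
    obtain ⟨p, hp⟩ := exists_lift hs.le hs.f_mem
    have hF := hs.isField hS
    have hp0 : p.map (red V s.A) ≠ 0 := by
      intro h0
      obtain ⟨i, hi⟩ := hc.prim
      have h1 : red V s.A (p.coeff i) = 0 := by rw [← coeff_map, h0, coeff_zero]
      have h2 : IsLocalRing.residue V (p.coeff i).1 = 0 := by rw [← coe_red, h1]; rfl
      rw [residue_eq_zero_iff_valuation] at h2
      have h3 : (((p.coeff i).1 : V) : E) = s.f.coeff i := by rw [← hp, coeff_map]; rfl
      rw [h3, hi] at h2
      exact lt_irrefl _ h2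
    obtain ⟨g, hirr, hdvd, hroot⟩ := exists_irreducible_of_root hF (resField V s.A).subtype hp0
      (z := IsLocalRing.residue V ⟨y, hyV⟩)
      (by rw [eval₂_red_eq_zero_iff, ← eval_map, hp, hy]; simp)
    have hmap := ch.lift_map s g
    rw [← hmap, eval₂_red_eq_zero_iff, ← eval_map] at hroot
    -- Not every root of the lift will do: c must be the one congruent to y, so that γ remains on
    -- the branch.
    obtain ⟨c, hc0, hyc⟩ := exists_root_of_valuation_eval_lt_one (fun i => by
      rw [coeff_map, V.valuation_le_one_iff]
      exact ((ch.lift s g).coeff i).1.2) (by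
      refine ⟨g.natDegree, ?_⟩
      rw [coeff_map]
      change V.valuation (((ch.lift s g).coeff g.natDegree).1 : E) = 1
      rw [← residue_ne_zero_iff_valuation, ← coe_red, ← coeff_map, hmap]
      exact fun h0 => leadingCoeff_ne_zero.mpr hirr.ne_zero (Subtype.ext h0)) hy1 hroot
    rw [eval_map] at hc0
    refine ⟨_, Step.factor s g ⟨hirr, p, hp, hdvd⟩ c hc0, fun _ => ?_⟩
    change V.valuation (γ - (s.P + C c * X ^ s.N).eval s.ϖ) < V.valuation s.ϖ ^ s.N
    have h1 : γ - (s.P + C c * X ^ s.N).eval s.ϖ = s.ϖ ^ s.N * (y - c) := by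
      simp only [eval_add, eval_mul, eval_C, eval_pow, eval_X]
      linear_combination hyγ
    rw [h1, map_mul, map_pow]
    exact (mul_lt_iff_lt_one_right hϖN).mpr hyc

theorem Config.Tracks.exists_done [IsAlgClosed E] (hS : IsKummerSetting V k₀ π f M₀ ρ e)
    (ch : Choices V) {γ : E} (hγ : aeval γ f = 0) (hγV : γ ∈ V) {x : Config E}
    (hx : x.IsGood V k₀ π f M₀ ρ e h) (ht : x.Tracks V h γ) :
    ∃ s, Relation.ReflTransGen (Step ch h) x (.done s) ∧
      V.valuation (γ - s.P.eval s.ϖ) ≤ V.valuation s.ϖ ^ (s.r * h) := by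
  induction hn : x.bound e h using Nat.strong_induction_on generalizing x with
  | _ n ih =>
    rcases ht.exists_step hS ch hγ hγV hx with ⟨s, rfl⟩ | ⟨y, hxy, hty⟩
    · exact ⟨s, .refl, ht⟩
    · obtain ⟨s, hys, h1⟩ := ih _ (hn ▸ hx.bound_lt hS hxy) (hx.step hS hxy) hty rfl
      exact ⟨s, .head hxy hys, h1⟩

theorem isGood_init (hS : IsKummerSetting V k₀ π f M₀ ρ e) (hh : 0 < h) :
    (init E π f).IsGood V k₀ π f M₀ ρ e h := by
  have hmem : ∀ i, (f.map (algebraMap R E)).coeff i ∈ (algebraMap R E).range := fun i => by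
    rw [coeff_map]
    exact ⟨_, rfl⟩
  refine ⟨⟨one_pos, one_dvd _, pow_one _, le_rfl, ⟨π, rfl⟩, ?_, ?_, ?_, ⟨M₀, le_rfl, hS.tame, ?_⟩,
    hmem, ?_, ?_⟩, ⟨⟨f.natDegree, valuation_coeff_natDegree hS⟩, ⟨1, one_ne_zero, ?_⟩, ?_⟩,
    fun _ => ⟨rfl, rfl, rfl⟩, fun h0 => absurd rfl h0⟩
  · rintro _ ⟨x, rfl⟩
    exact hS.mem_base x
  · rintro _ ⟨x, rfl⟩ hx
    obtain ⟨y, rfl⟩ := hS.base_div x hx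
    exact ⟨_, ⟨y, rfl⟩, map_mul _ _ _⟩
  · rintro σ - - _ ⟨x, rfl⟩
    exact hS.fix_base σ x
  · rintro _ ⟨x, rfl⟩
    exact hS.base_mem x
  · intro i
    exact zero_mem _
  · change (0 : E[X]).degree < _
    rw [degree_zero]
    exact WithBot.bot_lt_coe _
  · change C 1 * f.map (algebraMap R E) =
      (f.map (algebraMap R E)).comp (C ((0 : E[X]).eval _) + C (_ ^ 0) * X)
    simp
  · change 0 < 1 * h
    omega

end Run

/-! ### Uniqueness of expansions -/

section Unique

variable {E : Type*} [Field E] {V : ValuationSubring E}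

theorem eval_mem_of_coeff_mem {A : Subring E} {p : E[X]} (hp : ∀ i, p.coeff i ∈ A) {x : E}
    (hx : x ∈ A) : p.eval x ∈ A := by
  rw [eval_eq_sum]
  exact sum_mem fun i _ => mul_mem (hp i) (pow_mem hx i)

/-- The lowest nonzero term has a unit coefficient and dominates all later ones. -/
theorem valuation_eval_of_natTrailingDegree {D : E[X]} {ϖ : E} (hϖ : V.valuation ϖ < 1)
    (hD : ∀ i, D.coeff i ∈ V) (h1 : V.valuation D.trailingCoeff = 1) :
    V.valuation (D.eval ϖ) = V.valuation ϖ ^ D.natTrailingDegree := by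
  obtain ⟨G, hG⟩ : X ^ D.natTrailingDegree ∣ D :=
    X_pow_dvd_iff.mpr fun _ => coeff_eq_zero_of_lt_natTrailingDegree
  have hcoeff : ∀ n, G.coeff n = D.coeff (n + D.natTrailingDegree) := fun n => by
    have h2 := congrArg (fun p : E[X] => p.coeff (n + D.natTrailingDegree)) hG
    exact (h2.trans (coeff_X_pow_mul _ _ _)).symm
  have hG0 : V.valuation (G.coeff 0) = 1 := by
    rw [hcoeff, zero_add]
    exact h1
  have hrest : V.valuation (G.divX.eval ϖ) ≤ 1 := (V.valuation_le_one_iff _).mpr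
    (eval_mem_of_coeff_mem (A := V.toSubring) (fun i => by
      rw [coeff_divX, hcoeff]
      exact hD _) ((V.valuation_le_one_iff _).mp hϖ.le))
  have hev : D.eval ϖ = ϖ ^ D.natTrailingDegree * (G.divX.eval ϖ * ϖ + G.coeff 0) := by
    have h2 := congrArg (eval ϖ) hG
    rw [eval_mul, eval_pow, eval_X] at h2
    rw [h2]
    conv_lhs => rw [← divX_mul_X_add G]
    simp
  have hlt : V.valuation (G.divX.eval ϖ * ϖ) < V.valuation (G.coeff 0) := by
    rw [hG0, map_mul, mul_comm]
    exact mul_lt_one_of_lt_of_le hϖ hrest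
  rw [hev, map_mul, map_pow, add_comm, V.valuation.map_add_eq_of_lt_left hlt, hG0, mul_one]

/-- Congruent representatives are equal, so the lowest nonzero coefficient of Q - P is a unit. Then
(Q - P)(ϖ) has the value of ϖ^i with i < H, although it must be divisible by ϖ^H. -/
theorem eq_of_approximates {B B' : Subring E} (hB : B ≤ V.toSubring) (hB' : B' ≤ V.toSubring)
    {ϖ : E} (hϖ : V.valuation ϖ < 1) (hϖ0 : ϖ ≠ 0) {H : ℕ} {γ : E} {P Q : E[X]} {S : Set E}
    (hS : IsRepresentatives V B' S) (hPS : ∀ i, P.coeff i ∈ S) (hQS : ∀ i, Q.coeff i ∈ S)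
    (hP : Approximates B ϖ H γ P) (hQ : Approximates B ϖ H γ Q) : Q = P := by
  obtain ⟨-, hSB, hrep⟩ := hS
  obtain ⟨hPd, t, ht, hPt⟩ := hP
  obtain ⟨hQd, u, hu, hQu⟩ := hQ
  by_contra hne
  have hD0 : Q - P ≠ 0 := sub_ne_zero.mpr hne
  have hDV : ∀ i, (Q - P).coeff i ∈ V := fun i => by
    rw [coeff_sub]
    exact sub_mem (hB' (hSB (hQS i))) (hB' (hSB (hPS i)))
  have hi : (Q - P).natTrailingDegree < H := by
    have h1 := (degree_sub_le Q P).trans_lt (max_lt hQd hPd)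
    rw [degree_eq_natDegree hD0, Nat.cast_lt] at h1
    exact (natTrailingDegree_le_natDegree _).trans_lt h1
  have htr : V.valuation (Q - P).trailingCoeff = 1 := by
    refine le_antisymm ((V.valuation_le_one_iff _).mpr (hDV _)) (not_lt.mp fun h1 => ?_)
    apply trailingCoeff_nonzero_iff_nonzero.mpr hD0
    rw [trailingCoeff, coeff_sub] at h1 ⊢
    obtain ⟨s, -, hs⟩ := hrep _ (hSB (hQS (Q - P).natTrailingDegree))
    rw [hs _ ⟨hPS _, h1⟩, hs _ ⟨hQS _, by simp⟩, sub_self]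
  have h1 := valuation_eval_of_natTrailingDegree hϖ hDV htr
  have h2 : (Q - P).eval ϖ = ϖ ^ H * (t - u) := by
    rw [eval_sub]
    linear_combination hPt - hQu
  have h3 : V.valuation (t - u) ≤ 1 :=
    (V.valuation_le_one_iff _).mpr (sub_mem (hB ht) (hB hu))
  rw [h2, map_mul, map_pow] at h1
  have hpos : 0 < V.valuation ϖ := by simpa [zero_lt_iff] using hϖ0
  have h4 := pow_lt_pow_right_of_lt_one₀ hpos hϖ hi
  rw [← h1] at h4
  exact absurd h4 (not_lt.mpr (mul_le_of_le_one_right zero_le h3))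

end Unique

/-! ### The Kummer extensions -/

section Kummer

variable {R K E : Type*} [CommRing R] [IsDomain R] [IsDiscreteValuationRing R]
    [Field K] [Algebra R K] [IsFractionRing R K]
    [Field E] [Algebra K E] [IsAlgClosure K E] [Algebra R E] [IsScalarTower R K E]
    {V : ValuationSubring E}

/-- The given ρ = ϖd^(d!/e) and the uniformizer ϖ of the splitting field have equal values, and
(ρ/ϖ)^e is a unit u of that field. As e is a unit, ρ/ϖ is a simple root of X^e - u modulo the
maximal ideal, so adjoining it is étale. -/
theorem exists_isKummerSetting
    (hV : ∀ x : K, algebraMap K E x ∈ V ↔ x ∈ (algebraMap R K).range)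
    {π : R} (hπ : Irreducible π) {f : R[X]} (hlead : IsUnit f.leadingCoeff) (hf : IsTame R K f)
    {ϖd : E} (hϖd : ϖd ^ f.natDegree.factorial = algebraMap R E π) :
    ∃ (e : ℕ) (M : IntermediateField K E), e ∣ f.natDegree.factorial ∧
      IsKummerSetting V (baseResidueField hV) π f M (ϖd ^ (f.natDegree.factorial / e)) e := by
  have hf0 : f ≠ 0 := by
    rintro rfl
    simp at hlead
  obtain ⟨e, hed, he, ϖ, M, hM, hϖ, hroot⟩ := exists_isTameField_of_isTame (E := E) hV hπ hf hf0
  set ρ := ϖd ^ (f.natDegree.factorial / e)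
  have he0 : e ≠ 0 := by
    rintro rfl
    simp at he
  have hρ : ρ ^ e = algebraMap R E π := by
    rw [← pow_mul, Nat.div_mul_cancel hed, hϖd]
  have hρϖ : V.valuation ρ = V.valuation ϖ := by
    refine (pow_left_inj₀ zero_le zero_le he0).mp ?_
    rw [hϖ, ← map_pow, hρ]
  have hϖ0 := hM.ne_zero
  have hc1 : V.valuation (ρ / ϖ) = 1 := by
    rw [map_div₀, hρϖ, div_self hM.valuation_pos.ne']
  have hce : (ρ / ϖ) ^ e = algebraMap R E π / ϖ ^ e := by rw [div_pow, hρ]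
  have hRM : ∀ x : R, algebraMap R E x ∈ M := fun x => by
    rw [IsScalarTower.algebraMap_apply R K E]
    exact IntermediateField.algebraMap_mem M _
  have huM : (ρ / ϖ) ^ e ∈ M := by
    rw [hce]
    exact div_mem (hRM π) (pow_mem hM.mem e)
  have hcV : ρ / ϖ ∈ V := (V.valuation_le_one_iff _).mp hc1.le
  obtain ⟨M', hMM', hcM', hM'⟩ := hM.adjoin_simple_root hcV (g := X ^ e - C ((ρ / ϖ) ^ e))
    (fun i => by
      rw [coeff_sub, coeff_X_pow, coeff_C]
      refine sub_mem ?_ ?_ <;> split_ifs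
      exacts [one_mem _, zero_mem _, huM, zero_mem _])
    (fun i => by
      rw [coeff_sub, coeff_X_pow, coeff_C]
      refine sub_mem ?_ ?_ <;> split_ifs
      exacts [one_mem _, zero_mem _, pow_mem hcV e, zero_mem _])
    (by simp) (by
      rw [derivative_sub, derivative_X_pow, derivative_C, sub_zero, eval_mul, eval_C, eval_pow,
        eval_X, map_mul, map_pow, hc1, one_pow, mul_one]
      exact he)
  have hρM' : ρ ∈ M' := by
    rw [← div_mul_cancel₀ ρ hϖ0]
    exact mul_mem hcM' hM'.mem
  refine ⟨e, M', hed, ?_⟩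
  exact {
    mem_base := algebraMap_mem_of_valuation hV
    base_le := baseResidueField_le hV le_rfl
    tame := hM'.congr hρM' hρϖ
    pow := hρ
    index := he
    root_mem := fun γ hγ => hMM' (hroot γ hγ)
    unit_lead := by
      refine le_antisymm ((V.valuation_le_one_iff _).mpr (algebraMap_mem_of_valuation hV _))
        (not_lt.mp fun h1 => ?_)
      rw [valuation_algebraMap_lt_one_iff hV] at h1
      exact h1 hlead
    base_mem := fun x => hMM' (hRM x)
    fix_base := fun σ x => by rw [IsScalarTower.algebraMap_apply R K E, σ.commutes]
    base_div := fun x hx => by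
      rw [valuation_algebraMap_lt_one_iff hV, hπ.maximalIdeal_eq,
        Ideal.mem_span_singleton] at hx
      exact hx }

variable {k₀ : Subfield (IsLocalRing.ResidueField V)} {π : R} {f : R[X]}
    {M₀ : IntermediateField K E} {ρ : E} {e h : ℕ} {s : State E}

set_option linter.unusedSectionVars false

theorem Reachable.isGood (hS : IsKummerSetting V k₀ π f M₀ ρ e) (hh : 0 < h) {ch : Choices V}
    {x : Config E} (hx : Reachable ch h π f x) : x.IsGood V k₀ π f M₀ ρ e h := by
  have hE : IsAlgClosed E := IsAlgClosure.isAlgClosed K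
  induction hx with
  | refl => exact isGood_init hS hh
  | tail _ h1 ih => exact ih.step hS h1

/-- Whatever roots the rule picks, the current uniformizer is a power of ρ times an r-th root of
unity. That root of unity is simple modulo the maximal ideal, so inertia fixes it and it lies in
K^sh. -/
theorem State.IsGood.kummerField_le (hs : s.IsGood V k₀ π M₀ ρ e h)
    (hS : IsKummerSetting V k₀ π f M₀ ρ e) {ϖ : E} (hρ : ρ ∈ K⟮ϖ⟯) :
    kummerField K V s.ϖ ≤ kummerField K V ϖ := by
  refine sup_le le_sup_left (adjoin_simple_le_iff.mpr ?_)
  have hρ0 := pow_ne_zero (e / s.r) hS.tame.ne_zero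
  set ζ := s.ϖ / ρ ^ (e / s.r) with hζ
  have hζr : ζ ^ s.r = 1 := by
    rw [hζ, _root_.div_pow, ← pow_mul, Nat.div_mul_cancel hs.r_dvd, hs.pow, hS.pow, div_self]
    rw [← hS.pow]
    exact pow_ne_zero _ hS.tame.ne_zero
  have hζ1 : V.valuation ζ = 1 := by
    have h1 := congrArg V.valuation hζr
    rw [map_pow, map_one] at h1
    exact (pow_eq_one_iff_of_nonneg zero_le hs.r_pos.ne').mp h1
  have hder : V.valuation ((derivative (X ^ s.r - 1 : E[X])).eval ζ) = 1 := by
    rw [derivative_sub, derivative_X_pow, derivative_one, sub_zero, eval_mul, eval_C, eval_pow,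
      eval_X, map_mul, map_pow, hζ1, one_pow, mul_one]
    exact hS.valuation_natCast hs.r_dvd
  have hζK : ζ ∈ strictHenselField K V := by
    rw [mem_strictHenselField_iff]
    refine ⟨isSeparable_of_simple_root (g := X ^ s.r - 1) (by simp [hζr]) ?_, fun σ hσ => ?_⟩
    · intro h0
      have h1 : (derivative (X ^ s.r - 1 : E[X])).eval ζ = 0 := by
        simpa [aeval_def, derivative_X_pow] using h0
      rw [h1, map_zero] at hder
      exact zero_ne_one hder
    · refine apply_eq_of_simple_root (σ := (σ : E →+* E)) (g := X ^ s.r - 1) hσ (fun i => ?_)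
        (fun i => ?_) ((V.valuation_le_one_iff _).mp hζ1.le) (by simp [hζr]) hder
      · rw [coeff_sub, coeff_X_pow, coeff_one]
        refine sub_mem ?_ ?_ <;> split_ifs
        exacts [one_mem _, zero_mem _, one_mem _, zero_mem _]
      · rw [coeff_sub, coeff_X_pow, coeff_one]
        split_ifs <;> simp
  rw [← div_mul_cancel₀ s.ϖ hρ0]
  exact mul_mem ((le_sup_left : strictHenselField K V ≤ _) hζK)
    (pow_mem ((le_sup_right : K⟮ϖ⟯ ≤ kummerField K V ϖ) hρ) _)

theorem State.IsGood.le_strictHenselRing (hs : s.IsGood V k₀ π M₀ ρ e h) :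
    s.A ≤ strictHenselRing K⟮s.ϖ⟯ V := by
  obtain ⟨M, -, hM, hAM⟩ := hs.field
  exact fun x hx => ⟨mem_strictHenselField_adjoin
    (mem_separableClosure_iff.mp (hM.sep (hAM x hx))) fun σ hσ hϖ => hs.fix σ hσ hϖ x hx, hs.le hx⟩

theorem mem_of_aeval_eq_zero
    (hV : ∀ x : K, algebraMap K E x ∈ V ↔ x ∈ (algebraMap R K).range)
    (hlead : IsUnit f.leadingCoeff) {γ : E} (hγ : aeval γ f = 0) : γ ∈ V := by
  obtain ⟨u, hu⟩ := hlead
  refine mem_of_isIntegral hV ⟨C (↑u⁻¹ : R) * f, ?_, ?_⟩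
  · rw [Monic, leadingCoeff_mul, leadingCoeff_C, ← hu, Units.inv_mul]
  · rw [← aeval_def, map_mul, hγ, mul_zero]

/-- Inertia elements fixing ρ fix all of `M₀`, so x lies in the strict Henselization of K(ρ), and
thus in K^sh(ρ). -/
theorem IsKummerSetting.mem_kummerField
    (hV : ∀ x : K, algebraMap K E x ∈ V ↔ x ∈ (algebraMap R K).range)
    (hS : IsKummerSetting V (baseResidueField hV) π f M₀ ρ e) {ϖ : E} (hρ : ρ ∈ K⟮ϖ⟯) {x : E}
    (hx : x ∈ M₀) : x ∈ kummerField K V ϖ := by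
  have hsep : ∀ y ∈ M₀, IsSeparable K y := fun y hy =>
    mem_separableClosure_iff.mp (hS.tame.sep hy)
  have h1 := strictHenselField_adjoin_le_kummerField (V := V) (hsep ρ hS.tame.mem) x
    (mem_strictHenselField_adjoin (hsep x hx) fun σ hσ hσρ => hS.tame.apply_eq hV hσ hσρ hx)
  exact (sup_le le_sup_left ((adjoin_simple_le_iff.mpr hρ).trans le_sup_right) :
    kummerField K V ρ ≤ kummerField K V ϖ) h1

theorem State.IsGood.isExpansion
    (hV : ∀ x : K, algebraMap K E x ∈ V ↔ x ∈ (algebraMap R K).range)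
    (hS : IsKummerSetting V (baseResidueField hV) π f M₀ ρ e)
    (hs : s.IsGood V (baseResidueField hV) π M₀ ρ e h) {ϖ : E} (hρ : ρ ∈ K⟮ϖ⟯) {γ : E}
    (hγ : aeval γ f = 0) (hγV : γ ∈ V)
    (hγP : V.valuation (γ - s.P.eval s.ϖ) ≤ V.valuation s.ϖ ^ (s.r * h)) :
    IsExpansion V (strictHenselRing K⟮s.ϖ⟯ V)
      ((kummerField K V ϖ).toSubfield.toSubring ⊓ V.toSubring) s.ϖ (s.r * h) γ s.P := by
  have hγF : γ ∈ kummerField K V ϖ := hS.mem_kummerField hV hρ (hS.root_mem γ hγ)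
  have hAF : ∀ x ∈ s.A, x ∈ kummerField K V ϖ := fun x hx => by
    obtain ⟨M, -, hM, hAM⟩ := hs.field
    exact hs.kummerField_le hS hρ (strictHenselField_adjoin_le_kummerField
      (mem_separableClosure_iff.mp (hM.sep (hAM _ hs.mem))) x (hs.le_strictHenselRing hx).1)
  have hϖ0 := pow_ne_zero (s.r * h) (hs.unif_ne_zero hS)
  have happ : Approximates ((kummerField K V ϖ).toSubfield.toSubring ⊓ V.toSubring) s.ϖ (s.r * h)
      γ s.P := by
    refine ⟨hs.P_deg, (γ - s.P.eval s.ϖ) / s.ϖ ^ (s.r * h), ⟨?_, ?_⟩, by field_simp; ring⟩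
    · change _ ∈ kummerField K V ϖ
      exact div_mem (sub_mem hγF (hAF _ (eval_mem_of_coeff_mem hs.P_mem hs.mem)))
        (pow_mem (hAF _ hs.mem) _)
    · refine (V.valuation_le_one_iff _).mp ?_
      rw [map_div₀, map_pow]
      exact div_le_one_of_le₀ hγP zero_le
  refine ⟨⟨hγF, hγV⟩, fun i => hs.le_strictHenselRing (hs.P_mem i), happ,
    fun S hrep hPS Q hQS hQ => ?_⟩
  exact eq_of_approximates inf_le_right inf_le_right (hs.unif_lt_one hS) (hs.unif_ne_zero hS) hrep
    hPS hQS happ hQ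

theorem exists_bound (hS : IsKummerSetting V k₀ π f M₀ ρ e) (hh : 0 < h) (ch : Choices V) {n : ℕ}
    {x : ℕ → Config E} (h0 : x 0 = init E π f) (hstep : ∀ i < n, Step ch h (x i) (x (i + 1))) :
    n ≤ (init E π f).bound e h := by
  have hE : IsAlgClosed E := IsAlgClosure.isAlgClosed K
  have key : ∀ i ≤ n, (x i).IsGood V k₀ π f M₀ ρ e h ∧
      (x i).bound e h + i ≤ (init E π f).bound e h := by
    intro i
    induction i with
    | zero => exact fun _ => h0.symm ▸ ⟨isGood_init hS hh, le_rfl⟩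
    | succ i ih =>
      intro hi
      obtain ⟨h1, h2⟩ := ih (Nat.le_of_succ_le hi)
      have h3 := hstep i hi
      have h4 := h1.bound_lt hS h3
      exact ⟨h1.step hS h3, by omega⟩
  exact le_trans (Nat.le_add_left n _) (key n le_rfl).2

end Kummer

end DiscreteNP

end

theorem mainTheorem10 {R K E : Type*}
    [CommRing R] [IsDomain R] [IsDiscreteValuationRing R]
    [Field K] [Algebra R K] [IsFractionRing R K]
    [Field E] [Algebra K E] [IsAlgClosure K E] [Algebra R E] [IsScalarTower R K E]
    -- an extension of the valuation to the algebraic closure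
    (V : ValuationSubring E)
    (hV : ∀ x : K, algebraMap K E x ∈ V ↔ x ∈ (algebraMap R K).range)
    (π : R) (hπ : Irreducible π)
    (f : R[X]) (hlead : IsUnit f.leadingCoeff) (hf : DiscreteNP.IsTame R K f)
    (h : ℕ) (hh : 0 < h)
    (ch : DiscreteNP.Choices V)
    -- a choice of `π ^ (1 / d!)`
    (ϖd : E) (hϖd : ϖd ^ f.natDegree.factorial = algebraMap R E π) :
    -- the Kummer extensions made, and all calculations, stay inside `K^sh(π ^ (1 / d!))`
    (∀ x, DiscreteNP.Reachable ch h π f x →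
      0 < x.state.r ∧ x.state.r ∣ f.natDegree.factorial ∧
      x.state.ϖ ^ x.state.r = algebraMap R E π ∧
      DiscreteNP.kummerField K V x.state.ϖ ≤ DiscreteNP.kummerField K V ϖd ∧
      x.state.A ≤ DiscreteNP.strictHenselRing K⟮x.state.ϖ⟯ V ∧
      ∀ i, x.state.f.coeff i ∈ x.state.A) ∧
    -- the steps can be carried out
    (∀ s, DiscreteNP.Reachable ch h π f (.residual s) →
      IsField (DiscreteNP.resField V s.A) ∧
      ∀ g, DiscreteNP.IsIrredFactor V s g → g.Separable) ∧
    (0 < f.natDegree → ∀ x, DiscreteNP.Reachable ch h π f x →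
      (∃ s, x = .done s) ∨ ∃ y, DiscreteNP.Step ch h x y) ∧
    -- the algorithm terminates
    (∃ M : ℕ, ∀ (n : ℕ) (x : ℕ → DiscreteNP.Config E), x 0 = DiscreteNP.init E π f →
      (∀ i < n, DiscreteNP.Step ch h (x i) (x (i + 1))) → n ≤ M) ∧
    -- every output is the expansion of a root up to height `r * h`
    (∀ s, DiscreteNP.Reachable ch h π f (.done s) → ∃ γ : E, Polynomial.aeval γ f = 0 ∧
      DiscreteNP.IsExpansion V (DiscreteNP.strictHenselRing K⟮s.ϖ⟯ V)
        ((DiscreteNP.kummerField K V ϖd).toSubfield.toSubring ⊓ V.toSubring)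
        s.ϖ (s.r * h) γ s.P) ∧
    -- the expansions of all roots are found
    (∀ γ : E, Polynomial.aeval γ f = 0 → ∃ s, DiscreteNP.Reachable ch h π f (.done s) ∧
      DiscreteNP.IsExpansion V (DiscreteNP.strictHenselRing K⟮s.ϖ⟯ V)
        ((DiscreteNP.kummerField K V ϖd).toSubfield.toSubring ⊓ V.toSubring)
        s.ϖ (s.r * h) γ s.P) := by
  have hE : IsAlgClosed E := IsAlgClosure.isAlgClosed K
  obtain ⟨e, M, hed, hS⟩ := DiscreteNP.exists_isKummerSetting hV hπ hlead hf hϖd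
  have hρ : ϖd ^ (f.natDegree.factorial / e) ∈ K⟮ϖd⟯ := pow_mem (mem_adjoin_simple_self K ϖd) _
  have hroot : ∀ γ : E, aeval γ f = 0 → γ ∈ V := fun γ hγ =>
    DiscreteNP.mem_of_aeval_eq_zero hV hlead hγ
  refine ⟨fun x hx => ?_, fun s hs => ?_, fun hd x hx => ?_, ?_, fun s hs => ?_, fun γ hγ => ?_⟩
  · have hs := (hx.isGood hS hh).isGood
    exact ⟨hs.r_pos, hs.r_dvd.trans hed, hs.pow, hs.kummerField_le hS hρ, hs.le_strictHenselRing,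
      hs.f_mem⟩
  · obtain ⟨hs, hc, -⟩ := hs.isGood hS hh
    exact ⟨hs.isField hS, fun g hg => hs.separable hS hc hg⟩
  · exact (hx.isGood hS hh).exists_step hS ch hd
  · exact ⟨_, fun n x h0 hstep => DiscreteNP.exists_bound hS hh ch h0 hstep⟩
  · obtain ⟨hs, γ, hγ, hγP⟩ := hs.isGood hS hh
    exact ⟨γ, hγ, hs.isExpansion hV hS hρ hγ (hroot γ hγ) hγP⟩
  -- At the start no coefficient has been recorded, so the tracking condition holds vacuously for
  -- every root.
  · obtain ⟨s, hs, hγP⟩ := DiscreteNP.Config.Tracks.exists_done hS ch hγ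
      (hroot γ hγ) (DiscreteNP.isGood_init hS hh)
      (fun h0 => absurd rfl h0)
    have hs' : DiscreteNP.Reachable ch h π f (.done s) := hs
    exact ⟨s, hs', (hs'.isGood hS hh).1.isExpansion hV hS hρ hγ (hroot γ hγ) hγP⟩
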